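/- **Setting.** Let $n\ge 2$, let $\varepsilon\ge \log n/\sqrt n$ and $\tau\ge n^{3/4}/\varepsilon$, and let $v_0\in\mathbb R^n$ be an arbitrary fixed unit vector. The input is $\mathbf T=\tau\, v_0^{\otimes 3}+\mathbf A$, where $\mathbf A$ is a symmetric Gaussian noise tensor: $A_{ijk}=A_{\pi(i)\pi(j)\pi(k)}$ for all permutations $\pi$ of the three indices, and otherwise the entries are i.i.d. standard Gaussians (one independent $\mathcal N(0,1)$ variable for each multiset $\{i,j,k\}$). **Algorithm.** Independently of each other and of $\mathbf T$, draw a Haar-random rotation $R\in SO(n)$, a uniformly random ordered partition $X\cup Y\cup Z$ of $[n]$ whose part sizes are those of the residue classes of $0,\dots,n-1$ modulo $3$ (thus differ by at most one), and three standard Gaussian vectors $g_X,g_Y,g_Z\in\mathbb R^n$. Let $T$ be the $n^2\times n$ unfolding of $\mathbf T$, let $U=(R\otimes R)TR^{\mathsf T}$ be the unfolding of $\mathbf U=R^{\otimes3}\mathbf T$, let $P_X,P_Y,P_Z$ be the diagonal coordinate projectors, and put $$M_X=P_XU^{\mathsf T}(P_Y\otimes P_Z)UP_X-\tfrac{n^2}{9}\,P_X,\qquad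 M_Y=P_YU^{\mathsf T}(P_Z\otimes P_X)UP_Y-\tfrac{n^2}{9}\,P_Y,\qquad M_Z=P_ZU^{\mathsf T}(P_X\otimes P_Y)UP_Z-\tfrac{n^2}{9}\,P_Z .$$ Run $k$ iterations of the matrix power method $x\mapsto M x/\|M x\|$ for each of these matrices, started at $g_X,g_Y,g_Z$ respectively, to obtain unit vectors $v_X^{(k)},v_Y^{(k)},v_Z^{(k)}$; replace each of them by its negative if the cubic form $x\mapsto\langle \mathbf U,x^{\otimes3}\rangle$ is negative on it; output the normalization $v^{(k)}$ of $R^{-1}(v_X^{(k)}+v_Y^{(k)}+v_Z^{(k)})$. (Here $0/0$ is read as $0$.) **Theorem.** There are absolute constants $C,\kappa>0$ and $p\in\mathbb N$ such that for all $n,\varepsilon,\tau,v_0$ as above, with $L=\max(1,\log(1/\varepsilon))$: 1. With probability at least $1-Cn^{-10}$ over $\mathbf A$ and the random choices of the algorithm, the following holds for every integer $k\ge\kappa\,(\log n)^p L$. The power method has converged: each iterate (before the choice of sign) is within distance $C\varepsilon$ of $w$ or of $-w$, for every top (unit) singular vector $w$ of the corresponding matrix $M_X$, $M_Y$, $M_Z$.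 And the output satisfies $\langle v^{(k)},v_0\rangle\ge 1-C\varepsilon$. 2. The algorithm runs in time $\tilde O(n^3\log(1/\varepsilon))$. More precisely, there is one fixed program, independent of $n,\varepsilon,\tau,v_0$, for a machine with exact real arithmetic (addition, subtraction, multiplication, division, square root and comparison, array access, bounded loops, each operation taking one step) and a tape of independent standard Gaussians, with the following properties. Given $n$, any tensor $\mathbf T\in(\mathbb R^n)^{\otimes 3}$ and any $k$, its output has exactly the distribution of the output $v^{(k)}$ of the algorithm on $\mathbf T$. With $k=\lceil\kappa(\log n)^pL\rceil$ iterations it always stops within $C\,n^3(\log n)^p L$ steps; this count includes the sampling of the rotation and the partition. -/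

import Mathlib

open MeasureTheory ProbabilityTheory
open scoped Matrix Kronecker

noncomputable section

namespace SpikedTensor

/-! ### The spiked tensor model with symmetric Gaussian noise -/

/-- Order-3 tensors of dimension `n`. -/
abbrev Tensor (n : ℕ) : Type := Fin n → Fin n → Fin n → ℝ

/-- The law of the free entries of the noise: one independent standard Gaussian for every unordered
triple (multiset of size three) of indices. -/
def noiseLaw (n : ℕ) : Measure (Sym (Fin n) 3 → ℝ) :=
  Measure.pi fun _ => gaussianReal 0 1

/-- The symmetric tensor with `A i j k = a {i, j, k}`. -/
def noiseTensor {n : ℕ} (a : Sym (Fin n) 3 → ℝ) : Tensor n :=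
  fun i j k => a ⟨({i, j, k} : Multiset (Fin n)), rfl⟩

/-- The input `T = τ • v₀ ⊗ v₀ ⊗ v₀ + A`. -/
def spikedTensor {n : ℕ} (τ : ℝ) (v₀ : EuclideanSpace ℝ (Fin n)) (a : Sym (Fin n) 3 → ℝ) :
    Tensor n :=
  fun i j k => τ * (v₀ i * v₀ j * v₀ k) + noiseTensor a i j k

/-! ### Random rotations -/

/-- The rotation group of `ℝⁿ`. -/
abbrev SO (n : ℕ) : Type := Matrix.specialOrthogonalGroup (Fin n) ℝ

instance instTopologicalGroupSO (n : ℕ) : IsTopologicalGroup (SO n) where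
  continuous_inv := by
    refine Continuous.subtype_mk ?_ _
    exact (continuous_star (R := Matrix (Fin n) (Fin n) ℝ)).comp continuous_subtype_val

instance instCompactSpaceSO (n : ℕ) : CompactSpace (SO n) := by
  apply isCompact_iff_compactSpace.mp
  have hcl : IsClosed {A : Matrix (Fin n) (Fin n) ℝ | A * star A = 1 ∧ A.det = 1} := by
    refine IsClosed.inter ?_ ?_
    · exact isClosed_eq (continuous_id.mul continuous_star) continuous_const
    · exact isClosed_eq (Continuous.matrix_det continuous_id) continuous_const
  have hbox : IsCompact {A : Matrix (Fin n) (Fin n) ℝ |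
      ∀ i, A i ∈ {r : Fin n → ℝ | ∀ j, r j ∈ Set.Icc (-1 : ℝ) 1}} :=
    isCompact_pi_infinite fun _ => isCompact_pi_infinite fun _ => isCompact_Icc
  refine (hbox.inter_left hcl).of_isClosed_subset ?_ ?_
  · convert hcl using 1
    ext A
    exact and_congr_left fun _ => Matrix.mem_orthogonalGroup_iff (Fin n) ℝ
  · intro A hA
    have hA' : A * star A = 1 := (Matrix.mem_orthogonalGroup_iff (Fin n) ℝ).1 hA.1
    refine ⟨⟨hA', hA.2⟩, fun i j => ?_⟩
    have := entry_norm_bound_of_unitary (𝕜 := ℝ) hA.1 i j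
    exact abs_le.1 this

instance instMeasurableSpaceSO (n : ℕ) : MeasurableSpace (SO n) := borel _

instance instBorelSpaceSO (n : ℕ) : BorelSpace (SO n) := ⟨rfl⟩

/-- The law of a uniformly random rotation: the Haar probability measure on the rotation group. -/
def rotationLaw (n : ℕ) : Measure (SO n) := Measure.haarMeasure ⊤

/-! ### Random partitions of the coordinates -/

instance instMeasurableSpacePerm (n : ℕ) : MeasurableSpace (Equiv.Perm (Fin n)) := ⊤

/-- A random partition of the coordinates into three parts `X, Y, Z` whose sizes differ by at most
one is encoded by a uniformly random permutation `σ`: coordinate `i` is in part `a` iff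
`σ i ≡ a` modulo `3`. -/
def permLaw (n : ℕ) : Measure (Equiv.Perm (Fin n)) :=
  (PMF.uniformOfFintype (Equiv.Perm (Fin n))).toMeasure

/-- The diagonal projector onto the coordinates in part `a`. -/
def partProj {n : ℕ} (σ : Equiv.Perm (Fin n)) (a : Fin 3) : Matrix (Fin n) (Fin n) ℝ :=
  Matrix.diagonal fun i => if (σ i : ℕ) % 3 = (a : ℕ) then 1 else 0

/-! ### The recovery algorithm -/

/-- The random choices of the algorithm: the rotation, the permutation that encodes the partition,
and the three Gaussian starting vectors of the power method. -/
abbrev Coins (n : ℕ) : Type := SO n × Equiv.Perm (Fin n) × (Fin 3 → Fin n → ℝ)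

/-- The joint law of the (independent) random choices. -/
def coinLaw (n : ℕ) : Measure (Coins n) :=
  (rotationLaw n).prod ((permLaw n).prod
    (Measure.pi fun _ => Measure.pi fun _ => gaussianReal 0 1))

/-- The `n² × n` unfolding `T` of a tensor. -/
def unfolding {n : ℕ} (T : Tensor n) : Matrix (Fin n × Fin n) (Fin n) ℝ :=
  Matrix.of fun p k => T p.1 p.2 k

/-- `U = (R ⊗ R) T Rᵀ`, the unfolding of the rotated tensor. -/
def rotatedUnfolding {n : ℕ} (T : Tensor n) (R : SO n) : Matrix (Fin n × Fin n) (Fin n) ℝ :=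
  (R.1 ⊗ₖ R.1) * unfolding T * R.1ᵀ

/-- The shifted matrix of part `a`; with `X, Y, Z` the parts `0, 1, 2`, in cyclic order, it is
`P_X Uᵀ (P_Y ⊗ P_Z) U P_X - (n² / 9) Id_X`, where `Id_X = P_X` is the identity of the coordinate
subspace `ℝ^X`, and likewise for `Y` with `P_Z ⊗ P_X` and for `Z` with `P_X ⊗ P_Y`. -/
def blockMatrix {n : ℕ} (T : Tensor n) (R : SO n) (σ : Equiv.Perm (Fin n)) (a : Fin 3) :
    Matrix (Fin n) (Fin n) ℝ :=
  partProj σ a * (rotatedUnfolding T R)ᵀ * (partProj σ (a + 1) ⊗ₖ partProj σ (a + 2)) *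
      rotatedUnfolding T R * partProj σ a
    - ((n : ℝ) ^ 2 / 9) • partProj σ a

/-- `x / ‖x‖` (and `0` for `x = 0`). -/
def normalized {n : ℕ} (x : EuclideanSpace ℝ (Fin n)) : EuclideanSpace ℝ (Fin n) :=
  ‖x‖⁻¹ • x

/-- The `k`-th iterate of the matrix power method for `M`, started at `g`. -/
def powerIterate {n : ℕ} (M : Matrix (Fin n) (Fin n) ℝ) (g : Fin n → ℝ) :
    ℕ → EuclideanSpace ℝ (Fin n)
  | 0 => normalized (WithLp.toLp 2 g)
  | k + 1 => normalized (Matrix.toEuclideanLin M (powerIterate M g k))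

/-- `w` is a top (right) singular vector of `M`: a unit vector on which `‖M w‖` is maximal. -/
def IsTopSingularVector {n : ℕ} (M : Matrix (Fin n) (Fin n) ℝ)
    (w : EuclideanSpace ℝ (Fin n)) : Prop :=
  ‖w‖ = 1 ∧ ∀ u : EuclideanSpace ℝ (Fin n), ‖u‖ = 1 →
    ‖Matrix.toEuclideanLin M u‖ ≤ ‖Matrix.toEuclideanLin M w‖

/-- The cubic form `⟨x ⊗ x ⊗ x, U⟩` of a tensor given by its unfolding. -/
def cubicForm {n : ℕ} (U : Matrix (Fin n × Fin n) (Fin n) ℝ)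
    (x : EuclideanSpace ℝ (Fin n)) : ℝ :=
  ∑ i, ∑ j, ∑ k, U (i, j) k * (x i * x j * x k)

/-- Singular vectors are only determined up to sign: choose the sign for which the cubic form
is nonnegative. -/
def fixSign {n : ℕ} (U : Matrix (Fin n × Fin n) (Fin n) ℝ)
    (x : EuclideanSpace ℝ (Fin n)) : EuclideanSpace ℝ (Fin n) :=
  if 0 ≤ cubicForm U x then x else -x

/-- The `k`-th power iterate for part `a` in a run of the algorithm. -/
def iterate {n : ℕ} (T : Tensor n) (ρ : Coins n) (k : ℕ) (a : Fin 3) :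
    EuclideanSpace ℝ (Fin n) :=
  powerIterate (blockMatrix T ρ.1 ρ.2.1 a) (ρ.2.2 a) k

/-- The output of the algorithm on input `T`, with random choices `ρ` and `k` iterations of the
power method: the normalization of `R⁻¹ (v_X + v_Y + v_Z)`. -/
def recover {n : ℕ} (T : Tensor n) (k : ℕ) (ρ : Coins n) : EuclideanSpace ℝ (Fin n) :=
  normalized (Matrix.toEuclideanLin (ρ.1⁻¹ : SO n).1
    (∑ a : Fin 3, fixSign (rotatedUnfolding T ρ.1) (iterate T ρ k a)))

end SpikedTensor

/-! ### A real-number machine with bounded loops and its running time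

Programs use natural-number index variables (bound by `for` loops), three-dimensional arrays
of reals named by natural numbers, and unit-cost exact real arithmetic. -/

namespace RealMachine

/-- Values of the index variables. -/
abbrev Env : Type := ℕ → ℕ

/-- Contents of the arrays: name of the array and three indices. -/
abbrev Mem : Type := ℕ → ℕ → ℕ → ℕ → ℝ

/-- Real expressions. Array indices are index variables. -/
inductive Expr : Type
  | num (m : ℕ)
  | idx (i : ℕ)
  | load (b i j k : ℕ)
  | add (x y : Expr)
  | sub (x y : Expr)
  | mul (x y : Expr)
  | div (x y : Expr)
  | sqrt (x : Expr)
  | ifLe (x y s t : Expr)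
  | sum (i bound : ℕ) (x : Expr)

/-- The value of an expression: `idx i` is the value of the index variable `i` as a real number,
`load b i j k` is the entry of array `b` at the values of the index variables `i, j, k`,
`ifLe x y s t` is `s` if `x ≤ y` and `t` otherwise, and `sum i bound x` is the sum of `x` over
all values of the index variable `i` below the value of the index variable `bound`. -/
def Expr.eval (m : Mem) : Expr → Env → ℝ
  | .num c, _ => c
  | .idx i, e => e i
  | .load b i j k, e => m b (e i) (e j) (e k)
  | .add x y, e => x.eval m e + y.eval m e
  | .sub x y, e => x.eval m e - y.eval m e
  | .mul x y, e => x.eval m e * y.eval m e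
  | .div x y, e => x.eval m e / y.eval m e
  | .sqrt x, e => Real.sqrt (x.eval m e)
  | .ifLe x y s t, e => if x.eval m e ≤ y.eval m e then s.eval m e else t.eval m e
  | .sum i b x, e => ∑ l ∈ Finset.range (e b), x.eval m (Function.update e i l)

/-- The number of steps for evaluating an expression. -/
def Expr.time (m : Mem) : Expr → Env → ℕ
  | .num _, _ => 1
  | .idx _, _ => 1
  | .load _ _ _ _, _ => 1
  | .add x y, e => x.time m e + y.time m e + 1
  | .sub x y, e => x.time m e + y.time m e + 1
  | .mul x y, e => x.time m e + y.time m e + 1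
  | .div x y, e => x.time m e + y.time m e + 1
  | .sqrt x, e => x.time m e + 1
  | .ifLe x y s t, e =>
      x.time m e + y.time m e + (if x.eval m e ≤ y.eval m e then s.time m e else t.time m e) + 1
  | .sum i b x, e => ∑ l ∈ Finset.range (e b), (x.time m (Function.update e i l) + 1) + 1

/-- Programs: store the value of an expression in one array cell, run two programs in sequence, or
run a program for all values of an index variable below the value of another one. -/
inductive Program : Type
  | store (b i j k : ℕ) (x : Expr)
  | seq (p q : Program)
  | loop (i bound : ℕ) (p : Program)

/-- Run `body 0, …, body (N - 1)` one after the other and count the steps. -/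
def iterateBody (body : ℕ → Mem → Mem × ℕ) (m : Mem) : ℕ → Mem × ℕ
  | 0 => (m, 1)
  | l + 1 =>
    let r := iterateBody body m l
    ((body l r.1).1, r.2 + (body l r.1).2 + 1)

/-- Execution of a program: the final contents of the arrays and the number of steps. -/
def Program.exec : Program → Env → Mem → Mem × ℕ
  | .store b i j k x, e, m =>
      (fun b' i' j' k' => if b' = b ∧ i' = e i ∧ j' = e j ∧ k' = e k then x.eval m e
        else m b' i' j' k', x.time m e + 1)
  | .seq p q, e, m =>
      let r := p.exec e m
      ((q.exec e r.1).1, r.2 + (q.exec e r.1).2 + 1)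
  | .loop i b p, e, m => iterateBody (fun l m' => p.exec (Function.update e i l) m') m (e b)

/-- A random tape of real numbers. -/
abbrev Tape : Type := ℕ × ℕ × ℕ → ℝ

/-- The entries of the tape are independent standard Gaussians. -/
def tapeLaw : Measure Tape := Measure.infinitePi fun _ => gaussianReal 0 1

/-- Initially index variable `0` has value `n`, index variable `1` has value `k`, and all other
index variables have value `0`. -/
def initEnv (n k : ℕ) : Env := fun i => if i = 0 then n else if i = 1 then k else 0

/-- Initially array `0` holds the input tensor, array `1` holds the random tape, and all other
cells hold `0`. -/
def initMem {n : ℕ} (T : Fin n → Fin n → Fin n → ℝ) (ω : Tape) : Mem := fun b i j k =>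
  if b = 0 then
    if h : i < n ∧ j < n ∧ k < n then T ⟨i, h.1⟩ ⟨j, h.2.1⟩ ⟨k, h.2.2⟩ else 0
  else if b = 1 then ω (i, j, k)
  else 0

/-- The output of a program is the vector stored in the first `n` cells of array `2`. -/
def Program.output (p : Program) {n : ℕ} (T : Fin n → Fin n → Fin n → ℝ) (k : ℕ) (ω : Tape) :
    EuclideanSpace ℝ (Fin n) :=
  WithLp.toLp 2 fun i => (p.exec (initEnv n k) (initMem T ω)).1 2 i 0 0

/-- The total number of steps of a program. -/
def Program.time (p : Program) {n : ℕ} (T : Fin n → Fin n → Fin n → ℝ) (k : ℕ) (ω : Tape) : ℕ :=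
  (p.exec (initEnv n k) (initMem T ω)).2

end RealMachine

end

/-! Why recovery works. Write `u = R v₀` and let `r_i` be the rows of `R`. By `blockForm_spiked`,
the form of `M_X` at a vector `h` of the span of the `r_i`, `i ∈ X`, is a signal `τ² m_Y m_Z ⟨u_X,
·⟩²` (with `m` the mass of `u` in a part), two cross terms, and the pure noise form `∑ ⟨A, r_i ⊗ r_j
⊗ h⟩² - n²/9 ‖h‖²` over `i ∈ Y`, `j ∈ Z`. The parts being disjoint, `r_i`, `r_j`, `h` are pairwise
orthogonal. So, in spite of the symmetry of `A`, each summand has variance `‖h‖²` up to index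
triples with a repetition, and these contribute only `O(n)` in total (`abs_sum_variance_sub_le`).
The shift by `n²/9` removes the mean, and a Chernoff bound for Gaussian quadratic forms with a union
bound over a net leaves a noise form of size `O(n^{3/2})`. The cross terms are `O(τ √n)`, because
the trilinear form of `A` is `O(√n)` on unit vectors. As `ε τ ≥ n^{3/4}`, everything except the
signal is `O(ε τ²)`.

A random rotation of `v₀` has the direction of a Gaussian vector, so each part carries mass `1/3 +
O(n^{-1/4})` (`rotationLaw_mask_tail`) and the signal has size of order `τ²`. Hence `M_X` is, up to
relative error `O(ε)`, of rank one (`blockForm_near_rank_one`). Its top singular vector is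
`O(ε)`-close to the direction of `±u_X` and the operator is at least four times smaller on the
complement (`top_singular_near`), so each power step gains a factor four (`exists_sign_power_near`).
A Gaussian start overlaps with the top vector by at least `n^{-11}` with the required probability,
so `18 log n` steps reach accuracy `1/n ≤ ε`; the factor `L ≥ 1` only adds iterations. The cubic
form, dominated by `τ ⟨u, x⟩³`, settles the sign. When the three directions are added, the
first-order effects of the mass deviations cancel and the second-order ones are `O(n^{-1/2}) ≤ O(ε)`
(`inner_normalized_sum_ge`).

Why it is fast. A power step contracts one index of the tensor at a time (`blockMat_mulVec_apply`),
at cost `O(n³)`, without forming the rotated tensor. Gram–Schmidt applied to a Gaussian matrix is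
equivariant under right multiplication by rotations, which gives Haar measure (`map_gsRot`) apart
from the sign of the determinant. That sign need not be computed: flipping rows of the rotation
together with coordinates of the starting vectors leaves the output unchanged (`recoverMat_flip`)
and preserves the Gaussian law. The ranks of independent Gaussian keys give the partition
(`map_sortPerm`). `recoverP_output` verifies the program on a fixed tape, and `recoverP_law`
transfers this to the distributions. -/

noncomputable section

/-! ### Nets in the unit ball -/

/-- The unit ball of a Euclidean space has a `1/2`-net of at most `5 ^ dim` points. -/
lemma exists_half_net (E : Type*) [NormedAddCommGroup E] [NormedSpace ℝ E]
    [FiniteDimensional ℝ E] :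
    ∃ N : Finset E, N.card ≤ 5 ^ Module.finrank ℝ E ∧ (∀ y ∈ N, ‖y‖ ≤ 1) ∧
      ∀ x : E, ‖x‖ ≤ 1 → ∃ y ∈ N, ‖x - y‖ ≤ 1 / 2 := by
  -- The net is half of a maximal `1`-separated subset of the ball of radius `2`, whose size a
  -- volume argument bounds by `5 ^ dim`.
  let P : Finset E → Prop := fun s => (∀ c ∈ s, ‖c‖ ≤ 2) ∧
    ∀ c ∈ s, ∀ d ∈ s, c ≠ d → 1 ≤ ‖c - d‖
  have hP : ∀ s, P s → s.card ≤ 5 ^ Module.finrank ℝ E := fun s hs =>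
    Besicovitch.card_le_of_separated s hs.1 hs.2
  obtain ⟨s, hs, hmax⟩ : ∃ s, P s ∧ ∀ t, P t → t.card ≤ s.card := by
    let S : Set ℕ := {m | ∃ s, P s ∧ s.card = m}
    have hne : S.Nonempty := ⟨0, ∅, ⟨by simp, by simp⟩, rfl⟩
    have hb : BddAbove S := ⟨5 ^ Module.finrank ℝ E, by rintro m ⟨s, hs, rfl⟩; exact hP s hs⟩
    obtain ⟨s, hs, hc⟩ := Nat.sSup_mem hne hb
    exact ⟨s, hs, fun t ht => hc ▸ le_csSup hb ⟨t, ht, rfl⟩⟩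
  classical
  refine ⟨s.image (fun c => (1 / 2 : ℝ) • c), Finset.card_image_le.trans (hP s hs), ?_, ?_⟩
  · intro y hy
    obtain ⟨c, hc, rfl⟩ := Finset.mem_image.1 hy
    have := hs.1 c hc
    rw [norm_smul]
    norm_num
    linarith
  · intro x hx
    -- Otherwise `2 • x` could be added to the maximal separated set.
    by_contra! hcon
    have key : ∀ c ∈ s, 1 ≤ ‖(2 : ℝ) • x - c‖ := by
      intro c hc
      have h1 := hcon _ (Finset.mem_image_of_mem _ hc)
      have h2 : (2 : ℝ) • x - c = (2 : ℝ) • (x - (1 / 2 : ℝ) • c) := by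
        rw [smul_sub, smul_smul]; norm_num
      rw [h2, norm_smul]
      norm_num at h1 ⊢
      linarith
    have hnot : (2 : ℝ) • x ∉ s := fun h => by
      have := key _ h
      simp at this
      linarith
    have hbig := hmax (insert ((2 : ℝ) • x) s) ⟨?_, ?_⟩
    · rw [Finset.card_insert_of_notMem hnot] at hbig
      omega
    · intro c hc
      rcases Finset.mem_insert.1 hc with rfl | hc
      · rw [norm_smul]; norm_num; linarith
      · exact hs.1 c hc
    · intro c hc d hd hcd
      rcases Finset.mem_insert.1 hc with rfl | hc <;> rcases Finset.mem_insert.1 hd with rfl | hd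
      · exact absurd rfl hcd
      · exact key d hd
      · rw [norm_sub_rev]; exact key c hc
      · exact hs.2 c hc d hd hcd

/-- A linear functional is controlled by its values on a `1/2`-net. -/
lemma LinearMap.abs_le_of_half_net {E : Type*} [NormedAddCommGroup E] [NormedSpace ℝ E]
    [FiniteDimensional ℝ E] {N : Finset E}
    (hN : ∀ x : E, ‖x‖ ≤ 1 → ∃ y ∈ N, ‖x - y‖ ≤ 1 / 2) (f : E →ₗ[ℝ] ℝ) {c : ℝ}
    (hf : ∀ y ∈ N, |f y| ≤ c) (x : E) : |f x| ≤ 2 * c * ‖x‖ := by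
  let F : E →L[ℝ] ℝ := LinearMap.toContinuousLinearMap f
  have hc : 0 ≤ c := by
    obtain ⟨y, hy, -⟩ := hN 0 (by simp)
    exact (abs_nonneg _).trans (hf y hy)
  -- The norm is bounded by itself: replacing a unit vector by a net point costs at most `‖F‖ / 2`.
  -- Since `‖F‖` is finite, it can be absorbed.
  have h1 : ‖F‖ ≤ c + ‖F‖ / 2 := by
    refine ContinuousLinearMap.opNorm_le_of_unit_norm (by positivity) fun x hx => ?_
    obtain ⟨y, hy, hxy⟩ := hN x hx.le
    have h2 : F x = F y + F (x - y) := by rw [map_sub]; ring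
    have h3 : ‖F (x - y)‖ ≤ ‖F‖ * (1 / 2) :=
      (F.le_opNorm _).trans (mul_le_mul_of_nonneg_left hxy (norm_nonneg _))
    have h4 : ‖F y‖ ≤ c := hf y hy
    rw [h2]
    refine (norm_add_le _ _).trans ?_
    linarith
  have h5 : ‖F x‖ ≤ ‖F‖ * ‖x‖ := F.le_opNorm x
  have h6 : ‖F‖ ≤ 2 * c := by linarith
  exact h5.trans (mul_le_mul_of_nonneg_right h6 (norm_nonneg _))

/-! ### Concentration of Gaussian quadratic forms -/

/-- With `y = 2 * s` this turns the exact value `(1 - 2 s)^{-1/2}` of the moment generating function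
of a squared Gaussian into the bound `exp (s + 2 s²)`. For `y ≥ 0` the second-order Taylor bound of
`exp` is needed; for `y ≤ 0` the first-order one suffices. -/
lemma exp_neg_sub_sq_le {y : ℝ} (h1 : -(1 / 2) ≤ y) (h2 : y ≤ 1 / 2) :
    Real.exp (-(y + y ^ 2)) ≤ 1 - y := by
  rw [Real.exp_neg]
  apply inv_le_of_inv_le₀ (by linarith)
  rw [inv_le_iff_one_le_mul₀' (by linarith)]
  rcases le_total 0 y with hy | hy
  · have hz : 0 ≤ y + y ^ 2 := by positivity
    have := Real.quadratic_le_exp_of_nonneg hz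
    have h3 : 1 ≤ (1 - y) * (1 + (y + y ^ 2) + (y + y ^ 2) ^ 2 / 2) := by
      have : 0 ≤ y ^ 2 * (1 - y - y ^ 2 - y ^ 3) := by
        have h4 : y ^ 2 ≤ 1 / 4 := by nlinarith
        have h5 : y ^ 3 ≤ 1 / 8 := by nlinarith
        have : 0 ≤ 1 - y - y ^ 2 - y ^ 3 := by linarith
        positivity
      nlinarith
    exact h3.trans (mul_le_mul_of_nonneg_left this (by linarith))
  · have := Real.add_one_le_exp (y + y ^ 2)
    have h3 : 1 ≤ (1 - y) * (y + y ^ 2 + 1) := by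
      have : 0 ≤ -y * y ^ 2 := mul_nonneg (by linarith) (sq_nonneg _)
      nlinarith
    exact h3.trans (mul_le_mul_of_nonneg_left this (by linarith))

lemma gaussianReal_withDensity_integral (f : ℝ → ℝ) :
    ∫ x, f x ∂(gaussianReal 0 1) =
      ∫ x, (Real.sqrt (2 * Real.pi))⁻¹ * Real.exp (-x ^ 2 / 2) * f x := by
  rw [integral_gaussianReal_eq_integral_smul (by norm_num)]
  simp [gaussianPDFReal]

lemma integrable_exp_mul_sq_gaussian {s : ℝ} (hs : s < 1 / 2) :
    Integrable (fun x : ℝ => Real.exp (s * x ^ 2)) (gaussianReal 0 1) := by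
  rw [gaussianReal_of_var_ne_zero _ (by norm_num),
    integrable_withDensity_iff (measurable_gaussianPDF _ _)
      (ae_of_all _ fun _ => gaussianPDF_lt_top)]
  have h := (integrable_exp_neg_mul_sq (b := 1 / 2 - s) (by linarith)).const_mul
    ((Real.sqrt (2 * Real.pi))⁻¹)
  refine h.congr (ae_of_all _ fun x => ?_)
  simp only [toReal_gaussianPDF, gaussianPDFReal]
  rw [mul_comm (Real.exp (s * x ^ 2)), mul_assoc, ← Real.exp_add]
  simp only [NNReal.coe_one, mul_one, sub_zero]
  congr 2
  ring

lemma integral_exp_mul_sq_gaussian_le {s : ℝ} (h1 : -(1 / 4) ≤ s) (h2 : s ≤ 1 / 4) :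
    ∫ x : ℝ, Real.exp (s * x ^ 2) ∂(gaussianReal 0 1) ≤ Real.exp (s + 2 * s ^ 2) := by
  rw [gaussianReal_withDensity_integral]
  have : ∀ x : ℝ, (Real.sqrt (2 * Real.pi))⁻¹ * Real.exp (-x ^ 2 / 2) * Real.exp (s * x ^ 2) =
      (Real.sqrt (2 * Real.pi))⁻¹ * Real.exp (-(1 / 2 - s) * x ^ 2) := fun x => by
    rw [mul_assoc, ← Real.exp_add]; congr 2; ring
  simp_rw [this]
  rw [integral_const_mul, integral_gaussian, ← Real.sqrt_inv,
    ← Real.sqrt_mul (by positivity), Real.sqrt_le_left (by positivity), ← Real.exp_nat_mul]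
  have hpi := Real.pi_pos
  have hpos : 0 < 1 - 2 * s := by linarith
  have e1 : (2 * Real.pi)⁻¹ * (Real.pi / (1 / 2 - s)) = (1 - 2 * s)⁻¹ := by
    have : (1 / 2 - s) ≠ 0 := by linarith
    field_simp
  rw [e1]
  apply inv_le_of_inv_le₀ (Real.exp_pos _)
  rw [← Real.exp_neg]
  have := exp_neg_sub_sq_le (y := 2 * s) (by linarith) (by linarith)
  have e2 : -(((2 : ℕ) : ℝ) * (s + 2 * s ^ 2)) = -(2 * s + (2 * s) ^ 2) := by push_cast; ring
  rwa [e2]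

section QuadraticForm

variable {ι : Type*} [Fintype ι]

/-- The product of standard Gaussians. -/
abbrev gaussianPi (ι : Type*) [Fintype ι] : Measure (ι → ℝ) :=
  Measure.pi fun _ : ι => gaussianReal 0 1

lemma integrable_exp_weighted_sq (c : ι → ℝ) (hc : ∀ i, c i ≤ 1 / 4) :
    Integrable (fun z : ι → ℝ => Real.exp (∑ i, c i * z i ^ 2)) (gaussianPi ι) := by
  simp_rw [Real.exp_sum]
  exact Integrable.fintype_prod (f := fun i x => Real.exp (c i * x ^ 2))
    fun i => integrable_exp_mul_sq_gaussian (by linarith [hc i])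

lemma integral_exp_weighted_sq_le (c : ι → ℝ) (hc : ∀ i, |c i| ≤ 1 / 4) :
    ∫ z : ι → ℝ, Real.exp (∑ i, c i * z i ^ 2) ∂(gaussianPi ι) ≤
      Real.exp (∑ i, (c i + 2 * c i ^ 2)) := by
  simp_rw [Real.exp_sum]
  rw [integral_fintype_prod_eq_prod (f := fun i x => Real.exp (c i * x ^ 2))]
  exact Finset.prod_le_prod (fun i _ => integral_nonneg fun x => (Real.exp_pos _).le)
    fun i _ => integral_exp_mul_sq_gaussian_le (abs_le.1 (hc i)).1 (abs_le.1 (hc i)).2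

/-- Two-sided concentration of a weighted sum of squares of independent standard Gaussians. -/
lemma gaussianPi_weighted_sq_tail (c : ι → ℝ) {b l t : ℝ} (hc0 : ∀ i, 0 ≤ c i)
    (hcb : ∀ i, c i ≤ b) (hl : 0 ≤ l) (hlb : l * b ≤ 1 / 4) :
    (gaussianPi ι).real {z | t ≤ |∑ i, c i * z i ^ 2 - ∑ i, c i|} ≤
      2 * Real.exp (2 * l ^ 2 * b * (∑ i, c i) - l * t) := by
  -- The sign `σ` treats the upper and the lower tail by the same Chernoff argument.
  have main : ∀ σ : ℝ, |σ| = 1 →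
      (gaussianPi ι).real {z | t ≤ σ * (∑ i, c i * z i ^ 2 - ∑ i, c i)} ≤
        Real.exp (2 * l ^ 2 * b * (∑ i, c i) - l * t) := by
    intro σ hσ
    have hσ2 : σ ^ 2 = 1 := by rw [← sq_abs, hσ]; norm_num
    have hlc : ∀ i, |l * σ * c i| ≤ 1 / 4 := fun i => by
      rw [abs_mul, abs_mul, hσ, abs_of_nonneg hl, abs_of_nonneg (hc0 i), mul_one]
      exact (mul_le_mul_of_nonneg_left (hcb i) hl).trans hlb
    have e : ∀ z : ι → ℝ, Real.exp (l * (σ * (∑ i, c i * z i ^ 2 - ∑ i, c i))) =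
        Real.exp (∑ i, l * σ * c i * z i ^ 2) * Real.exp (-(∑ i, l * σ * c i)) := fun z => by
      rw [← Real.exp_add]
      congr 1
      simp_rw [mul_assoc, ← Finset.mul_sum]
      ring
    have hint : Integrable (fun z : ι → ℝ =>
        Real.exp (l * (σ * (∑ i, c i * z i ^ 2 - ∑ i, c i)))) (gaussianPi ι) := by
      simp_rw [e]
      exact (integrable_exp_weighted_sq _ fun i => (abs_le.1 (hlc i)).2).mul_const _
    refine (measure_ge_le_exp_mul_mgf t hl hint).trans ?_
    rw [mgf]
    simp_rw [e]
    rw [integral_mul_const]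
    have h1 := integral_exp_weighted_sq_le _ hlc
    have h2 := mul_le_mul_of_nonneg_right h1 (Real.exp_pos (-(∑ i, l * σ * c i))).le
    refine (mul_le_mul_of_nonneg_left h2 (Real.exp_pos _).le).trans ?_
    rw [← Real.exp_add, ← Real.exp_add, Real.exp_le_exp, Finset.sum_add_distrib]
    -- The squares are linearized by `c i ^ 2 ≤ b * c i`, so that only the largest weight and the
    -- sum of the weights matter.
    have h3 : ∑ i, 2 * (l * σ * c i) ^ 2 ≤ 2 * l ^ 2 * b * ∑ i, c i := by
      rw [Finset.mul_sum]
      refine Finset.sum_le_sum fun i _ => ?_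
      have : (l * σ * c i) ^ 2 = l ^ 2 * (c i * c i) := by rw [mul_pow, mul_pow, hσ2]; ring
      rw [this]
      have h4 := mul_le_mul_of_nonneg_right (hcb i) (hc0 i)
      have h5 := mul_le_mul_of_nonneg_left h4 (sq_nonneg l)
      nlinarith
    linarith
  have hsub : {z : ι → ℝ | t ≤ |∑ i, c i * z i ^ 2 - ∑ i, c i|} ⊆
      {z | t ≤ 1 * (∑ i, c i * z i ^ 2 - ∑ i, c i)} ∪
      {z | t ≤ (-1) * (∑ i, c i * z i ^ 2 - ∑ i, c i)} := by
    intro z hz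
    have hz' : t ≤ |∑ i, c i * z i ^ 2 - ∑ i, c i| := hz
    rcases le_abs.1 hz' with h | h
    · left; simpa using h
    · right; simpa using h
  refine (measureReal_mono hsub).trans ((measureReal_union_le _ _).trans ?_)
  have := main 1 (by norm_num)
  have := main (-1) (by norm_num)
  linarith

/-- Concentration of `‖L a‖²` for a standard Gaussian vector `a`. -/
lemma gaussianPi_norm_sq_tail {F : Type*} [NormedAddCommGroup F] [InnerProductSpace ℝ F]
    [FiniteDimensional ℝ F] (f : EuclideanSpace ℝ ι →ₗ[ℝ] F) {b l t : ℝ}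
    (hb : ∀ x, ‖f x‖ ^ 2 ≤ b * ‖x‖ ^ 2) (hl : 0 ≤ l) (hlb : l * b ≤ 1 / 4) [DecidableEq ι] :
    (gaussianPi ι).real {a | t ≤ |‖f (WithLp.toLp 2 a)‖ ^ 2 -
        ∑ i, ‖f (EuclideanSpace.single i 1)‖ ^ 2|} ≤
      2 * Real.exp (2 * l ^ 2 * b * (∑ i, ‖f (EuclideanSpace.single i 1)‖ ^ 2) - l * t) := by
  -- In an eigenbasis of `f* f`, which by rotation invariance again has independent Gaussian
  -- coordinates, `‖f a‖²` is a weighted sum of squares. The weights are the eigenvalues and their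
  -- sum is the trace.
  have hsym : (f.adjoint ∘ₗ f).IsSymmetric := fun x y => by
    simp [LinearMap.adjoint_inner_left, LinearMap.adjoint_inner_right]
  let e := hsym.eigenvectorBasis (n := Fintype.card ι) (by simp)
  let μ := hsym.eigenvalues (n := Fintype.card ι) (by simp)
  have happ : ∀ i, (f.adjoint ∘ₗ f) (e i) = μ i • e i := fun i => by
    exact hsym.apply_eigenvectorBasis (by simp) i
  have hinner : ∀ x y, inner ℝ (f x) (f y) = inner ℝ x ((f.adjoint ∘ₗ f) y) := fun x y => by
    simp [LinearMap.adjoint_inner_right]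
  have hμ : ∀ i, μ i = ‖f (e i)‖ ^ 2 := fun i => by
    rw [← real_inner_self_eq_norm_sq, hinner, happ, inner_smul_right,
      real_inner_self_eq_norm_sq, e.norm_eq_one]
    simp
  have htr : ∑ i, ‖f (EuclideanSpace.single i 1)‖ ^ 2 = ∑ i, μ i := by
    have h1 := (f.adjoint ∘ₗ f).trace_eq_sum_inner e
    have h2 := (f.adjoint ∘ₗ f).trace_eq_sum_inner (EuclideanSpace.basisFun ι ℝ)
    have h3 : ∑ i, μ i = ∑ i, inner ℝ (e i) ((f.adjoint ∘ₗ f) (e i)) :=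
      Finset.sum_congr rfl fun i _ => by rw [← hinner, real_inner_self_eq_norm_sq, hμ]
    have h4 : ∑ i, ‖f (EuclideanSpace.single i 1)‖ ^ 2 =
        ∑ i, inner ℝ (EuclideanSpace.basisFun ι ℝ i)
          ((f.adjoint ∘ₗ f) (EuclideanSpace.basisFun ι ℝ i)) :=
      Finset.sum_congr rfl fun i _ => by
        rw [← hinner, real_inner_self_eq_norm_sq, EuclideanSpace.basisFun_apply]
    rw [h3, h4, ← h1, ← h2]
  have hnorm : ∀ z : Fin (Fintype.card ι) → ℝ, ‖f (∑ i, z i • e i)‖ ^ 2 =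
      ∑ i, μ i * z i ^ 2 := fun z => by
    rw [← real_inner_self_eq_norm_sq, hinner, map_sum]
    simp_rw [map_smul, happ, sum_inner, inner_sum, inner_smul_left, inner_smul_right,
      orthonormal_iff_ite.1 e.orthonormal]
    simp
    exact Finset.sum_congr rfl fun i _ => by ring
  rw [htr]
  have hlaw : (gaussianPi ι).map (WithLp.toLp 2) =
      (gaussianPi (Fin (Fintype.card ι))).map (fun z => ∑ i, z i • e i) := by
    rw [map_pi_eq_stdGaussian, stdGaussian_eq_map_pi_orthonormalBasis e]
  have hcont : Continuous fun x : EuclideanSpace ℝ ι => |‖f x‖ ^ 2 - ∑ i, μ i| := by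
    have := f.continuous_of_finiteDimensional
    fun_prop
  have hmeas : MeasurableSet {x : EuclideanSpace ℝ ι | t ≤ |‖f x‖ ^ 2 - ∑ i, μ i|} :=
    measurableSet_le measurable_const hcont.measurable
  have h1 : (gaussianPi ι).real {a | t ≤ |‖f (WithLp.toLp 2 a)‖ ^ 2 - ∑ i, μ i|} =
      (gaussianPi (Fin (Fintype.card ι))).real {z | t ≤ |∑ i, μ i * z i ^ 2 - ∑ i, μ i|} := by
    have h2 := map_measureReal_apply (μ := gaussianPi ι) (f := WithLp.toLp 2)
      (by fun_prop) hmeas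
    have h3 := map_measureReal_apply (μ := gaussianPi (Fin (Fintype.card ι)))
      (f := fun z => ∑ i, z i • e i) (by fun_prop) hmeas
    rw [hlaw, h3] at h2
    simp only [Set.preimage_ofPred_eq, hnorm] at h2
    exact h2.symm
  rw [h1]
  refine gaussianPi_weighted_sq_tail μ (fun i => by rw [hμ]; positivity) (fun i => ?_) hl hlb
  rw [hμ]
  simpa using hb (e i)

/-- A linear form of independent standard Gaussians is Gaussian. -/
lemma gaussianPi_map_linear (c : ι → ℝ) :
    (gaussianPi ι).map (fun a => ∑ i, c i * a i) =
      gaussianReal 0 (∑ i, c i ^ 2).toNNReal := by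
  let L : StrongDual ℝ (EuclideanSpace ℝ ι) := innerSL ℝ (WithLp.toLp 2 c)
  have h1 : (fun a : ι → ℝ => ∑ i, c i * a i) = L ∘ WithLp.toLp 2 := by
    ext a
    simp [L, PiLp.inner_apply, mul_comm]
  rw [h1, ← Measure.map_map (by fun_prop) (by fun_prop), map_pi_eq_stdGaussian,
    IsGaussian.map_eq_gaussianReal, variance_dual_stdGaussian,
    integral_strongDual_stdGaussian, innerSL_apply_norm, EuclideanSpace.real_norm_sq_eq]

lemma gaussianPi_linear_tail (c : ι → ℝ) {b t : ℝ} (hb : 0 < b) (hc : ∑ i, c i ^ 2 ≤ b)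
    (ht : 0 ≤ t) :
    (gaussianPi ι).real {a | t ≤ |∑ i, c i * a i|} ≤ 2 * Real.exp (-t ^ 2 / (2 * b)) := by
  have hv : ((∑ i, c i ^ 2).toNNReal : ℝ) = ∑ i, c i ^ 2 :=
    Real.coe_toNNReal _ (Finset.sum_nonneg fun i _ => sq_nonneg _)
  have main : ∀ d : ι → ℝ, ∑ i, d i ^ 2 = ∑ i, c i ^ 2 →
      (gaussianPi ι).real {a | t ≤ ∑ i, d i * a i} ≤ Real.exp (-t ^ 2 / (2 * b)) := by
    intro d hd
    have hmap := gaussianPi_map_linear d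
    -- The Chernoff parameter `t / b` minimizes `b s² / 2 - s t`.
    have hs : 0 ≤ t / b := by positivity
    have hint : Integrable (fun a : ι → ℝ => Real.exp (t / b * ∑ i, d i * a i))
        (gaussianPi ι) := by
      have := integrable_exp_mul_gaussianReal (μ := 0) (v := (∑ i, d i ^ 2).toNNReal) (t / b)
      rw [← hmap] at this
      exact this.comp_measurable (by fun_prop)
    refine (measure_ge_le_exp_mul_mgf t hs hint).trans ?_
    rw [mgf_gaussianReal hmap, ← Real.exp_add, Real.exp_le_exp, hd, hv]
    have : (∑ i, c i ^ 2) * (t / b) ^ 2 ≤ b * (t / b) ^ 2 :=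
      mul_le_mul_of_nonneg_right hc (sq_nonneg _)
    have e : b * (t / b) ^ 2 = t ^ 2 / b := by field_simp
    have e2 : t / b * t = t ^ 2 / b := by ring
    have e3 : -t ^ 2 / (2 * b) = -(t ^ 2 / b) / 2 := by field_simp
    rw [e3]
    linarith
  have hsub : {a : ι → ℝ | t ≤ |∑ i, c i * a i|} ⊆
      {a | t ≤ ∑ i, c i * a i} ∪ {a | t ≤ ∑ i, (-c i) * a i} := by
    intro a ha
    have ha' : t ≤ |∑ i, c i * a i| := ha
    rcases le_abs.1 ha' with h | h
    · left; exact h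
    · right; simpa using h
  refine (measureReal_mono hsub).trans ((measureReal_union_le _ _).trans ?_)
  have := main c rfl
  have := main (fun i => -c i) (by simp)
  linarith

/-- The density is at most `1 / √(2π) ≤ 1 / 2` and the interval has length `2 δ`. -/
lemma gaussianReal_small_ball (δ : ℝ) :
    gaussianReal 0 1 {x | |x| < δ} ≤ ENNReal.ofReal δ := by
  rw [gaussianReal_apply _ (by norm_num)]
  have h1 : ∀ x : ℝ, gaussianPDF 0 1 x ≤ ENNReal.ofReal (1 / 2) := fun x => by
    rw [gaussianPDF]
    apply ENNReal.ofReal_le_ofReal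
    simp only [gaussianPDFReal, NNReal.coe_one, mul_one, sub_zero]
    have h2 : 2 ≤ Real.sqrt (2 * Real.pi) := by
      apply Real.le_sqrt_of_sq_le
      linarith [Real.pi_gt_three]
    have h3 : Real.exp (-x ^ 2 / 2) ≤ 1 := Real.exp_le_one_iff.2 (by nlinarith [sq_nonneg x])
    have h4 : (Real.sqrt (2 * Real.pi))⁻¹ ≤ 1 / 2 := by
      rw [one_div]; exact inv_anti₀ (by norm_num) h2
    calc _ ≤ (Real.sqrt (2 * Real.pi))⁻¹ * 1 := by gcongr
      _ ≤ _ := by linarith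
  refine (lintegral_mono h1).trans ?_
  rw [setLIntegral_const]
  have : {x : ℝ | |x| < δ} = Set.Ioo (-δ) δ := by ext x; simp [abs_lt]
  rw [this, Real.volume_Ioo, ← ENNReal.ofReal_mul (by norm_num)]
  apply ENNReal.ofReal_le_ofReal
  linarith

/-- Anti-concentration of a linear form with unit coefficient vector. -/
lemma gaussianPi_small_ball (c : ι → ℝ) (hc : ∑ i, c i ^ 2 = 1) (δ : ℝ) :
    gaussianPi ι {a | |∑ i, c i * a i| < δ} ≤ ENNReal.ofReal δ := by
  have h := gaussianPi_map_linear c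
  rw [hc, Real.toNNReal_one] at h
  refine le_trans (le_of_eq ?_) (gaussianReal_small_ball δ)
  rw [← h, Measure.map_apply (by fun_prop) (measurableSet_lt (by fun_prop) (by fun_prop))]
  rfl

/-- Markov's inequality for the squared norm of a Gaussian vector. -/
lemma gaussianPi_sum_sq_ge {t : ℝ} (ht : 0 < t) :
    gaussianPi ι {a | t ≤ ∑ i, a i ^ 2} ≤ ENNReal.ofReal (Fintype.card ι / t) := by
  have hsq : ∫⁻ x : ℝ, ENNReal.ofReal (x ^ 2) ∂(gaussianReal 0 1) = 1 := by
    rw [← ofReal_integral_eq_lintegral_ofReal]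
    · have h1 := variance_fun_id_gaussianReal (μ := 0) (v := 1)
      rw [variance_eq_integral (by fun_prop)] at h1
      simp only [integral_id_gaussianReal, sub_zero, NNReal.coe_one] at h1
      rw [h1, ENNReal.ofReal_one]
    · have := (memLp_id_gaussianReal (μ := 0) (v := 1) 2).integrable_sq
      simpa using this
    · exact ae_of_all _ fun x => sq_nonneg x
  have h2 : ∫⁻ a : ι → ℝ, ENNReal.ofReal (∑ i, a i ^ 2) ∂(gaussianPi ι) = Fintype.card ι := by
    have : ∀ a : ι → ℝ, ENNReal.ofReal (∑ i, a i ^ 2) = ∑ i, ENNReal.ofReal (a i ^ 2) :=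
      fun a => ENNReal.ofReal_sum_of_nonneg fun i _ => sq_nonneg _
    simp_rw [this]
    rw [lintegral_finsetSum _ (fun i _ => by fun_prop)]
    have h3 : ∀ i, ∫⁻ a : ι → ℝ, ENNReal.ofReal (a i ^ 2) ∂(gaussianPi ι) = 1 := fun i => by
      rw [← hsq, ← (measurePreserving_eval (fun _ : ι => gaussianReal 0 1) i).lintegral_comp
        (f := fun x => ENNReal.ofReal (x ^ 2)) (by fun_prop)]
    simp [h3]
  have h4 := meas_ge_le_lintegral_div (μ := gaussianPi ι)
    (f := fun a : ι → ℝ => ENNReal.ofReal (∑ i, a i ^ 2)) (ε := ENNReal.ofReal t)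
    (Measurable.aemeasurable (by fun_prop)) (by simpa using ht) ENNReal.ofReal_ne_top
  rw [h2] at h4
  rw [ENNReal.ofReal_div_of_pos ht, ENNReal.ofReal_natCast]
  refine le_trans (measure_mono fun a ha => ?_) h4
  exact ENNReal.ofReal_le_ofReal ha

end QuadraticForm


namespace SpikedTensor

variable {n : ℕ}

/-! ### Index triples up to permutation -/

/-- The multiset of a triple of indices. -/
def tripleClass (t : Fin n × Fin n × Fin n) : Sym (Fin n) 3 :=
  ⟨({t.1, t.2.1, t.2.2} : Multiset (Fin n)), rfl⟩

/-- The six permutations of a triple. -/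
def triplePerm : Fin 6 → (Fin n × Fin n × Fin n ≃ Fin n × Fin n × Fin n)
  | 0 => Equiv.refl _
  | 1 => ⟨fun t => (t.1, t.2.2, t.2.1), fun t => (t.1, t.2.2, t.2.1), fun _ => rfl, fun _ => rfl⟩
  | 2 => ⟨fun t => (t.2.1, t.1, t.2.2), fun t => (t.2.1, t.1, t.2.2), fun _ => rfl, fun _ => rfl⟩
  | 3 => ⟨fun t => (t.2.2, t.2.1, t.1), fun t => (t.2.2, t.2.1, t.1), fun _ => rfl, fun _ => rfl⟩
  | 4 => ⟨fun t => (t.2.1, t.2.2, t.1), fun t => (t.2.2, t.1, t.2.1), fun _ => rfl, fun _ => rfl⟩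
  | 5 => ⟨fun t => (t.2.2, t.1, t.2.1), fun t => (t.2.1, t.2.2, t.1), fun _ => rfl, fun _ => rfl⟩

/-- A triple with a repeated index. -/
def IsRepeated (t : Fin n × Fin n × Fin n) : Prop := t.1 = t.2.1 ∨ t.2.1 = t.2.2 ∨ t.1 = t.2.2

instance : DecidablePred (IsRepeated (n := n)) := fun t => by unfold IsRepeated; infer_instance

lemma isRepeated_triplePerm (p : Fin 6) (t : Fin n × Fin n × Fin n) :
    IsRepeated (triplePerm p t) ↔ IsRepeated t := by
  fin_cases p <;> simp only [IsRepeated, triplePerm, Equiv.coe_fn_mk, Equiv.refl_apply] <;> grind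

lemma tripleClass_triplePerm (p : Fin 6) (t : Fin n × Fin n × Fin n) :
    tripleClass (triplePerm p t) = tripleClass t := by
  obtain ⟨i, j, k⟩ := t
  apply Subtype.ext
  change ({_, _, _} : Multiset (Fin n)) = {i, j, k}
  ext x
  fin_cases p <;> simp [triplePerm, Multiset.insert_eq_cons, Multiset.count_cons,
    Multiset.count_singleton] <;> ring

lemma exists_triplePerm_of_class_eq {t t' : Fin n × Fin n × Fin n}
    (h : tripleClass t' = tripleClass t) : ∃ p, triplePerm p t = t' := by
  obtain ⟨i, j, k⟩ := t
  obtain ⟨i', j', k'⟩ := t'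
  have h1 : ({i', j', k'} : Multiset (Fin n)) = {i, j, k} := congrArg Subtype.val h
  have hpair : ∀ a b c d : Fin n, ({a, b} : Multiset (Fin n)) = {c, d} →
      (a = c ∧ b = d) ∨ (a = d ∧ b = c) := fun a b c d h => by
    have ha : a ∈ ({c, d} : Multiset (Fin n)) := h ▸ by simp
    simp only [Multiset.insert_eq_cons, Multiset.mem_cons, Multiset.mem_singleton] at ha
    rcases ha with rfl | rfl
    · exact Or.inl ⟨rfl, by simpa using h⟩
    · rw [Multiset.pair_comm c] at h
      exact Or.inr ⟨rfl, by simpa using h⟩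
  have h2 : (i', j', k') = (i, j, k) ∨ (i', j', k') = (i, k, j) ∨ (i', j', k') = (j, i, k) ∨
      (i', j', k') = (k, j, i) ∨ (i', j', k') = (j, k, i) ∨ (i', j', k') = (k, i, j) := by
    have hi : i' ∈ ({i, j, k} : Multiset (Fin n)) := h1 ▸ by simp
    simp only [Multiset.insert_eq_cons, Multiset.mem_cons, Multiset.mem_singleton] at hi h1
    rcases hi with rfl | rfl | rfl
    · have := hpair _ _ _ _ ((Multiset.cons_inj_right _).1 h1)
      grind
    · rw [Multiset.cons_swap i] at h1
      have := hpair _ _ _ _ ((Multiset.cons_inj_right _).1 h1)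
      grind
    · have h3 : (i ::ₘ j ::ₘ {i'} : Multiset (Fin n)) = i' ::ₘ i ::ₘ {j} := by
        rw [Multiset.cons_swap i' i, ← Multiset.cons_zero j, Multiset.cons_swap i' j]; rfl
      rw [h3] at h1
      have := hpair _ _ _ _ ((Multiset.cons_inj_right _).1 h1)
      grind
  rcases h2 with h2 | h2 | h2 | h2 | h2 | h2
  exacts [⟨0, h2.symm⟩, ⟨1, h2.symm⟩, ⟨2, h2.symm⟩, ⟨3, h2.symm⟩, ⟨4, h2.symm⟩, ⟨5, h2.symm⟩]

lemma triplePerm_injective_of_not_isRepeated {t : Fin n × Fin n × Fin n} (ht : ¬ IsRepeated t) :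
    Function.Injective fun p => triplePerm p t := by
  obtain ⟨i, j, k⟩ := t
  simp only [IsRepeated, not_or] at ht
  intro p q h
  fin_cases p <;> fin_cases q <;> simp [triplePerm] at h <;> simp <;> grind

/-- The triples in the class of `t`. -/
def classOf (t : Fin n × Fin n × Fin n) : Finset (Fin n × Fin n × Fin n) :=
  Finset.univ.filter fun t' => tripleClass t' = tripleClass t

/-- The triples with a given multiset form one orbit of the permutations of three positions. The
orbit has six elements exactly when no index repeats; with repetitions the image is smaller, which
is the source of the error terms below. -/
lemma classOf_eq_image (t : Fin n × Fin n × Fin n) :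
    classOf t = Finset.univ.image fun p => triplePerm p t := by
  ext t'
  simp only [classOf, Finset.mem_filter, Finset.mem_univ, true_and, Finset.mem_image]
  exact ⟨exists_triplePerm_of_class_eq, fun ⟨p, hp⟩ => hp ▸ tripleClass_triplePerm p t⟩

lemma card_fiber_le (s : Sym (Fin n) 3) :
    (Finset.univ.filter fun t : Fin n × Fin n × Fin n => tripleClass t = s).card ≤ 6 := by
  by_cases h : ∃ t : Fin n × Fin n × Fin n, tripleClass t = s
  · obtain ⟨t, rfl⟩ := h
    change (classOf t).card ≤ 6
    rw [classOf_eq_image]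
    exact Finset.card_image_le.trans (by simp)
  · rw [Finset.filter_eq_empty_iff.2 fun t _ ht => h ⟨t, ht⟩]
    simp

lemma sum_classOf_of_not_isRepeated (H : Fin n × Fin n × Fin n → ℝ) {t : Fin n × Fin n × Fin n}
    (ht : ¬ IsRepeated t) : ∑ t' ∈ classOf t, H t' = ∑ p, H (triplePerm p t) := by
  rw [classOf_eq_image, Finset.sum_image fun p _ q _ h =>
    triplePerm_injective_of_not_isRepeated ht h]

lemma abs_sum_classOf_le (H : Fin n × Fin n × Fin n → ℝ) (t : Fin n × Fin n × Fin n) :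
    |∑ t' ∈ classOf t, H t'| ≤ ∑ p, |H (triplePerm p t)| := by
  refine (Finset.abs_sum_le_sum_abs _ _).trans ?_
  rw [classOf_eq_image]
  have : ∀ t' ∈ Finset.univ.image fun p => triplePerm p t, |H t'| ≤
      ∑ p ∈ Finset.univ.filter fun p => triplePerm p t = t', |H (triplePerm p t)| := by
    intro t' ht'
    obtain ⟨p, -, hp⟩ := Finset.mem_image.1 ht'
    rw [← hp]
    exact Finset.single_le_sum (f := fun p => |H (triplePerm p t)|) (fun _ _ => abs_nonneg _)
      (by simp)
  refine (Finset.sum_le_sum this).trans (le_of_eq ?_)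
  exact Finset.sum_fiberwise_of_maps_to (f := fun p => |H (triplePerm p t)|)
    (fun p hp => Finset.mem_image_of_mem _ hp)

/-! ### The variance of a linear form of the noise -/

/-- The coefficient at the free entry `s` of the linear form `⟨H, A⟩` of the noise tensor. -/
def symCoeff (H : Fin n × Fin n × Fin n → ℝ) (s : Sym (Fin n) 3) : ℝ :=
  ∑ t with tripleClass t = s, H t

lemma sum_mul_noise (H : Fin n × Fin n × Fin n → ℝ) (a : Sym (Fin n) 3 → ℝ) :
    ∑ t, H t * a (tripleClass t) = ∑ s, symCoeff H s * a s := by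
  simp_rw [symCoeff, Finset.sum_mul]
  rw [← Finset.sum_fiberwise (s := Finset.univ) (g := tripleClass)]
  refine Finset.sum_congr rfl fun s _ => Finset.sum_congr rfl fun t ht => ?_
  rw [(Finset.mem_filter.1 ht).2]

/-- Cauchy–Schwarz on fibres of at most six triples: symmetry of the noise raises the variance of a
linear form by at most a factor six. -/
lemma sum_symCoeff_sq_le (H : Fin n × Fin n × Fin n → ℝ) :
    ∑ s, symCoeff H s ^ 2 ≤ 6 * ∑ t, H t ^ 2 := by
  rw [← Finset.sum_fiberwise (s := Finset.univ) (g := tripleClass) (f := fun t => H t ^ 2),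
    Finset.mul_sum]
  refine Finset.sum_le_sum fun s _ => ?_
  refine sq_sum_le_card_mul_sum_sq.trans ?_
  refine mul_le_mul_of_nonneg_right ?_ (Finset.sum_nonneg fun _ _ => sq_nonneg _)
  exact_mod_cast card_fiber_le s

lemma sum_noise_sq_le (a : Sym (Fin n) 3 → ℝ) :
    ∑ t : Fin n × Fin n × Fin n, a (tripleClass t) ^ 2 ≤ 6 * ∑ s, a s ^ 2 := by
  rw [← Finset.sum_fiberwise (s := Finset.univ) (g := tripleClass), Finset.mul_sum]
  refine Finset.sum_le_sum fun s _ => ?_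
  rw [Finset.sum_congr rfl (g := fun _ => a s ^ 2)
    fun t ht => by rw [(Finset.mem_filter.1 ht).2], Finset.sum_const, nsmul_eq_mul]
  refine mul_le_mul_of_nonneg_right ?_ (sq_nonneg _)
  exact_mod_cast card_fiber_le s

lemma sum_symCoeff_sq_eq (H : Fin n × Fin n × Fin n → ℝ) :
    ∑ s, symCoeff H s ^ 2 = ∑ t, H t * ∑ t' ∈ classOf t, H t' := by
  rw [← Finset.sum_fiberwise (s := Finset.univ) (g := tripleClass)]
  refine Finset.sum_congr rfl fun s _ => ?_
  rw [sq, symCoeff, Finset.sum_mul]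
  refine Finset.sum_congr rfl fun t ht => ?_
  rw [classOf, (Finset.mem_filter.1 ht).2]

/-- Up to triples with a repeated index, the variance is that of the symmetrization. -/
lemma abs_sum_symCoeff_sq_sub_le (H : Fin n × Fin n × Fin n → ℝ) :
    |∑ s, symCoeff H s ^ 2 - ∑ t, H t * ∑ p, H (triplePerm p t)| ≤
      12 * ∑ t with IsRepeated t, H t ^ 2 := by
  rw [sum_symCoeff_sq_eq, ← Finset.sum_sub_distrib]
  -- The sum over the class and the sum over the six permutations agree unless `t` has a repeated
  -- index. There both are at most the sum of `|H|` over the six permutations, and `2 |a b| ≤ a² +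
  -- b²` applies to each.
  have h1 : ∀ t, |H t * ∑ t' ∈ classOf t, H t' - H t * ∑ p, H (triplePerm p t)| ≤
      ∑ p, if IsRepeated t then H t ^ 2 + H (triplePerm p t) ^ 2 else 0 := by
    intro t
    split_ifs with ht
    · rw [← mul_sub, abs_mul]
      have h2 := abs_sum_classOf_le H t
      have h3 : |∑ p, H (triplePerm p t)| ≤ ∑ p, |H (triplePerm p t)| :=
        Finset.abs_sum_le_sum_abs _ _
      have h4 : |∑ t' ∈ classOf t, H t' - ∑ p, H (triplePerm p t)| ≤
          2 * ∑ p, |H (triplePerm p t)| := (abs_sub _ _).trans (by linarith)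
      refine (mul_le_mul_of_nonneg_left h4 (abs_nonneg _)).trans ?_
      rw [Finset.mul_sum, Finset.mul_sum]
      refine Finset.sum_le_sum fun p _ => ?_
      have := two_mul_le_add_sq |H t| |H (triplePerm p t)|
      rw [sq_abs, sq_abs] at this
      linarith
    · rw [sum_classOf_of_not_isRepeated H ht]
      simp
  refine (Finset.abs_sum_le_sum_abs _ _).trans ((Finset.sum_le_sum fun t _ => h1 t).trans ?_)
  rw [Finset.sum_comm]
  have h2 : ∀ p : Fin 6, ∑ t, (if IsRepeated t then H t ^ 2 + H (triplePerm p t) ^ 2 else 0) =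
      2 * ∑ t with IsRepeated t, H t ^ 2 := by
    intro p
    -- Permuting positions maps the repeated triples bijectively to themselves, so each of the six
    -- permutations contributes the same sum twice: `12 = 6 * 2`.
    have h3 : ∑ t, (if IsRepeated t then H (triplePerm p t) ^ 2 else 0) =
        ∑ t, if IsRepeated t then H t ^ 2 else 0 := by
      rw [← Equiv.sum_comp (triplePerm p) (fun t => if IsRepeated t then H t ^ 2 else 0)]
      simp_rw [isRepeated_triplePerm]
    rw [Finset.sum_filter, two_mul]
    nth_rewrite 2 [← h3]
    rw [← Finset.sum_add_distrib]
    exact Finset.sum_congr rfl fun t _ => by split_ifs <;> simp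
  simp_rw [h2]
  simp
  linarith

end SpikedTensor

namespace SpikedTensor

variable {n : ℕ}

/-! ### Trilinear forms -/

/-- The trilinear form of a tensor. -/
def tri (A : Tensor n) (x y z : Fin n → ℝ) : ℝ :=
  ∑ i, ∑ j, ∑ k, A i j k * (x i * y j * z k)

lemma tri_add (A B : Tensor n) (x y z : Fin n → ℝ) :
    tri (fun i j k => A i j k + B i j k) x y z = tri A x y z + tri B x y z := by
  simp only [tri, add_mul, Finset.sum_add_distrib]

lemma tri_add_right (A : Tensor n) (x y z w : Fin n → ℝ) :
    tri A x y (z + w) = tri A x y z + tri A x y w := by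
  simp only [tri, Pi.add_apply, mul_add, Finset.sum_add_distrib]

lemma tri_smul_right (A : Tensor n) (x y z : Fin n → ℝ) (c : ℝ) :
    tri A x y (c • z) = c * tri A x y z := by
  simp only [tri, Pi.smul_apply, smul_eq_mul, Finset.mul_sum]
  exact Finset.sum_congr rfl fun _ _ => Finset.sum_congr rfl fun _ _ =>
    Finset.sum_congr rfl fun _ _ => by ring

lemma tri_add_mid (A : Tensor n) (x y z w : Fin n → ℝ) :
    tri A x (y + w) z = tri A x y z + tri A x w z := by
  simp only [tri, Pi.add_apply, add_mul, mul_add, Finset.sum_add_distrib]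

lemma tri_smul_mid (A : Tensor n) (x y z : Fin n → ℝ) (c : ℝ) :
    tri A x (c • y) z = c * tri A x y z := by
  simp only [tri, Pi.smul_apply, smul_eq_mul, Finset.mul_sum]
  exact Finset.sum_congr rfl fun _ _ => Finset.sum_congr rfl fun _ _ =>
    Finset.sum_congr rfl fun _ _ => by ring

lemma tri_add_left (A : Tensor n) (x y z w : Fin n → ℝ) :
    tri A (x + w) y z = tri A x y z + tri A w y z := by
  simp only [tri, Pi.add_apply, add_mul, mul_add, Finset.sum_add_distrib]

lemma tri_smul_left (A : Tensor n) (x y z : Fin n → ℝ) (c : ℝ) :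
    tri A (c • x) y z = c * tri A x y z := by
  simp only [tri, Pi.smul_apply, smul_eq_mul, Finset.mul_sum]
  exact Finset.sum_congr rfl fun _ _ => Finset.sum_congr rfl fun _ _ =>
    Finset.sum_congr rfl fun _ _ => by ring

lemma tri_rank_one (τ : ℝ) (v x y z : Fin n → ℝ) :
    tri (fun i j k => τ * (v i * v j * v k)) x y z =
      τ * ((v ⬝ᵥ x) * (v ⬝ᵥ y) * (v ⬝ᵥ z)) := by
  simp only [tri, dotProduct]
  rw [Finset.sum_mul_sum, Finset.sum_mul, Finset.mul_sum]
  refine Finset.sum_congr rfl fun i _ => ?_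
  rw [Finset.sum_mul, Finset.mul_sum]
  refine Finset.sum_congr rfl fun j _ => ?_
  rw [Finset.mul_sum, Finset.mul_sum]
  exact Finset.sum_congr rfl fun k _ => by ring

/-- The rank one tensor `x ⊗ y ⊗ z` as a function of index triples. -/
def pureTriple (x y z : Fin n → ℝ) (t : Fin n × Fin n × Fin n) : ℝ := x t.1 * y t.2.1 * z t.2.2

lemma sum_triple_mul (f g h : Fin n → ℝ) :
    ∑ t : Fin n × Fin n × Fin n, f t.1 * g t.2.1 * h t.2.2 = (∑ i, f i) * (∑ i, g i) * ∑ i, h i := by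
  rw [Fintype.sum_prod_type, Finset.sum_mul_sum, Finset.sum_mul]
  refine Finset.sum_congr rfl fun i _ => ?_
  rw [Fintype.sum_prod_type, Finset.sum_mul]
  refine Finset.sum_congr rfl fun j _ => ?_
  rw [Finset.mul_sum]

lemma tri_noise (a : Sym (Fin n) 3 → ℝ) (x y z : Fin n → ℝ) :
    tri (noiseTensor a) x y z = ∑ s, symCoeff (pureTriple x y z) s * a s := by
  rw [← sum_mul_noise, tri, Fintype.sum_prod_type]
  refine Finset.sum_congr rfl fun i _ => ?_
  rw [Fintype.sum_prod_type]
  exact Finset.sum_congr rfl fun j _ => Finset.sum_congr rfl fun k _ => mul_comm _ _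

lemma sum_pureTriple_sq (x y z : Fin n → ℝ) :
    ∑ t, pureTriple x y z t ^ 2 = (∑ i, x i ^ 2) * (∑ i, y i ^ 2) * ∑ i, z i ^ 2 := by
  rw [← sum_triple_mul]
  exact Finset.sum_congr rfl fun t _ => by rw [pureTriple]; ring

/-- Every permutation other than the identity pairs two different vectors in some position, and that
inner product vanishes. This is why the coordinates are split into three disjoint parts: the
symmetry of the noise then leaves the main term of the variance unaffected. -/
lemma sum_pureTriple_mul_perm {x y z : Fin n → ℝ} (hxy : ∑ i, x i * y i = 0)
    (hyz : ∑ i, y i * z i = 0) (hxz : ∑ i, x i * z i = 0) :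
    ∑ t, pureTriple x y z t * ∑ p, pureTriple x y z (triplePerm p t) =
      (∑ i, x i ^ 2) * (∑ i, y i ^ 2) * ∑ i, z i ^ 2 := by
  have h : ∀ t, pureTriple x y z t * ∑ p, pureTriple x y z (triplePerm p t) =
      (x t.1 ^ 2) * (y t.2.1 ^ 2) * (z t.2.2 ^ 2) +
      (x t.1 ^ 2) * (y t.2.1 * z t.2.1) * (y t.2.2 * z t.2.2) +
      (x t.1 * y t.1) * (x t.2.1 * y t.2.1) * (z t.2.2 ^ 2) +
      (x t.1 * z t.1) * (y t.2.1 ^ 2) * (x t.2.2 * z t.2.2) +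
      (x t.1 * z t.1) * (x t.2.1 * y t.2.1) * (y t.2.2 * z t.2.2) +
      (x t.1 * y t.1) * (y t.2.1 * z t.2.1) * (x t.2.2 * z t.2.2) := fun t => by
    simp only [Fin.sum_univ_six, triplePerm, pureTriple, Equiv.coe_fn_mk, Equiv.refl_apply]
    ring
  simp_rw [h, Finset.sum_add_distrib]
  rw [sum_triple_mul (fun i => x i ^ 2) (fun i => y i ^ 2) (fun i => z i ^ 2),
    sum_triple_mul (fun i => x i ^ 2) (fun i => y i * z i) (fun i => y i * z i),
    sum_triple_mul (fun i => x i * y i) (fun i => x i * y i) (fun i => z i ^ 2),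
    sum_triple_mul (fun i => x i * z i) (fun i => y i ^ 2) (fun i => x i * z i),
    sum_triple_mul (fun i => x i * z i) (fun i => x i * y i) (fun i => y i * z i),
    sum_triple_mul (fun i => x i * y i) (fun i => y i * z i) (fun i => x i * z i)]
  simp [hxy, hyz, hxz]

/-! ### Orthogonal matrices -/

lemma sum_row_mul_row {R : Matrix (Fin n) (Fin n) ℝ} (hR : R * Rᵀ = 1) (i j : Fin n) :
    ∑ k, R i k * R j k = if i = j then 1 else 0 := by
  have := congrFun (congrFun hR i) j
  rwa [Matrix.mul_apply, Matrix.one_apply] at this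

lemma sum_col_mul_col {R : Matrix (Fin n) (Fin n) ℝ} (hR : R * Rᵀ = 1) (i j : Fin n) :
    ∑ k, R k i * R k j = if i = j then 1 else 0 := by
  have := congrFun (congrFun (mul_eq_one_comm.1 hR : Rᵀ * R = 1) i) j
  rwa [Matrix.mul_apply, Matrix.one_apply] at this

lemma sum_mulVec_sq {R : Matrix (Fin n) (Fin n) ℝ} (hR : R * Rᵀ = 1) (y : Fin n → ℝ) :
    ∑ i, (R *ᵥ y) i ^ 2 = ∑ i, y i ^ 2 := by
  have h1 : ∀ z : Fin n → ℝ, ∑ i, z i ^ 2 = z ⬝ᵥ z := fun z => by simp [dotProduct, sq]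
  rw [h1, h1, Matrix.dotProduct_mulVec, ← Matrix.mulVec_transpose, Matrix.mulVec_mulVec,
    mul_eq_one_comm.1 hR, Matrix.one_mulVec]

/-! ### Concentration of the noise -/

instance : IsProbabilityMeasure (noiseLaw n) := by unfold noiseLaw; infer_instance

/-- The variance is at most `6`, whence the exponent `t² / (2 * 6)`. -/
lemma tri_noise_tail {x y z : Fin n → ℝ} (hx : ∑ i, x i ^ 2 ≤ 1) (hy : ∑ i, y i ^ 2 ≤ 1)
    (hz : ∑ i, z i ^ 2 ≤ 1) {t : ℝ} (ht : 0 ≤ t) :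
    (noiseLaw n).real {a | t ≤ |tri (noiseTensor a) x y z|} ≤ 2 * Real.exp (-t ^ 2 / 12) := by
  simp_rw [tri_noise]
  have hx0 : 0 ≤ ∑ i, x i ^ 2 := Finset.sum_nonneg fun _ _ => sq_nonneg _
  have hy0 : 0 ≤ ∑ i, y i ^ 2 := Finset.sum_nonneg fun _ _ => sq_nonneg _
  have hz0 : 0 ≤ ∑ i, z i ^ 2 := Finset.sum_nonneg fun _ _ => sq_nonneg _
  have h := gaussianPi_linear_tail (symCoeff (pureTriple x y z)) (b := 6) (by norm_num) ?_ ht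
  · norm_num at h ⊢
    exact h
  · refine (sum_symCoeff_sq_le _).trans ?_
    rw [sum_pureTriple_sq]
    have := mul_le_one₀ (mul_le_one₀ hx hy0 hy) hz0 hz
    linarith

/-- The vector of the values `⟨A, r_i ⊗ r_j ⊗ h⟩`, `i ∈ Y`, `j ∈ Z`, as a linear function of the
free entries of the noise `A`, where the `r_i` are the rows of `R`. -/
def noiseMap (R : Matrix (Fin n) (Fin n) ℝ) (Y Z : Finset (Fin n)) (h : Fin n → ℝ) :
    EuclideanSpace ℝ (Sym (Fin n) 3) →ₗ[ℝ] EuclideanSpace ℝ (Fin n × Fin n) where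
  toFun a := WithLp.toLp 2 fun p =>
    if p.1 ∈ Y ∧ p.2 ∈ Z then ∑ s, symCoeff (pureTriple (R p.1) (R p.2) h) s * a s else 0
  map_add' a b := by
    ext p
    simp only [PiLp.add_apply, mul_add, Finset.sum_add_distrib]
    split_ifs <;> simp
  map_smul' c a := by
    ext p
    simp only [PiLp.smul_apply, smul_eq_mul, RingHom.id_apply]
    split_ifs
    · rw [Finset.mul_sum]
      exact Finset.sum_congr rfl fun s _ => by ring
    · simp

lemma norm_noiseMap_sq (R : Matrix (Fin n) (Fin n) ℝ) (Y Z : Finset (Fin n)) (h : Fin n → ℝ)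
    (a : Sym (Fin n) 3 → ℝ) :
    ‖noiseMap R Y Z h (WithLp.toLp 2 a)‖ ^ 2 =
      ∑ i ∈ Y, ∑ j ∈ Z, tri (noiseTensor a) (R i) (R j) h ^ 2 := by
  rw [EuclideanSpace.real_norm_sq_eq, Fintype.sum_prod_type]
  simp only [noiseMap, LinearMap.coe_mk, AddHom.coe_mk, tri_noise]
  rw [← Finset.sum_filter_add_sum_filter_not Finset.univ (· ∈ Y)]
  have h2 : ∑ i with i ∉ Y, ∑ j, (if i ∈ Y ∧ j ∈ Z then
      ∑ s, symCoeff (pureTriple (R i) (R j) h) s * a s else 0) ^ 2 = 0 :=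
    Finset.sum_eq_zero fun i hi => Finset.sum_eq_zero fun j _ => by
      simp [(Finset.mem_filter.1 hi).2]
  rw [h2, add_zero, Finset.filter_univ_mem]
  refine Finset.sum_congr rfl fun i hi => ?_
  rw [← Finset.sum_filter_add_sum_filter_not Finset.univ (· ∈ Z), Finset.filter_univ_mem]
  have h3 : ∑ j with j ∉ Z, (if i ∈ Y ∧ j ∈ Z then
      ∑ s, symCoeff (pureTriple (R i) (R j) h) s * a s else 0) ^ 2 = 0 :=
    Finset.sum_eq_zero fun j hj => by simp [(Finset.mem_filter.1 hj).2]
  rw [h3, add_zero]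
  exact Finset.sum_congr rfl fun j hj => by simp [hi, hj]

lemma tri_eq_mulVec (A : Tensor n) (R : Matrix (Fin n) (Fin n) ℝ) (h : Fin n → ℝ) (i j : Fin n) :
    tri A (R i) (R j) h = (R *ᵥ fun l => (R *ᵥ fun m => ∑ k, A l m k * h k) j) i := by
  simp only [tri, Matrix.mulVec, dotProduct, Finset.mul_sum]
  exact Finset.sum_congr rfl fun _ _ => Finset.sum_congr rfl fun _ _ =>
    Finset.sum_congr rfl fun _ _ => by ring

lemma sum_tri_rows_sq {R : Matrix (Fin n) (Fin n) ℝ} (hR : R * Rᵀ = 1) (A : Tensor n)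
    (h : Fin n → ℝ) :
    ∑ i, ∑ j, tri A (R i) (R j) h ^ 2 = ∑ l, ∑ m, (∑ k, A l m k * h k) ^ 2 := by
  simp_rw [tri_eq_mulVec]
  rw [Finset.sum_comm]
  simp_rw [sum_mulVec_sq hR]
  rw [Finset.sum_comm]
  simp_rw [sum_mulVec_sq hR]

/-- Extending the sum to all pairs of rows makes the rotation drop out; Cauchy–Schwarz in the third
index and the multiplicity six of the free entries finish. The operator norm is thus independent of
`n`, while the trace is of order `n²`; this gap is what produces fluctuations of order `n` only. -/
lemma norm_noiseMap_sq_le {R : Matrix (Fin n) (Fin n) ℝ} (hR : R * Rᵀ = 1) (Y Z : Finset (Fin n))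
    (h : Fin n → ℝ) (a : EuclideanSpace ℝ (Sym (Fin n) 3)) :
    ‖noiseMap R Y Z h a‖ ^ 2 ≤ 6 * (∑ i, h i ^ 2) * ‖a‖ ^ 2 := by
  have e : a = WithLp.toLp 2 (WithLp.ofLp a) := rfl
  rw [e, norm_noiseMap_sq]
  set b := WithLp.ofLp a
  have h1 : ∑ i ∈ Y, ∑ j ∈ Z, tri (noiseTensor b) (R i) (R j) h ^ 2 ≤
      ∑ i, ∑ j, tri (noiseTensor b) (R i) (R j) h ^ 2 :=
    (Finset.sum_le_sum fun i _ => Finset.sum_le_sum_of_subset_of_nonneg (Finset.subset_univ _)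
      fun _ _ _ => sq_nonneg _).trans
    (Finset.sum_le_sum_of_subset_of_nonneg (Finset.subset_univ _)
      fun _ _ _ => Finset.sum_nonneg fun _ _ => sq_nonneg _)
  refine h1.trans ?_
  rw [sum_tri_rows_sq hR]
  have h2 : ∑ l, ∑ m, (∑ k, noiseTensor b l m k * h k) ^ 2 ≤
      ∑ l, ∑ m, (∑ k, noiseTensor b l m k ^ 2) * ∑ k, h k ^ 2 :=
    Finset.sum_le_sum fun l _ => Finset.sum_le_sum fun m _ =>
      Finset.sum_mul_sq_le_sq_mul_sq _ _ _
  refine h2.trans ?_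
  simp_rw [← Finset.sum_mul]
  have h3 := sum_noise_sq_le b
  have h4 : ∑ l, ∑ m, ∑ k, noiseTensor b l m k ^ 2 =
      ∑ t : Fin n × Fin n × Fin n, b (tripleClass t) ^ 2 := by
    rw [Fintype.sum_prod_type]
    refine Finset.sum_congr rfl fun i _ => ?_
    rw [Fintype.sum_prod_type]
    rfl
  rw [h4, EuclideanSpace.real_norm_sq_eq]
  have h5 : 0 ≤ ∑ k, h k ^ 2 := Finset.sum_nonneg fun _ _ => sq_nonneg _
  have := mul_le_mul_of_nonneg_right h3 h5
  simp only [b] at this ⊢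
  linarith

lemma sum_norm_noiseMap_single (R : Matrix (Fin n) (Fin n) ℝ) (Y Z : Finset (Fin n))
    (h : Fin n → ℝ) :
    ∑ s, ‖noiseMap R Y Z h (EuclideanSpace.single s 1)‖ ^ 2 =
      ∑ i ∈ Y, ∑ j ∈ Z, ∑ s, symCoeff (pureTriple (R i) (R j) h) s ^ 2 := by
  have : ∀ s : Sym (Fin n) 3, ‖noiseMap R Y Z h (EuclideanSpace.single s 1)‖ ^ 2 =
      ∑ i ∈ Y, ∑ j ∈ Z, symCoeff (pureTriple (R i) (R j) h) s ^ 2 := fun s => by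
    have e : (EuclideanSpace.single s 1 : EuclideanSpace ℝ (Sym (Fin n) 3)) =
        WithLp.toLp 2 (Pi.single s 1) := rfl
    rw [e, norm_noiseMap_sq]
    simp_rw [tri_noise]
    simp [Pi.single_apply]
  simp_rw [this]
  rw [Finset.sum_comm]
  exact Finset.sum_congr rfl fun i _ => Finset.sum_comm

/-- Each of the three possible coincidences leaves the index in `h` and one further free index,
hence contributes `n * ∑ h²`. -/
lemma sum_isRepeated_le (h : Fin n → ℝ) :
    ∑ t : Fin n × Fin n × Fin n with IsRepeated t, h t.2.2 ^ 2 ≤ 3 * n * ∑ i, h i ^ 2 := by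
  have h1 : ∀ t : Fin n × Fin n × Fin n, (if IsRepeated t then h t.2.2 ^ 2 else 0) ≤
      (if t.1 = t.2.1 then h t.2.2 ^ 2 else 0) + (if t.2.1 = t.2.2 then h t.2.2 ^ 2 else 0) +
      (if t.1 = t.2.2 then h t.2.2 ^ 2 else 0) := fun t => by
    have := sq_nonneg (h t.2.2)
    have hp : ∀ (P : Prop) [Decidable P], 0 ≤ if P then h t.2.2 ^ 2 else 0 := fun P _ => by
      split_ifs <;> simp [this]
    have h1 := hp (t.1 = t.2.1)
    have h2 := hp (t.2.1 = t.2.2)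
    have h3 := hp (t.1 = t.2.2)
    by_cases hr : IsRepeated t
    · rw [if_pos hr]
      rcases hr with e | e | e
      · rw [if_pos e]; linarith
      · rw [if_pos e]; linarith
      · rw [if_pos e]; linarith
    · rw [if_neg hr]; linarith
  rw [Finset.sum_filter]
  refine (Finset.sum_le_sum fun t _ => h1 t).trans (le_of_eq ?_)
  simp only [Finset.sum_add_distrib, Fintype.sum_prod_type]
  have e1 : ∑ i : Fin n, ∑ j : Fin n, ∑ k, (if i = j then h k ^ 2 else 0) = n * ∑ k, h k ^ 2 := by
    have : ∀ i j : Fin n, ∑ k, (if i = j then h k ^ 2 else 0) =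
        if i = j then ∑ k, h k ^ 2 else 0 := fun i j => by split_ifs <;> simp
    simp_rw [this]
    simp
  have e2 : ∑ i : Fin n, ∑ j : Fin n, ∑ k, (if j = k then h k ^ 2 else 0) = n * ∑ k, h k ^ 2 := by
    simp
  have e3 : ∑ i : Fin n, ∑ j : Fin n, ∑ k, (if i = k then h k ^ 2 else 0) = n * ∑ k, h k ^ 2 := by
    simp [Finset.mul_sum]
  rw [e1, e2, e3]
  ring

/-- For a pair `(i, j)` orthogonality gives the variance `‖h‖²` up to the repeated triples. These
corrections are summed over all pairs before being estimated: the columns of `R` have norm one, so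
`R i` and `R j` disappear and only `O(n) ‖h‖²` remains for all `n²` pairs together. The constant is
`36 = 12 * 3`. -/
lemma abs_sum_variance_sub_le {R : Matrix (Fin n) (Fin n) ℝ} (hR : R * Rᵀ = 1)
    {Y Z : Finset (Fin n)} (hYZ : Disjoint Y Z) {h : Fin n → ℝ}
    (hY : ∀ i ∈ Y, ∑ k, R i k * h k = 0) (hZ : ∀ i ∈ Z, ∑ k, R i k * h k = 0) :
    |∑ i ∈ Y, ∑ j ∈ Z, ∑ s, symCoeff (pureTriple (R i) (R j) h) s ^ 2 -
      Y.card * Z.card * ∑ k, h k ^ 2| ≤ 36 * n * ∑ k, h k ^ 2 := by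
  have h1 : ∀ i ∈ Y, ∀ j ∈ Z,
      |∑ s, symCoeff (pureTriple (R i) (R j) h) s ^ 2 - ∑ k, h k ^ 2| ≤
      12 * ∑ t with IsRepeated t, pureTriple (R i) (R j) h t ^ 2 := by
    intro i hi j hj
    have hij : i ≠ j := fun e => Finset.disjoint_left.1 hYZ hi (e ▸ hj)
    have h2 := abs_sum_symCoeff_sq_sub_le (pureTriple (R i) (R j) h)
    rw [sum_pureTriple_mul_perm (by rw [sum_row_mul_row hR, if_neg hij]) (hZ j hj) (hY i hi)] at h2
    have h3 : ∀ i, ∑ k, R i k ^ 2 = 1 := fun i => by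
      simp_rw [sq]; rw [sum_row_mul_row hR, if_pos rfl]
    rwa [h3, h3, one_mul, one_mul] at h2
  have h2 : ∑ i ∈ Y, ∑ j ∈ Z, ∑ s, symCoeff (pureTriple (R i) (R j) h) s ^ 2 -
      Y.card * Z.card * ∑ k, h k ^ 2 =
      ∑ i ∈ Y, ∑ j ∈ Z, (∑ s, symCoeff (pureTriple (R i) (R j) h) s ^ 2 - ∑ k, h k ^ 2) := by
    simp [Finset.sum_sub_distrib, mul_assoc]
  rw [h2]
  have h3 : |∑ i ∈ Y, ∑ j ∈ Z,
      (∑ s, symCoeff (pureTriple (R i) (R j) h) s ^ 2 - ∑ k, h k ^ 2)| ≤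
      ∑ i ∈ Y, ∑ j ∈ Z, 12 * ∑ t with IsRepeated t, pureTriple (R i) (R j) h t ^ 2 :=
    (Finset.abs_sum_le_sum_abs _ _).trans <| Finset.sum_le_sum fun i hi =>
      (Finset.abs_sum_le_sum_abs _ _).trans <| Finset.sum_le_sum fun j hj => h1 i hi j hj
  refine h3.trans ?_
  have hnn : ∀ i j, 0 ≤ 12 * ∑ t with IsRepeated t, pureTriple (R i) (R j) h t ^ 2 := fun i j =>
    mul_nonneg (by norm_num) (Finset.sum_nonneg fun _ _ => sq_nonneg _)
  have h4 : ∑ i ∈ Y, ∑ j ∈ Z, 12 * ∑ t with IsRepeated t, pureTriple (R i) (R j) h t ^ 2 ≤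
      ∑ i, ∑ j, 12 * ∑ t with IsRepeated t, pureTriple (R i) (R j) h t ^ 2 :=
    (Finset.sum_le_sum fun i _ => Finset.sum_le_sum_of_subset_of_nonneg (Finset.subset_univ _)
      fun j _ _ => hnn i j).trans
    (Finset.sum_le_sum_of_subset_of_nonneg (Finset.subset_univ _)
      fun i _ _ => Finset.sum_nonneg fun j _ => hnn i j)
  refine h4.trans ?_
  have h5 : ∑ i, ∑ j, 12 * ∑ t with IsRepeated t, pureTriple (R i) (R j) h t ^ 2 =
      12 * ∑ t : Fin n × Fin n × Fin n with IsRepeated t, h t.2.2 ^ 2 := by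
    simp_rw [← Finset.mul_sum]
    congr 1
    have hc : ∀ l, ∑ i, R i l ^ 2 = 1 := fun l => by
      simp_rw [sq]; rw [sum_col_mul_col hR, if_pos rfl]
    have : ∀ t : Fin n × Fin n × Fin n,
        ∑ i, ∑ j, pureTriple (R i) (R j) h t ^ 2 = h t.2.2 ^ 2 := fun t => by
      have e : ∀ i j, pureTriple (R i) (R j) h t ^ 2 =
          R i t.1 ^ 2 * (R j t.2.1 ^ 2 * h t.2.2 ^ 2) := fun i j => by rw [pureTriple]; ring
      simp_rw [e, ← Finset.mul_sum, ← Finset.sum_mul, hc, one_mul]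
    rw [← Finset.sum_congr rfl fun t _ => this t, Finset.sum_comm]
    calc _ = ∑ i, ∑ t : Fin n × Fin n × Fin n with IsRepeated t, ∑ j,
          pureTriple (R i) (R j) h t ^ 2 := by
          rw [Finset.sum_comm]
          exact Finset.sum_congr rfl fun i _ => Finset.sum_comm
      _ = _ := Finset.sum_comm
  rw [h5]
  have := sum_isRepeated_le h
  linarith

/-- Concentration of the quadratic form of the noise part of a block matrix. -/
lemma noise_quadratic_tail {R : Matrix (Fin n) (Fin n) ℝ} (hR : R * Rᵀ = 1)
    {Y Z : Finset (Fin n)} (hYZ : Disjoint Y Z) {h : Fin n → ℝ}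
    (hY : ∀ i ∈ Y, ∑ k, R i k * h k = 0) (hZ : ∀ i ∈ Z, ∑ k, R i k * h k = 0)
    (hh : ∑ k, h k ^ 2 ≤ 4) {l t : ℝ} (hl : 0 ≤ l) (hl' : l ≤ 1 / 96) :
    (noiseLaw n).real {a | t + 144 * n ≤ |∑ i ∈ Y, ∑ j ∈ Z, tri (noiseTensor a) (R i) (R j) h ^ 2 -
        Y.card * Z.card * ∑ k, h k ^ 2|} ≤
      2 * Real.exp (1152 * l ^ 2 * n ^ 2 - l * t) := by
  classical
  have hh0 : 0 ≤ ∑ k, h k ^ 2 := Finset.sum_nonneg fun _ _ => sq_nonneg _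
  -- With `‖h‖² ≤ 4` the operator bound is `24 = 6 * 4`, and the trace `V` is at most `24 n²`,
  -- whence `1152 = 2 * 24 * 24`. The bias of the mean is at most `36 * 4 * n = 144 n`.
  have htail := gaussianPi_norm_sq_tail (noiseMap R Y Z h) (b := 24) (l := l) (t := t)
    (fun a => (norm_noiseMap_sq_le hR Y Z h a).trans
      (mul_le_mul_of_nonneg_right (by linarith) (sq_nonneg _))) hl (by linarith)
  rw [sum_norm_noiseMap_single] at htail
  have hvar := abs_sum_variance_sub_le hR hYZ hY hZ
  set V := ∑ i ∈ Y, ∑ j ∈ Z, ∑ s, symCoeff (pureTriple (R i) (R j) h) s ^ 2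
  simp_rw [norm_noiseMap_sq] at htail
  have hV : V ≤ 24 * n ^ 2 := by
    have h1 : V ≤ ∑ i ∈ Y, ∑ j ∈ Z, 24 := by
      refine Finset.sum_le_sum fun i _ => Finset.sum_le_sum fun j _ => ?_
      refine (sum_symCoeff_sq_le _).trans ?_
      have h3 : ∀ i, ∑ k, R i k ^ 2 = 1 := fun i => by
        simp_rw [sq]; rw [sum_row_mul_row hR, if_pos rfl]
      rw [sum_pureTriple_sq, h3, h3]
      linarith
    refine h1.trans ?_
    have hc : ∀ W : Finset (Fin n), (W.card : ℝ) ≤ n := fun W => by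
      exact_mod_cast (Finset.card_le_univ W).trans (by simp)
    simp only [Finset.sum_const, nsmul_eq_mul]
    have := mul_le_mul (hc Y) (hc Z) (by positivity) (by positivity)
    nlinarith
  refine (measureReal_mono ?_).trans (htail.trans ?_)
  · intro a ha
    have ha' : t + 144 * n ≤ |∑ i ∈ Y, ∑ j ∈ Z, tri (noiseTensor a) (R i) (R j) h ^ 2 -
        Y.card * Z.card * ∑ k, h k ^ 2| := ha
    change t ≤ |∑ i ∈ Y, ∑ j ∈ Z, tri (noiseTensor a) (R i) (R j) h ^ 2 - V|
    have h1 := abs_sub_le (∑ i ∈ Y, ∑ j ∈ Z, tri (noiseTensor a) (R i) (R j) h ^ 2) V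
      (Y.card * Z.card * ∑ k, h k ^ 2)
    have h2 : 36 * n * ∑ k, h k ^ 2 ≤ 36 * n * 4 := mul_le_mul_of_nonneg_left hh (by positivity)
    linarith
  · refine mul_le_mul_of_nonneg_left (Real.exp_le_exp.2 ?_) (by norm_num)
    have h1 : 2 * l ^ 2 * 24 * V ≤ 2 * l ^ 2 * 24 * (24 * n ^ 2) :=
      mul_le_mul_of_nonneg_left hV (by positivity)
    nlinarith

end SpikedTensor

namespace SpikedTensor

variable {n : ℕ}

/-! ### The parts of the partition -/

/-- The coordinates in part `c`. -/
def partSet (σ : Equiv.Perm (Fin n)) (c : Fin 3) : Finset (Fin n) :=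
  Finset.univ.filter fun i => (σ i : ℕ) % 3 = (c : ℕ)

/-- The restriction of a vector to part `c`. -/
def mask (σ : Equiv.Perm (Fin n)) (c : Fin 3) (x : Fin n → ℝ) : Fin n → ℝ :=
  fun i => (if (σ i : ℕ) % 3 = (c : ℕ) then 1 else 0) * x i

lemma mask_add (σ : Equiv.Perm (Fin n)) (c : Fin 3) (x y : Fin n → ℝ) :
    mask σ c (x + y) = mask σ c x + mask σ c y := by
  ext i; simp [mask, mul_add]

lemma mask_smul (σ : Equiv.Perm (Fin n)) (c : Fin 3) (r : ℝ) (x : Fin n → ℝ) :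
    mask σ c (r • x) = r • mask σ c x := by
  ext i; simp [mask]

lemma disjoint_partSet (σ : Equiv.Perm (Fin n)) {c d : Fin 3} (h : c ≠ d) :
    Disjoint (partSet σ c) (partSet σ d) := by
  rw [Finset.disjoint_left]
  intro i hc hd
  exact h (Fin.ext ((Finset.mem_filter.1 hc).2.symm.trans (Finset.mem_filter.1 hd).2))

lemma mask_eq_zero {σ : Equiv.Perm (Fin n)} {c d : Fin 3} (h : d ≠ c) (x : Fin n → ℝ)
    {i : Fin n} (hi : i ∈ partSet σ d) : mask σ c x i = 0 := by
  have h1 := (Finset.mem_filter.1 hi).2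
  have : (σ i : ℕ) % 3 ≠ (c : ℕ) := fun e => h (Fin.ext (h1.symm.trans e))
  simp [mask, this]

lemma sum_mask_mul (σ : Equiv.Perm (Fin n)) (c : Fin 3) (x y : Fin n → ℝ) :
    ∑ i, mask σ c x i * mask σ c y i = ∑ i, mask σ c x i * y i := by
  refine Finset.sum_congr rfl fun i _ => ?_
  simp only [mask]
  split_ifs <;> simp

lemma sum_mask_sq_le (σ : Equiv.Perm (Fin n)) (c : Fin 3) (x : Fin n → ℝ) :
    ∑ i, mask σ c x i ^ 2 ≤ ∑ i, x i ^ 2 := by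
  refine Finset.sum_le_sum fun i _ => ?_
  simp only [mask]
  split_ifs
  · simp
  · simpa using sq_nonneg (x i)

lemma sum_mask_eq (σ : Equiv.Perm (Fin n)) (x : Fin n → ℝ) (i : Fin n) :
    ∑ c, mask σ c x i = x i := by
  simp only [mask, Fin.sum_univ_three]
  have h : (σ i : ℕ) % 3 < 3 := Nat.mod_lt _ (by norm_num)
  have : (σ i : ℕ) % 3 = 0 ∨ (σ i : ℕ) % 3 = 1 ∨ (σ i : ℕ) % 3 = 2 := by omega
  rcases this with h | h | h <;> simp [h]

lemma sum_sum_mask_sq (σ : Equiv.Perm (Fin n)) (x : Fin n → ℝ) :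
    ∑ c, ∑ i, mask σ c x i ^ 2 = ∑ i, x i ^ 2 := by
  simp_rw [sq, sum_mask_mul]
  rw [Finset.sum_comm]
  simp_rw [← Finset.sum_mul, sum_mask_eq]

lemma card_partSet (σ : Equiv.Perm (Fin n)) (c : Fin 3) :
    |((partSet σ c).card : ℝ) - n / 3| ≤ 1 := by
  have h1 : (partSet σ c).card = n.count (· ≡ (c : ℕ) [MOD 3]) := by
    rw [Nat.count_eq_card_filter_range]
    refine Finset.card_bij (fun i _ => (σ i : ℕ)) ?_ ?_ ?_
    · intro i hi
      have h2 := (Finset.mem_filter.1 hi).2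
      rw [Finset.mem_filter, Finset.mem_range]
      exact ⟨(σ i).2, by rw [Nat.ModEq, h2, Nat.mod_eq_of_lt c.2]⟩
    · intro i _ j _ hij
      exact σ.injective (Fin.ext hij)
    · intro m hm
      rw [Finset.mem_filter, Finset.mem_range, Nat.ModEq] at hm
      refine ⟨σ.symm ⟨m, hm.1⟩, ?_, by simp⟩
      simp only [partSet, Finset.mem_filter, Finset.mem_univ, true_and, Equiv.apply_symm_apply]
      rw [hm.2, Nat.mod_eq_of_lt c.2]
  rw [h1, Nat.count_modEq_card n (by norm_num) c]
  have h2 : (n : ℝ) = 3 * ((n / 3 : ℕ) : ℝ) + ((n % 3 : ℕ) : ℝ) := by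
    exact_mod_cast (Nat.div_add_mod n 3).symm
  have h3 : n % 3 < 3 := Nat.mod_lt _ (by norm_num)
  have h4 : ((n % 3 : ℕ) : ℝ) ≤ 2 := by exact_mod_cast Nat.le_of_lt_succ h3
  have h5 : (0 : ℝ) ≤ ((n % 3 : ℕ) : ℝ) := Nat.cast_nonneg _
  rw [abs_le]
  push_cast
  split_ifs with h6
  · constructor <;> linarith
  · constructor <;> linarith

/-- The shift `n² / 9` only approximates the number of pairs, but the discrepancy `O(n)` is below
the noise level `n^{3/2}`. -/
lemma card_mul_card_partSet (σ : Equiv.Perm (Fin n)) (c d : Fin 3) :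
    |((partSet σ c).card : ℝ) * (partSet σ d).card - (n : ℝ) ^ 2 / 9| ≤ (n : ℝ) + 1 := by
  have h1 := abs_le.1 (card_partSet σ c)
  have h2 := abs_le.1 (card_partSet σ d)
  have hn : (0 : ℝ) ≤ n := Nat.cast_nonneg _
  set p := ((partSet σ c).card : ℝ) - n / 3
  set q := ((partSet σ d).card : ℝ) - n / 3
  have e : ((partSet σ c).card : ℝ) * (partSet σ d).card - (n : ℝ) ^ 2 / 9 =
      n / 3 * (p + q) + p * q := by simp only [p, q]; ring
  have hpq : |p * q| ≤ 1 := by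
    rw [abs_mul]
    exact mul_le_one₀ (abs_le.2 h1) (abs_nonneg _) (abs_le.2 h2)
  have hs : |p + q| ≤ 2 := abs_le.2 ⟨by linarith [h1.1, h2.1], by linarith [h1.2, h2.2]⟩
  rw [e]
  refine (abs_add_le _ _).trans ?_
  rw [abs_mul, abs_of_nonneg (by positivity : (0 : ℝ) ≤ n / 3)]
  have := mul_le_mul_of_nonneg_left hs (by positivity : (0 : ℝ) ≤ n / 3)
  linarith

/-! ### The bilinear form of a block matrix -/

/-- The bilinear form of the shifted matrix of part `c`. -/
def blockForm (T : Tensor n) (R : Matrix (Fin n) (Fin n) ℝ) (σ : Equiv.Perm (Fin n)) (c : Fin 3)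
    (x y : Fin n → ℝ) : ℝ :=
  ∑ i, ∑ j, mask σ (c + 1) 1 i * mask σ (c + 2) 1 j *
    (tri T (R i) (R j) (Rᵀ *ᵥ mask σ c x) * tri T (R i) (R j) (Rᵀ *ᵥ mask σ c y)) -
    (n : ℝ) ^ 2 / 9 * ∑ i, mask σ c x i * mask σ c y i

lemma blockForm_comm (T : Tensor n) (R : Matrix (Fin n) (Fin n) ℝ) (σ : Equiv.Perm (Fin n))
    (c : Fin 3) (x y : Fin n → ℝ) : blockForm T R σ c x y = blockForm T R σ c y x := by
  simp only [blockForm, mul_comm]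

lemma blockForm_add_right (T : Tensor n) (R : Matrix (Fin n) (Fin n) ℝ) (σ : Equiv.Perm (Fin n))
    (c : Fin 3) (x y z : Fin n → ℝ) :
    blockForm T R σ c x (y + z) = blockForm T R σ c x y + blockForm T R σ c x z := by
  simp only [blockForm, mask_add, Matrix.mulVec_add, tri_add_right, mul_add,
    Finset.sum_add_distrib, Pi.add_apply]
  ring

lemma blockForm_smul_right (T : Tensor n) (R : Matrix (Fin n) (Fin n) ℝ)
    (σ : Equiv.Perm (Fin n)) (c : Fin 3) (x y : Fin n → ℝ) (r : ℝ) :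
    blockForm T R σ c x (r • y) = r * blockForm T R σ c x y := by
  simp only [blockForm, mask_smul, Matrix.mulVec_smul, tri_smul_right, Pi.smul_apply, smul_eq_mul]
  simp only [mul_sub, Finset.mul_sum]
  congr 1
  · exact Finset.sum_congr rfl fun i _ => Finset.sum_congr rfl fun j _ => by ring
  · exact Finset.sum_congr rfl fun j _ => by ring

lemma blockForm_self (T : Tensor n) (R : Matrix (Fin n) (Fin n) ℝ) (σ : Equiv.Perm (Fin n))
    (c : Fin 3) (x : Fin n → ℝ) :
    blockForm T R σ c x x =
      ∑ i ∈ partSet σ (c + 1), ∑ j ∈ partSet σ (c + 2),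
        tri T (R i) (R j) (Rᵀ *ᵥ mask σ c x) ^ 2 - (n : ℝ) ^ 2 / 9 * ∑ i, mask σ c x i ^ 2 := by
  simp only [blockForm, partSet, Finset.sum_filter, mask, Pi.one_apply, mul_one, sq]
  congr 1
  refine Finset.sum_congr rfl fun i _ => ?_
  split_ifs
  · exact Finset.sum_congr rfl fun j _ => by split_ifs <;> simp
  · simp

lemma blockForm_polarization (T : Tensor n) (R : Matrix (Fin n) (Fin n) ℝ)
    (σ : Equiv.Perm (Fin n)) (c : Fin 3) (x y : Fin n → ℝ) :
    4 * blockForm T R σ c x y =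
      blockForm T R σ c (x + y) (x + y) - blockForm T R σ c (x - y) (x - y) := by
  have h : x - y = x + (-1 : ℝ) • y := by ext; simp [sub_eq_add_neg]
  have e1 := blockForm_comm T R σ c (x + y) x
  have e2 := blockForm_comm T R σ c (x + y) y
  have e3 := blockForm_comm T R σ c (x + (-1 : ℝ) • y) x
  have e4 := blockForm_comm T R σ c (x + (-1 : ℝ) • y) y
  have e5 := blockForm_comm T R σ c x y
  rw [h]
  simp only [blockForm_add_right, blockForm_smul_right, e1, e2, e3, e4] at *
  rw [e5]
  ring

/-! ### Uniform bounds for the noise -/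

/-- The net over which the union bounds are taken. -/
def unitNet (n : ℕ) : Finset (EuclideanSpace ℝ (Fin n)) :=
  (exists_half_net (EuclideanSpace ℝ (Fin n))).choose

lemma card_unitNet_le (n : ℕ) : (unitNet n).card ≤ 5 ^ n := by
  have h := (exists_half_net (EuclideanSpace ℝ (Fin n))).choose_spec.1
  exact h.trans (by rw [finrank_euclideanSpace_fin])

lemma norm_le_of_mem_unitNet {y : EuclideanSpace ℝ (Fin n)} (hy : y ∈ unitNet n) : ‖y‖ ≤ 1 :=
  (exists_half_net (EuclideanSpace ℝ (Fin n))).choose_spec.2.1 y hy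

lemma unitNet_spec (x : EuclideanSpace ℝ (Fin n)) (hx : ‖x‖ ≤ 1) :
    ∃ y ∈ unitNet n, ‖x - y‖ ≤ 1 / 2 :=
  (exists_half_net (EuclideanSpace ℝ (Fin n))).choose_spec.2.2 x hx

/-- The half-net bound is applied in one argument after the other; each application doubles the
constant. -/
lemma abs_tri_le_of_net {A : Tensor n} {C : ℝ}
    (h : ∀ x ∈ unitNet n, ∀ y ∈ unitNet n, ∀ z ∈ unitNet n, |tri A x y z| ≤ C)
    (x y z : EuclideanSpace ℝ (Fin n)) : |tri A x y z| ≤ 8 * C * ‖x‖ * ‖y‖ * ‖z‖ := by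
  have h1 : ∀ x ∈ unitNet n, ∀ y ∈ unitNet n, |tri A x y z| ≤ 2 * C * ‖z‖ := fun x hx y hy =>
    LinearMap.abs_le_of_half_net unitNet_spec
      ⟨⟨fun z : EuclideanSpace ℝ (Fin n) => tri A x y z, fun a b => tri_add_right A x y a b⟩,
        fun c a => tri_smul_right A x y a c⟩ (h x hx y hy) z
  have h2 : ∀ x ∈ unitNet n, |tri A x y z| ≤ 2 * (2 * C * ‖z‖) * ‖y‖ := fun x hx =>
    LinearMap.abs_le_of_half_net unitNet_spec
      ⟨⟨fun y : EuclideanSpace ℝ (Fin n) => tri A x y z, fun a b => tri_add_mid A x a z b⟩,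
        fun c a => tri_smul_mid A x a z c⟩ (h1 x hx) y
  have h3 := LinearMap.abs_le_of_half_net unitNet_spec
      ⟨⟨fun x : EuclideanSpace ℝ (Fin n) => tri A x y z, fun a b => tri_add_left A a y z b⟩,
        fun c a => tri_smul_left A a y z c⟩ h2 x
  refine h3.trans (le_of_eq ?_)
  ring

/-- Concentration is available for quadratic values only. Polarization gives `C / 2` for pairs of
net points, which explains the sums and differences in the hypothesis; extending the two arguments
doubles the constant twice. -/
lemma abs_blockForm_le_of_net {T : Tensor n} {R : Matrix (Fin n) (Fin n) ℝ}
    {σ : Equiv.Perm (Fin n)} {c : Fin 3} {C : ℝ}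
    (h : ∀ x ∈ unitNet n, ∀ y ∈ unitNet n,
      |blockForm T R σ c (x + y) (x + y)| ≤ C ∧ |blockForm T R σ c (x - y) (x - y)| ≤ C)
    (x y : EuclideanSpace ℝ (Fin n)) : |blockForm T R σ c x y| ≤ 2 * C * ‖x‖ * ‖y‖ := by
  have h0 : ∀ x ∈ unitNet n, ∀ y ∈ unitNet n, |blockForm T R σ c x y| ≤ C / 2 := by
    intro x hx y hy
    have h1 := blockForm_polarization T R σ c x y
    have h2 := abs_le.1 (h x hx y hy).1
    have h3 := abs_le.1 (h x hx y hy).2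
    exact abs_le.2 ⟨by linarith [h2.1, h3.2], by linarith [h2.2, h3.1]⟩
  have h1 : ∀ x ∈ unitNet n, |blockForm T R σ c x y| ≤ 2 * (C / 2) * ‖y‖ := fun x hx =>
    LinearMap.abs_le_of_half_net unitNet_spec
      ⟨⟨fun y : EuclideanSpace ℝ (Fin n) => blockForm T R σ c x y,
        fun a b => blockForm_add_right T R σ c x a b⟩,
        fun r a => blockForm_smul_right T R σ c x a r⟩ (h0 x hx) y
  have h2 := LinearMap.abs_le_of_half_net unitNet_spec
      ⟨⟨fun x : EuclideanSpace ℝ (Fin n) => blockForm T R σ c y x,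
        fun a b => blockForm_add_right T R σ c y a b⟩,
        fun r a => blockForm_smul_right T R σ c y a r⟩
      (c := 2 * (C / 2) * ‖y‖) (fun x hx => by
        have := h1 x hx
        rw [blockForm_comm] at this
        exact this) x
  rw [blockForm_comm]
  refine h2.trans (le_of_eq ?_)
  ring

lemma pow_le_exp {a b : ℝ} (ha : 0 ≤ a) (h : a ≤ Real.exp b) (n : ℕ) :
    a ^ n ≤ Real.exp (b * n) := by
  rw [mul_comm, Real.exp_nat_mul]
  exact pow_le_pow_left₀ ha h n

lemma le_exp_of_le_pow {a : ℝ} {k : ℕ} (h : a ≤ 2.7 ^ k) : a ≤ Real.exp k := by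
  refine h.trans ?_
  rw [← mul_one (k : ℝ), Real.exp_nat_mul]
  exact pow_le_pow_left₀ (by norm_num) (by linarith [Real.exp_one_gt_d9]) k

/-- The trilinear form of the noise is of order `√n` on the whole unit ball. -/
lemma tri_noise_net_tail (n : ℕ) :
    noiseLaw n {a | ∃ x ∈ unitNet n, ∃ y ∈ unitNet n, ∃ z ∈ unitNet n,
        10 * Real.sqrt n ≤ |tri (noiseTensor a) x y z|} ≤
      ENNReal.ofReal (2 * Real.exp (-n)) := by
  have hset : {a : Sym (Fin n) 3 → ℝ | ∃ x ∈ unitNet n, ∃ y ∈ unitNet n, ∃ z ∈ unitNet n,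
        10 * Real.sqrt n ≤ |tri (noiseTensor a) x y z|} =
      ⋃ p ∈ unitNet n ×ˢ (unitNet n ×ˢ unitNet n),
        {a | 10 * Real.sqrt n ≤ |tri (noiseTensor a) p.1 p.2.1 p.2.2|} := by
    ext a
    simp only [Set.mem_ofPred_eq, Set.mem_iUnion, Finset.mem_product, exists_prop, Prod.exists]
    constructor
    · rintro ⟨x, hx, y, hy, z, hz, h⟩
      exact ⟨x, y, z, ⟨hx, hy, hz⟩, h⟩
    · rintro ⟨x, y, z, ⟨hx, hy, hz⟩, h⟩
      exact ⟨x, hx, y, hy, z, hz, h⟩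
  rw [hset, ← ofReal_measureReal (measure_ne_top _ _)]
  apply ENNReal.ofReal_le_ofReal
  refine (measureReal_biUnion_finset_le _ _).trans ?_
  have hb : ∀ p ∈ unitNet n ×ˢ (unitNet n ×ˢ unitNet n),
      (noiseLaw n).real {a | 10 * Real.sqrt n ≤ |tri (noiseTensor a) p.1 p.2.1 p.2.2|} ≤
      2 * Real.exp (-(10 * Real.sqrt n) ^ 2 / 12) := by
    intro p hp
    simp only [Finset.mem_product] at hp
    have hle : ∀ y ∈ unitNet n, ∑ i, y i ^ 2 ≤ 1 := fun y hy => by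
      rw [← EuclideanSpace.real_norm_sq_eq]
      exact pow_le_one₀ (norm_nonneg _) (norm_le_of_mem_unitNet hy)
    exact tri_noise_tail (hle _ hp.1) (hle _ hp.2.1) (hle _ hp.2.2) (by positivity)
  refine (Finset.sum_le_sum hb).trans ?_
  rw [Finset.sum_const, nsmul_eq_mul]
  have hc : ((unitNet n ×ˢ (unitNet n ×ˢ unitNet n)).card : ℝ) ≤ 125 ^ n := by
    rw [Finset.card_product, Finset.card_product]
    have := card_unitNet_le n
    have h1 : (unitNet n).card * ((unitNet n).card * (unitNet n).card) ≤ 5 ^ n * (5 ^ n * 5 ^ n) := by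
      gcongr
    rw [← mul_pow, ← mul_pow] at h1
    exact_mod_cast h1
  -- The union over `5^{3n}` triples costs `exp (5 n)`, against a tail of `exp (-100 n / 12)`.
  have h125 : (125 : ℝ) ^ n ≤ Real.exp (5 * n) :=
    pow_le_exp (by norm_num) (by exact_mod_cast le_exp_of_le_pow (k := 5) (by norm_num)) n
  refine (mul_le_mul_of_nonneg_right (hc.trans h125) (by positivity)).trans ?_
  rw [mul_left_comm, ← Real.exp_add]
  refine mul_le_mul_of_nonneg_left (Real.exp_le_exp.2 ?_) (by norm_num)
  have hn : (0 : ℝ) ≤ n := Nat.cast_nonneg _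
  rw [mul_pow, Real.sq_sqrt hn]
  linarith

lemma transpose_mulVec_row {R : Matrix (Fin n) (Fin n) ℝ} (hR : R * Rᵀ = 1) (y : Fin n → ℝ)
    (i : Fin n) : ∑ k, R i k * (Rᵀ *ᵥ y) k = y i := by
  have h : (R *ᵥ (Rᵀ *ᵥ y)) i = y i := by rw [Matrix.mulVec_mulVec, hR, Matrix.one_mulVec]
  exact h

/-- The vector `Rᵀ *ᵥ mask σ c x` is a combination of the rows in part `c` and hence orthogonal to
the rows in the other two parts, as the variance computation requires. The radius `2` allows for
sums and differences of net points. -/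
lemma blockForm_noise_tail {R : Matrix (Fin n) (Fin n) ℝ} (hR : R * Rᵀ = 1)
    (σ : Equiv.Perm (Fin n)) (c : Fin 3) (hn : 1 ≤ n) {x : EuclideanSpace ℝ (Fin n)}
    (hx : ‖x‖ ≤ 2) :
    (noiseLaw n).real {a | 1000 * (n * Real.sqrt n) < |blockForm (noiseTensor a) R σ c x x|} ≤
      2 * Real.exp (-(6 * n)) := by
  have hn' : (1 : ℝ) ≤ n := by exact_mod_cast hn
  have hs1 : 1 ≤ Real.sqrt n := Real.one_le_sqrt.2 hn'
  have hss : Real.sqrt n * Real.sqrt n = n := Real.mul_self_sqrt (by linarith)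
  have hRt : Rᵀ * Rᵀᵀ = 1 := by rw [Matrix.transpose_transpose]; exact mul_eq_one_comm.1 hR
  have hx2 : ∑ i, mask σ c x i ^ 2 ≤ 4 := by
    refine (sum_mask_sq_le σ c x).trans ?_
    rw [← EuclideanSpace.real_norm_sq_eq]
    nlinarith [norm_nonneg x]
  have hx0 : 0 ≤ ∑ i, mask σ c x i ^ 2 := Finset.sum_nonneg fun _ _ => sq_nonneg _
  have hdis : c + 1 ≠ c + 2 := by fin_cases c <;> decide
  have hd1 : c + 1 ≠ c := by fin_cases c <;> decide
  have hd2 : c + 2 ≠ c := by fin_cases c <;> decide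
  -- The choice `l = 1 / (96 √n)`, `t = 800 n^{3/2}` makes the exponent `n / 8 - (800 / 96) n ≤ -6
  -- n`, which survives a union over the `25 ^ n` pairs of net points.
  have h := noise_quadratic_tail (h := Rᵀ *ᵥ mask σ c x) hR (disjoint_partSet σ hdis)
    (fun i hi => by rw [transpose_mulVec_row hR, mask_eq_zero hd1 _ hi])
    (fun i hi => by rw [transpose_mulVec_row hR, mask_eq_zero hd2 _ hi])
    (by rw [sum_mulVec_sq hRt]; exact hx2)
    (l := 1 / (96 * Real.sqrt n)) (t := 800 * (n * Real.sqrt n)) (by positivity)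
    (one_div_le_one_div_of_le (by norm_num) (by linarith))
  rw [sum_mulVec_sq hRt] at h
  refine (measureReal_mono ?_).trans (h.trans ?_)
  · intro a ha
    have ha' : 1000 * (n * Real.sqrt n) < |blockForm (noiseTensor a) R σ c x x| := ha
    rw [blockForm_self] at ha'
    rw [Set.mem_ofPred_eq]
    set Q := ∑ i ∈ partSet σ (c + 1), ∑ j ∈ partSet σ (c + 2),
        tri (noiseTensor a) (R i) (R j) (Rᵀ *ᵥ mask σ c x) ^ 2
    set m := ∑ i, mask σ c x i ^ 2
    set k := ((partSet σ (c + 1)).card : ℝ) * (partSet σ (c + 2)).card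
    have hk : |k - (n : ℝ) ^ 2 / 9| ≤ (n : ℝ) + 1 := card_mul_card_partSet σ _ _
    have h1 : |Q - (n : ℝ) ^ 2 / 9 * m| ≤ |Q - k * m| + |k - (n : ℝ) ^ 2 / 9| * m := by
      have e : Q - (n : ℝ) ^ 2 / 9 * m = (Q - k * m) + (k - n ^ 2 / 9) * m := by ring
      rw [e, ← abs_of_nonneg hx0, ← abs_mul, abs_of_nonneg hx0]
      exact abs_add_le _ _
    have h2 : |k - (n : ℝ) ^ 2 / 9| * m ≤ (n + 1) * 4 := mul_le_mul hk hx2 hx0 (by linarith)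
    have h3 : (n : ℝ) ≤ n * Real.sqrt n := by nlinarith
    linarith
  · refine mul_le_mul_of_nonneg_left (Real.exp_le_exp.2 ?_) (by norm_num)
    have hne : Real.sqrt n ≠ 0 := by positivity
    have e1 : (1 / (96 * Real.sqrt n)) ^ 2 * (n : ℝ) ^ 2 = n / 9216 := by
      rw [div_pow, mul_pow, Real.sq_sqrt (by linarith)]
      field_simp
      norm_num
    have e2 : 1 / (96 * Real.sqrt n) * (800 * (n * Real.sqrt n)) = 800 / 96 * n := by
      field_simp
    rw [mul_assoc, e1, e2]
    linarith

/-- The bilinear form of the noise part of a block is of order `n^{3/2}` on the whole ball. -/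
lemma blockForm_noise_net_tail {R : Matrix (Fin n) (Fin n) ℝ} (hR : R * Rᵀ = 1)
    (σ : Equiv.Perm (Fin n)) (hn : 1 ≤ n) :
    noiseLaw n {a | ∃ c : Fin 3, ∃ x ∈ unitNet n, ∃ y ∈ unitNet n,
        1000 * (n * Real.sqrt n) < |blockForm (noiseTensor a) R σ c (x + y) (x + y)| ∨
        1000 * (n * Real.sqrt n) < |blockForm (noiseTensor a) R σ c (x - y) (x - y)|} ≤
      ENNReal.ofReal (12 * Real.exp (-n)) := by
  have hset : {a : Sym (Fin n) 3 → ℝ | ∃ c : Fin 3, ∃ x ∈ unitNet n, ∃ y ∈ unitNet n,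
        1000 * (n * Real.sqrt n) < |blockForm (noiseTensor a) R σ c (x + y) (x + y)| ∨
        1000 * (n * Real.sqrt n) < |blockForm (noiseTensor a) R σ c (x - y) (x - y)|} =
      ⋃ p ∈ (Finset.univ : Finset (Fin 3)) ×ˢ (unitNet n ×ˢ unitNet n),
        ({a | 1000 * (n * Real.sqrt n) < |blockForm (noiseTensor a) R σ p.1
            (p.2.1 + p.2.2 : EuclideanSpace ℝ (Fin n)) (p.2.1 + p.2.2 : EuclideanSpace ℝ (Fin n))|} ∪
         {a | 1000 * (n * Real.sqrt n) < |blockForm (noiseTensor a) R σ p.1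
            (p.2.1 - p.2.2 : EuclideanSpace ℝ (Fin n)) (p.2.1 - p.2.2 : EuclideanSpace ℝ (Fin n))|}) := by
    ext a
    simp only [Set.mem_ofPred_eq, Set.mem_iUnion, Finset.mem_product, exists_prop, Prod.exists,
      Finset.mem_univ, true_and, Set.mem_union]
    constructor
    · rintro ⟨c, x, hx, y, hy, h⟩
      exact ⟨c, x, y, ⟨hx, hy⟩, h⟩
    · rintro ⟨c, x, y, ⟨hx, hy⟩, h⟩
      exact ⟨c, x, hx, y, hy, h⟩
  rw [hset, ← ofReal_measureReal (measure_ne_top _ _)]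
  apply ENNReal.ofReal_le_ofReal
  refine (measureReal_biUnion_finset_le _ _).trans ?_
  have hb : ∀ p ∈ (Finset.univ : Finset (Fin 3)) ×ˢ (unitNet n ×ˢ unitNet n),
      (noiseLaw n).real ({a | 1000 * (n * Real.sqrt n) < |blockForm (noiseTensor a) R σ p.1
            (p.2.1 + p.2.2 : EuclideanSpace ℝ (Fin n)) (p.2.1 + p.2.2 : EuclideanSpace ℝ (Fin n))|} ∪
         {a | 1000 * (n * Real.sqrt n) < |blockForm (noiseTensor a) R σ p.1
            (p.2.1 - p.2.2 : EuclideanSpace ℝ (Fin n)) (p.2.1 - p.2.2 : EuclideanSpace ℝ (Fin n))|}) ≤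
      4 * Real.exp (-(6 * n)) := by
    intro p hp
    simp only [Finset.mem_product] at hp
    have h1 := norm_le_of_mem_unitNet hp.2.1
    have h2 := norm_le_of_mem_unitNet hp.2.2
    have h3 := blockForm_noise_tail hR σ p.1 hn (x := p.2.1 + p.2.2)
      ((norm_add_le _ _).trans (by linarith))
    have h4 := blockForm_noise_tail hR σ p.1 hn (x := p.2.1 - p.2.2)
      ((norm_sub_le _ _).trans (by linarith))
    refine (measureReal_union_le _ _).trans ?_
    linarith
  refine (Finset.sum_le_sum hb).trans ?_
  rw [Finset.sum_const, nsmul_eq_mul]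
  have hc : (((Finset.univ : Finset (Fin 3)) ×ˢ (unitNet n ×ˢ unitNet n)).card : ℝ) ≤
      3 * 25 ^ n := by
    rw [Finset.card_product, Finset.card_product]
    have := card_unitNet_le n
    have h1 : (Finset.univ : Finset (Fin 3)).card * ((unitNet n).card * (unitNet n).card) ≤
        3 * (5 ^ n * 5 ^ n) := by
      rw [Finset.card_univ, Fintype.card_fin]
      gcongr
    rw [← mul_pow] at h1
    exact_mod_cast h1
  have h25 : (25 : ℝ) ^ n ≤ Real.exp (4 * n) :=
    pow_le_exp (by norm_num) (by exact_mod_cast le_exp_of_le_pow (k := 4) (by norm_num)) n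
  have hn' : (0 : ℝ) ≤ n := Nat.cast_nonneg _
  calc _ ≤ 3 * Real.exp (4 * n) * (4 * Real.exp (-(6 * n))) :=
        mul_le_mul_of_nonneg_right (hc.trans (by linarith)) (by positivity)
    _ = 12 * Real.exp (4 * n + -(6 * n)) := by rw [Real.exp_add]; ring
    _ ≤ _ := mul_le_mul_of_nonneg_left (Real.exp_le_exp.2 (by linarith)) (by norm_num)

end SpikedTensor

/-! ### Perturbation of a rank one operator and the power method -/

section PowerMethod

variable {E : Type*} [NormedAddCommGroup E] [InnerProductSpace ℝ E]

/-- A vector that is close to `w` and `-w` up to scaling, after normalization. -/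
lemma norm_normalize_sub_le {w y r : E} {α θ : ℝ} (hw : ‖w‖ = 1) (hα : α ≠ 0)
    (hy : y = α • w + r) (hr : ‖r‖ ≤ θ * |α|) :
    ∃ s : ℝ, (s = 1 ∨ s = -1) ∧ ‖‖y‖⁻¹ • y - s • w‖ ≤ 2 * θ := by
  have hα' : 0 < |α| := abs_pos.2 hα
  -- The sign is that of `α`. One `θ` pays for dropping `r`, the other for scaling by `‖y‖` instead
  -- of `|α|`.
  refine ⟨α / |α|, ?_, ?_⟩
  · rcases abs_cases α with ⟨h, -⟩ | ⟨h, -⟩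
    · left; rw [h, div_self hα]
    · right; rw [h, div_neg, div_self hα]
  · have hαw : ‖α • w‖ = |α| := by rw [norm_smul, hw, mul_one, Real.norm_eq_abs]
    have hr2 : |α|⁻¹ * ‖r‖ ≤ θ := by
      rw [inv_mul_le_iff₀ hα', mul_comm]; exact hr
    have h1 : |α|⁻¹ • y - (α / |α|) • w = |α|⁻¹ • r := by
      rw [hy, smul_add, smul_smul, div_eq_inv_mul]; abel
    have h2 : ‖|α|⁻¹ • y - (α / |α|) • w‖ ≤ θ := by
      rw [h1, norm_smul, norm_inv, Real.norm_eq_abs, abs_abs]; exact hr2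
    have h3 : ‖‖y‖⁻¹ • y - |α|⁻¹ • y‖ ≤ θ := by
      rw [← sub_smul, norm_smul, Real.norm_eq_abs]
      rcases eq_or_ne y 0 with h0 | h0
      · rw [h0, norm_zero, mul_zero]
        exact (mul_nonneg (inv_nonneg.2 hα'.le) (norm_nonneg r)).trans hr2
      · have hy0 : 0 < ‖y‖ := norm_pos_iff.2 h0
        have h4 : |‖y‖⁻¹ - |α|⁻¹| * ‖y‖ = |α|⁻¹ * |(|α| - ‖y‖)| := by
          have : (‖y‖⁻¹ - |α|⁻¹) * ‖y‖ = |α|⁻¹ * (|α| - ‖y‖) := by field_simp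
          rw [← abs_of_pos hy0, ← abs_mul, abs_of_pos hy0, this, abs_mul,
            abs_of_pos (inv_pos.2 hα')]
        rw [h4]
        refine le_trans (mul_le_mul_of_nonneg_left ?_ (inv_nonneg.2 hα'.le)) hr2
        rw [← hαw]
        refine (abs_norm_sub_norm_le _ _).trans ?_
        rw [hy, sub_add_cancel_left, norm_neg]
    calc ‖‖y‖⁻¹ • y - (α / |α|) • w‖
        = ‖(‖y‖⁻¹ • y - |α|⁻¹ • y) + (|α|⁻¹ • y - (α / |α|) • w)‖ := by congr 1; abel
      _ ≤ θ + θ := (norm_add_le _ _).trans (add_le_add h3 h2)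
      _ = 2 * θ := by ring

variable {T : E →ₗ[ℝ] E} {q w : E} {l η : ℝ}

/-- The bilinear bound is tested against the error vector `d` itself. When `d = 0`, the right-hand
side is nonnegative because of the bound at `(y, y)`. -/
lemma norm_apply_sub_rank_one_le
    (hT : ∀ x y, |inner ℝ x (T y) - l * (inner ℝ q x * inner ℝ q y)| ≤ η * l * ‖x‖ * ‖y‖)
    (y : E) : ‖T y - (l * inner ℝ q y) • q‖ ≤ η * l * ‖y‖ := by
  set d := T y - (l * inner ℝ q y) • q with hd
  have h := hT d y
  have e : inner ℝ d (T y) - l * (inner ℝ q d * inner ℝ q y) = ‖d‖ ^ 2 := by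
    have : T y = d + (l * inner ℝ q y) • q := by rw [hd]; abel
    rw [this, inner_add_right, real_inner_self_eq_norm_sq, inner_smul_right,
      real_inner_comm d q]
    ring
  rw [e, abs_of_nonneg (sq_nonneg _)] at h
  rcases (norm_nonneg d).eq_or_lt with h0 | h0
  · rw [← h0] at h ⊢
    have := hT y y
    by_contra hcon
    push Not at hcon
    have hy : 0 < ‖y‖ := by
      rcases (norm_nonneg y).eq_or_lt with h1 | h1
      · rw [← h1] at hcon; simp at hcon
      · exact h1
    have h2 : η * l * ‖y‖ * ‖y‖ < 0 := mul_neg_of_neg_of_pos hcon hy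
    linarith [abs_nonneg (inner ℝ y (T y) - l * (inner ℝ q y * inner ℝ q y))]
  · nlinarith

/-- First-order condition at a maximum: `‖T w‖² ‖u‖² - ‖T u‖²` is nonnegative everywhere and zero at
`w`, so its derivative at `w` vanishes. The variation is taken in the direction `d` of the supposed
defect. -/
lemma apply_apply_of_isTop (hs : T.IsSymmetric) (hw : ‖w‖ = 1)
    (htop : ∀ u, ‖u‖ = 1 → ‖T u‖ ≤ ‖T w‖) : T (T w) = ‖T w‖ ^ 2 • w := by
  have hle : ∀ u, ‖T u‖ ^ 2 ≤ ‖T w‖ ^ 2 * ‖u‖ ^ 2 := by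
    intro u
    rcases eq_or_ne u 0 with rfl | hu
    · simp
    have hu' : ‖u‖ ≠ 0 := norm_ne_zero_iff.2 hu
    have h1 := htop (‖u‖⁻¹ • u) (norm_smul_inv_norm (𝕜 := ℝ) hu)
    rw [map_smul, norm_smul, norm_inv, norm_norm, inv_mul_le_iff₀ (by positivity)] at h1
    rw [← mul_pow, mul_comm]
    exact pow_le_pow_left₀ (norm_nonneg _) h1 2
  set d := ‖T w‖ ^ 2 • w - T (T w) with hd
  suffices d = 0 by rw [hd, sub_eq_zero] at this; exact this.symm
  by_contra hne
  have hdpos : 0 < ‖d‖ ^ 2 := by have := norm_pos_iff.2 hne; positivity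
  -- the nonnegative quadratic form `‖T w‖² ‖u‖² - ‖T u‖²` vanishes at `w`
  have key : ∀ t : ℝ, 0 ≤ 2 * t * ‖d‖ ^ 2 + t ^ 2 * (‖T w‖ ^ 2 * ‖d‖ ^ 2) := by
    intro t
    have h1 := hle (w + t • d)
    rw [map_add, map_smul, norm_add_sq_real, norm_add_sq_real, hw, norm_smul, norm_smul,
      inner_smul_right, inner_smul_right, ← hs (T w) d, mul_pow, mul_pow, Real.norm_eq_abs,
      sq_abs] at h1
    have h2 : ‖T w‖ ^ 2 * inner ℝ w d - inner ℝ (T (T w)) d = ‖d‖ ^ 2 := by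
      have e : inner ℝ d d = inner ℝ (‖T w‖ ^ 2 • w - T (T w)) d := by rw [← hd]
      rw [← real_inner_self_eq_norm_sq d, e, inner_sub_left, inner_smul_left]
      simp
    have h3 := sq_nonneg (‖T d‖)
    have h4 : 2 * t * (‖T w‖ ^ 2 * inner ℝ w d - inner ℝ (T (T w)) d) = 2 * t * ‖d‖ ^ 2 := by
      rw [h2]
    have h5 := mul_nonneg (sq_nonneg t) h3
    linarith
  -- A step of this size is short enough for the negative linear term to dominate the quadratic one.
  have hk := key (-(1 / (1 + ‖T w‖ ^ 2)))
  have hp : 0 < 1 + ‖T w‖ ^ 2 := by positivity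
  have e : 2 * -(1 / (1 + ‖T w‖ ^ 2)) * ‖d‖ ^ 2 +
      (-(1 / (1 + ‖T w‖ ^ 2))) ^ 2 * (‖T w‖ ^ 2 * ‖d‖ ^ 2) =
      -(‖d‖ ^ 2 * (2 + ‖T w‖ ^ 2) / (1 + ‖T w‖ ^ 2) ^ 2) := by
    field_simp
    ring
  rw [e] at hk
  have : 0 < ‖d‖ ^ 2 * (2 + ‖T w‖ ^ 2) / (1 + ‖T w‖ ^ 2) ^ 2 := by positivity
  linarith

/-- A top singular vector of a perturbation of `l • q qᵀ` is close to `±q`, and the operator is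
small on its complement. -/
lemma top_singular_near (hs : T.IsSymmetric) (hq : ‖q‖ = 1) (hl : 0 < l) (hη : 0 ≤ η)
    (hη' : η ≤ 1 / 20)
    (hT : ∀ x y, |inner ℝ x (T y) - l * (inner ℝ q x * inner ℝ q y)| ≤ η * l * ‖x‖ * ‖y‖)
    (hw : ‖w‖ = 1) (htop : ∀ u, ‖u‖ = 1 → ‖T u‖ ≤ ‖T w‖) :
    (∃ s : ℝ, (s = 1 ∨ s = -1) ∧ ‖w - s • q‖ ≤ 3 * η) ∧ 0 < ‖T w‖ ∧
      ∀ x, inner ℝ w x = 0 → ‖T x‖ ≤ ‖T w‖ / 4 * ‖x‖ := by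
  have hE := norm_apply_sub_rank_one_le hT
  have hqq : inner ℝ q q = (1 : ℝ) := by rw [real_inner_self_eq_norm_sq, hq]; norm_num
  have hσ : l * (1 - η) ≤ ‖T w‖ := by
    have h1 := hE q
    rw [hqq, mul_one, hq] at h1
    have h2 := norm_sub_norm_le (l • q) (T q)
    rw [norm_smul, hq, Real.norm_eq_abs, abs_of_pos hl, ← norm_sub_rev (T q)] at h2
    have := htop q hq
    linarith
  have hσ0 : 0 < ‖T w‖ := lt_of_lt_of_le (mul_pos hl (by linarith)) hσ
  have hTT := apply_apply_of_isTop hs hw htop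
  set c : ℝ := inner ℝ q w with hc
  -- the component of `w` orthogonal to `q`
  have hperp : ‖w - c • q‖ ≤ 2 * η := by
    -- So far `w` is only known to be an eigenvector of `T²`. Applying the rank one approximation to
    -- `T w` and projecting away from `q` gives `‖T w‖² ‖d‖² ≤ ‖d‖ η l ‖T w‖`.
    have h1 := hE (T w)
    rw [hTT] at h1
    set d := w - c • q with hd
    have hqd : inner ℝ q d = (0 : ℝ) := by
      rw [hd, inner_sub_right, inner_smul_right, hqq, hc]; ring
    have h2 : inner ℝ d (‖T w‖ ^ 2 • w - (l * inner ℝ q (T w)) • q) = ‖T w‖ ^ 2 * ‖d‖ ^ 2 := by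
      have hw' : w = d + c • q := by rw [hd]; abel
      rw [inner_sub_right, inner_smul_right, inner_smul_right, real_inner_comm q d, hqd]
      nth_rewrite 2 [hw']
      rw [inner_add_right, inner_smul_right, real_inner_comm q d, hqd, real_inner_self_eq_norm_sq]
      ring
    have h3 := real_inner_le_norm d (‖T w‖ ^ 2 • w - (l * inner ℝ q (T w)) • q)
    rw [h2] at h3
    rcases (norm_nonneg d).eq_or_lt with h0 | h0
    · rw [← h0]; linarith
    · have h4 : ‖T w‖ ^ 2 * ‖d‖ ^ 2 ≤ ‖d‖ * (η * l * ‖T w‖) :=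
        h3.trans (mul_le_mul_of_nonneg_left h1 h0.le)
      have h5 : ‖T w‖ * ‖d‖ ≤ η * l := by
        have h6 : (‖T w‖ * ‖d‖) * (‖T w‖ * ‖d‖) ≤ (‖T w‖ * ‖d‖) * (η * l) := by nlinarith
        exact le_of_mul_le_mul_left h6 (by positivity)
      have h7 : l * (1 - η) * ‖d‖ ≤ η * l := (mul_le_mul_of_nonneg_right hσ h0.le).trans h5
      have h8 : (1 - η) * ‖d‖ ≤ η := by
        have : l * ((1 - η) * ‖d‖) ≤ l * η := by linarith
        exact le_of_mul_le_mul_left this hl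
      nlinarith
  have hnorm : 1 - c ^ 2 = ‖w - c • q‖ ^ 2 := by
    rw [norm_sub_sq_real, hw, inner_smul_right, real_inner_comm q w, ← hc, norm_smul, hq,
      mul_one, Real.norm_eq_abs, sq_abs]
    ring
  have hnear : ∃ s : ℝ, (s = 1 ∨ s = -1) ∧ ‖w - s • q‖ ≤ 3 * η := by
    have hc1 : |c| ≤ 1 := by
      have := abs_real_inner_le_norm q w
      rwa [hq, hw, one_mul] at this
    have h2 : 1 - c ^ 2 ≤ 4 * η ^ 2 := by
      rw [hnorm]
      nlinarith [norm_nonneg (w - c • q)]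
    have fin : ∀ s : ℝ, s ^ 2 = 1 → s * c = |c| → ‖w - s • q‖ ≤ 3 * η := by
      intro s hs2 hsc
      apply le_of_sq_le_sq _ (by positivity)
      rw [norm_sub_sq_real, hw, inner_smul_right, real_inner_comm q w, ← hc, norm_smul, hq,
        mul_one, Real.norm_eq_abs, sq_abs, hs2, hsc]
      have h3 : 1 - |c| ≤ 1 - c ^ 2 := by
        rw [← sq_abs]; nlinarith [abs_nonneg c]
      nlinarith
    rcases abs_cases c with ⟨h, -⟩ | ⟨h, -⟩
    · exact ⟨1, Or.inl rfl, fin 1 (by norm_num) (by rw [h, one_mul])⟩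
    · exact ⟨-1, Or.inr rfl, fin (-1) (by norm_num) (by rw [h]; ring)⟩
  refine ⟨hnear, hσ0, fun x hx => ?_⟩
  obtain ⟨s, hs1, hsn⟩ := hnear
  -- A vector orthogonal to `w` is nearly orthogonal to `q`, because `w` is close to `±q`.
  have h1 : |inner ℝ q x| ≤ 3 * η * ‖x‖ := by
    have hs2 : s * s = 1 := by rcases hs1 with rfl | rfl <;> norm_num
    have hsa : |s| = 1 := by rcases hs1 with rfl | rfl <;> norm_num
    have e : inner ℝ q x = -s * inner ℝ (w - s • q) x := by
      rw [inner_sub_left, hx, inner_smul_left]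
      simp only [conj_trivial]
      linear_combination (-(inner ℝ q x : ℝ)) * hs2
    rw [e, abs_mul, abs_neg, hsa, one_mul]
    exact (abs_real_inner_le_norm _ _).trans (mul_le_mul_of_nonneg_right hsn (norm_nonneg _))
  have h2 := hE x
  have h3 : ‖T x‖ ≤ ‖T x - (l * inner ℝ q x) • q‖ + ‖(l * inner ℝ q x) • q‖ := by
    simpa using norm_add_le (T x - (l * inner ℝ q x) • q) ((l * inner ℝ q x) • q)
  rw [norm_smul, hq, mul_one, Real.norm_eq_abs, abs_mul, abs_of_pos hl] at h3
  have h4 : l * |inner ℝ q x| ≤ l * (3 * η * ‖x‖) := mul_le_mul_of_nonneg_left h1 hl.le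
  -- Since `η ≤ 1 / 20` and `‖T w‖ ≥ l (1 - η)`, the factor `4 η l` is at most `‖T w‖ / 4`.
  have h5 : ‖T x‖ ≤ 4 * η * l * ‖x‖ := by linarith
  refine h5.trans (mul_le_mul_of_nonneg_right ?_ (norm_nonneg _))
  nlinarith

/-- If the operator contracts the complement of the top singular vector `w`, then `w` is an
eigenvector. -/
lemma exists_eigenvalue_of_isTop (hs : T.IsSymmetric) (hw : ‖w‖ = 1)
    (htop : ∀ u, ‖u‖ = 1 → ‖T u‖ ≤ ‖T w‖) (hpos : 0 < ‖T w‖)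
    (hgap : ∀ x, inner ℝ w x = 0 → ‖T x‖ ≤ ‖T w‖ / 4 * ‖x‖) :
    ∃ μ : ℝ, |μ| = ‖T w‖ ∧ T w = μ • w := by
  have hTT := apply_apply_of_isTop hs hw htop
  set μ : ℝ := inner ℝ w (T w) with hμ
  set z := T w - μ • w with hz
  have hww : inner ℝ w w = (1 : ℝ) := by rw [real_inner_self_eq_norm_sq, hw]; norm_num
  have hwz : inner ℝ w z = 0 := by
    rw [hz, inner_sub_right, inner_smul_right, hww, hμ]; ring
  have hTz : T z = ‖T w‖ ^ 2 • w - μ • T w := by rw [hz, map_sub, map_smul, hTT]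
  -- The defect `z` is orthogonal to `w` and would be an eigenvector of `T²` with the top
  -- eigenvalue, which the contraction on the complement excludes unless `z = 0`.
  have hTTz : T (T z) = ‖T w‖ ^ 2 • z := by
    rw [hTz, map_sub, map_smul, map_smul, hTT, hz, smul_sub, smul_smul, smul_smul, mul_comm μ]
  have h1 : ‖T z‖ ^ 2 = ‖T w‖ ^ 2 * ‖z‖ ^ 2 := by
    rw [← real_inner_self_eq_norm_sq (T z), ← hs (T z) z, hTTz, inner_smul_left,
      real_inner_self_eq_norm_sq]
    simp
  have h2 := hgap z hwz
  have h3 : z = 0 := by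
    by_contra h0
    have h0' : 0 < ‖z‖ := norm_pos_iff.2 h0
    have h4 : ‖T z‖ ^ 2 ≤ (‖T w‖ / 4 * ‖z‖) ^ 2 := pow_le_pow_left₀ (norm_nonneg _) h2 2
    rw [h1] at h4
    have : 0 < ‖T w‖ ^ 2 * ‖z‖ ^ 2 := by positivity
    nlinarith
  have h4 : T w = μ • w := by rw [hz, sub_eq_zero] at h3; exact h3
  refine ⟨μ, ?_, h4⟩
  rw [h4, norm_smul, hw, mul_one, Real.norm_eq_abs]

/-- Linear convergence of the power method. -/
lemma exists_sign_power_near (hs : T.IsSymmetric) (hw : ‖w‖ = 1)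
    (htop : ∀ u, ‖u‖ = 1 → ‖T u‖ ≤ ‖T w‖) (hpos : 0 < ‖T w‖)
    (hgap : ∀ x, inner ℝ w x = 0 → ‖T x‖ ≤ ‖T w‖ / 4 * ‖x‖) {g : E} (hg : inner ℝ w g ≠ 0)
    (k : ℕ) :
    ∃ s : ℝ, (s = 1 ∨ s = -1) ∧ ‖‖(T ^ k) g‖⁻¹ • (T ^ k) g - s • w‖ ≤
      2 * ((1 / 4) ^ k * (‖g‖ / |inner ℝ w g|)) := by
  -- The eigenvalue `μ` may be negative and the iterates may alternate in sign, so the sign `s`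
  -- depends on `k`.
  obtain ⟨μ, hμ, hTw⟩ := exists_eigenvalue_of_isTop hs hw htop hpos hgap
  have hμ0 : μ ≠ 0 := fun h => by rw [h, abs_zero] at hμ; linarith
  set a : ℝ := inner ℝ w g with ha
  have hww : inner ℝ w w = (1 : ℝ) := by rw [real_inner_self_eq_norm_sq, hw]; norm_num
  -- The component along `w` is multiplied by `μ` in each step, and the remainder stays orthogonal
  -- to `w` and shrinks by `‖T w‖ / 4`.
  have hdec : ∃ r : ℕ → E, ∀ k, (T ^ k) g = (μ ^ k * a) • w + r k ∧ inner ℝ w (r k) = 0 ∧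
      ‖r k‖ ≤ (‖T w‖ / 4) ^ k * ‖g‖ := by
    refine ⟨fun k => (T ^ k) (g - a • w), fun k => ?_⟩
    have hr : inner ℝ w ((T ^ k) (g - a • w)) = 0 ∧
        ‖(T ^ k) (g - a • w)‖ ≤ (‖T w‖ / 4) ^ k * ‖g‖ := by
      induction k with
      | zero =>
        constructor
        · simp only [pow_zero, Module.End.one_apply]
          rw [inner_sub_right, inner_smul_right, hww, ha]; ring
        · simp only [pow_zero, Module.End.one_apply, one_mul]
          apply le_of_sq_le_sq _ (norm_nonneg _)
          rw [norm_sub_sq_real, inner_smul_right, real_inner_comm w g, ← ha, norm_smul, hw,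
            mul_one, Real.norm_eq_abs, sq_abs]
          nlinarith [sq_nonneg a]
      | succ k ih =>
        rw [pow_succ', Module.End.mul_apply]
        constructor
        · rw [← hs, hTw, inner_smul_left, ih.1, mul_zero]
        · refine (hgap _ ih.1).trans ?_
          rw [pow_succ', mul_assoc]
          exact mul_le_mul_of_nonneg_left ih.2 (by positivity)
    refine ⟨?_, hr⟩
    have hpw : ∀ k : ℕ, (T ^ k) w = μ ^ k • w := fun k => by
      induction k with
      | zero => simp
      | succ k ih => rw [pow_succ', Module.End.mul_apply, ih, map_smul, hTw, smul_smul, pow_succ]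
    change _ = _ + (T ^ k) (g - a • w)
    rw [map_sub, map_smul, hpw, smul_smul, mul_comm (μ ^ k)]
    abel
  obtain ⟨r, hr⟩ := hdec
  obtain ⟨h1, -, h3⟩ := hr k
  refine norm_normalize_sub_le hw (mul_ne_zero (pow_ne_zero k hμ0) hg) h1 (h3.trans (le_of_eq ?_))
  have ha0 : |a| ≠ 0 := abs_ne_zero.2 hg
  rw [abs_mul, abs_pow, hμ, div_pow, div_pow, one_pow]
  field_simp

end PowerMethod

/-! ### Power iterates as normalized matrix powers -/

namespace SpikedTensor

variable {n : ℕ}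

/-- Intermediate normalizations only rescale by a positive factor and may be postponed to the end;
for `y = 0` both sides are `0` by the convention `0 / 0 = 0`. -/
lemma normalized_map_normalized (f : EuclideanSpace ℝ (Fin n) →ₗ[ℝ] EuclideanSpace ℝ (Fin n))
    (y : EuclideanSpace ℝ (Fin n)) : normalized (f (normalized y)) = normalized (f y) := by
  rcases eq_or_ne y 0 with rfl | hy
  · simp [normalized]
  · have h : (0 : ℝ) < ‖y‖ := norm_pos_iff.2 hy
    simp only [normalized, map_smul, norm_smul, norm_inv, norm_norm, smul_smul, mul_inv, inv_inv]
    congr 1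
    field_simp

lemma powerIterate_eq (M : Matrix (Fin n) (Fin n) ℝ) (g : Fin n → ℝ) (k : ℕ) :
    powerIterate M g k = normalized ((Matrix.toEuclideanLin M ^ k) (WithLp.toLp 2 g)) := by
  induction k with
  | zero => simp [powerIterate]
  | succ k ih => rw [powerIterate, ih, normalized_map_normalized, pow_succ', Module.End.mul_apply]

end SpikedTensor

namespace SpikedTensor

variable {n : ℕ}

/-! ### The matrices of the algorithm for a general matrix in place of the rotation -/

/-- `(Q ⊗ Q) T Qᵀ`. -/
def rotMat (T : Tensor n) (Q : Matrix (Fin n) (Fin n) ℝ) : Matrix (Fin n × Fin n) (Fin n) ℝ :=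
  (Q ⊗ₖ Q) * unfolding T * Qᵀ

/-- The block matrix of part `a` for a general matrix in place of the rotation. -/
def blockMat (T : Tensor n) (Q : Matrix (Fin n) (Fin n) ℝ) (σ : Equiv.Perm (Fin n)) (a : Fin 3) :
    Matrix (Fin n) (Fin n) ℝ :=
  partProj σ a * (rotMat T Q)ᵀ * (partProj σ (a + 1) ⊗ₖ partProj σ (a + 2)) * rotMat T Q *
    partProj σ a - ((n : ℝ) ^ 2 / 9) • partProj σ a

lemma transpose_mulVec_eq_sum (R : Matrix (Fin n) (Fin n) ℝ) (x : Fin n → ℝ) :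
    Rᵀ *ᵥ x = ∑ i, x i • (R i : Fin n → ℝ) := by
  ext j
  simp [Matrix.mulVec, dotProduct, mul_comm, Finset.sum_apply]

lemma tri_transpose_mulVec_left (A : Tensor n) (R : Matrix (Fin n) (Fin n) ℝ)
    (x y z : Fin n → ℝ) : tri A (Rᵀ *ᵥ x) y z = ∑ i, x i * tri A (R i) y z := by
  let f : (Fin n → ℝ) →ₗ[ℝ] ℝ :=
    ⟨⟨fun w => tri A w y z, fun a b => tri_add_left A a y z b⟩, fun c a => tri_smul_left A a y z c⟩
  change f (Rᵀ *ᵥ x) = ∑ i, x i * f (R i)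
  rw [transpose_mulVec_eq_sum, map_sum]
  simp

lemma tri_transpose_mulVec_mid (A : Tensor n) (R : Matrix (Fin n) (Fin n) ℝ)
    (x y z : Fin n → ℝ) : tri A x (Rᵀ *ᵥ y) z = ∑ i, y i * tri A x (R i) z := by
  let f : (Fin n → ℝ) →ₗ[ℝ] ℝ :=
    ⟨⟨fun w => tri A x w z, fun a b => tri_add_mid A x a z b⟩, fun c a => tri_smul_mid A x a z c⟩
  change f (Rᵀ *ᵥ y) = ∑ i, y i * f (R i)
  rw [transpose_mulVec_eq_sum, map_sum]
  simp

lemma rotMat_mulVec (T : Tensor n) (Q : Matrix (Fin n) (Fin n) ℝ) (y : Fin n → ℝ)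
    (p : Fin n × Fin n) : (rotMat T Q *ᵥ y) p = tri T (Q p.1) (Q p.2) (Qᵀ *ᵥ y) := by
  rw [rotMat, ← Matrix.mulVec_mulVec, ← Matrix.mulVec_mulVec]
  simp only [Matrix.mulVec, dotProduct, unfolding, Matrix.of_apply, tri, Matrix.kroneckerMap_apply,
    Fintype.sum_prod_type, Finset.mul_sum]
  exact Finset.sum_congr rfl fun _ _ => Finset.sum_congr rfl fun _ _ =>
    Finset.sum_congr rfl fun _ _ => Finset.sum_congr rfl fun _ _ => by ring

lemma partProj_mulVec (σ : Equiv.Perm (Fin n)) (a : Fin 3) (x : Fin n → ℝ) :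
    partProj σ a *ᵥ x = mask σ a x := by
  ext i
  rw [partProj, Matrix.mulVec_diagonal, mask]

lemma kronecker_partProj_mulVec (σ : Equiv.Perm (Fin n)) (a b : Fin 3) (x : Fin n × Fin n → ℝ)
    (p : Fin n × Fin n) :
    ((partProj σ a ⊗ₖ partProj σ b) *ᵥ x) p = mask σ a 1 p.1 * mask σ b 1 p.2 * x p := by
  rw [partProj, partProj, Matrix.diagonal_kronecker_diagonal, Matrix.mulVec_diagonal]
  simp [mask]

lemma partProj_transpose (σ : Equiv.Perm (Fin n)) (a : Fin 3) :
    (partProj σ a)ᵀ = partProj σ a := Matrix.diagonal_transpose _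

/-- This links the matrix of the algorithm to the explicit double sum in which all estimates are
made. -/
lemma dotProduct_blockMat (T : Tensor n) (Q : Matrix (Fin n) (Fin n) ℝ) (σ : Equiv.Perm (Fin n))
    (a : Fin 3) (x y : Fin n → ℝ) :
    x ⬝ᵥ (blockMat T Q σ a *ᵥ y) = blockForm T Q σ a x y := by
  rw [blockMat, Matrix.sub_mulVec, dotProduct_sub, Matrix.smul_mulVec, dotProduct_smul,
    blockForm]
  congr 1
  · have h1 : x ⬝ᵥ ((partProj σ a * (rotMat T Q)ᵀ * (partProj σ (a + 1) ⊗ₖ partProj σ (a + 2)) *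
        rotMat T Q * partProj σ a) *ᵥ y) =
        (rotMat T Q *ᵥ (partProj σ a *ᵥ x)) ⬝ᵥ
          ((partProj σ (a + 1) ⊗ₖ partProj σ (a + 2)) *ᵥ
            (rotMat T Q *ᵥ (partProj σ a *ᵥ y))) := by
      simp only [← Matrix.mulVec_mulVec]
      rw [Matrix.dotProduct_mulVec, ← Matrix.mulVec_transpose, partProj_transpose,
        Matrix.dotProduct_mulVec, Matrix.vecMul_transpose]
    rw [h1]
    simp only [dotProduct, kronecker_partProj_mulVec, rotMat_mulVec, partProj_mulVec,
      Fintype.sum_prod_type]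
    exact Finset.sum_congr rfl fun _ _ => Finset.sum_congr rfl fun _ _ => by ring
  · rw [partProj_mulVec, sum_mask_mul]
    have h2 := sum_mask_mul σ a y x
    simp only [smul_eq_mul, dotProduct]
    congr 1
    refine Finset.sum_congr rfl fun i _ => ?_
    simp only [mask]
    ring

lemma cubicForm_rotMat (T : Tensor n) (Q : Matrix (Fin n) (Fin n) ℝ)
    (x : EuclideanSpace ℝ (Fin n)) :
    cubicForm (rotMat T Q) x = tri T (Qᵀ *ᵥ x) (Qᵀ *ᵥ x) (Qᵀ *ᵥ x) := by
  rw [tri_transpose_mulVec_left, cubicForm]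
  refine Finset.sum_congr rfl fun i _ => ?_
  rw [tri_transpose_mulVec_mid, Finset.mul_sum]
  refine Finset.sum_congr rfl fun j _ => ?_
  rw [← rotMat_mulVec T Q x (i, j), Matrix.mulVec, dotProduct, Finset.mul_sum, Finset.mul_sum]
  exact Finset.sum_congr rfl fun k _ => by ring

lemma inner_toEuclideanLin (M : Matrix (Fin n) (Fin n) ℝ) (x y : EuclideanSpace ℝ (Fin n)) :
    inner ℝ x (Matrix.toEuclideanLin M y) = (x : Fin n → ℝ) ⬝ᵥ (M *ᵥ (y : Fin n → ℝ)) := by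
  simp [PiLp.inner_apply, dotProduct, mul_comm, Matrix.toLpLin_apply]

lemma inner_eq_dotProduct (x y : EuclideanSpace ℝ (Fin n)) :
    inner ℝ x y = (x : Fin n → ℝ) ⬝ᵥ (y : Fin n → ℝ) := by
  simp [PiLp.inner_apply, dotProduct, mul_comm]

lemma inner_blockMat (T : Tensor n) (Q : Matrix (Fin n) (Fin n) ℝ) (σ : Equiv.Perm (Fin n))
    (a : Fin 3) (x y : EuclideanSpace ℝ (Fin n)) :
    inner ℝ x (Matrix.toEuclideanLin (blockMat T Q σ a) y) = blockForm T Q σ a x y := by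
  rw [inner_toEuclideanLin, dotProduct_blockMat]

lemma isSymmetric_blockMat (T : Tensor n) (Q : Matrix (Fin n) (Fin n) ℝ)
    (σ : Equiv.Perm (Fin n)) (a : Fin 3) :
    (Matrix.toEuclideanLin (blockMat T Q σ a)).IsSymmetric := fun x y => by
  rw [real_inner_comm, inner_blockMat, inner_blockMat, blockForm_comm]

/-! ### Signal and noise -/

lemma tri_spiked (τ : ℝ) (v₀ : EuclideanSpace ℝ (Fin n)) (a : Sym (Fin n) 3 → ℝ)
    (x y z : Fin n → ℝ) :
    tri (spikedTensor τ v₀ a) x y z =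
      τ * (((v₀ : Fin n → ℝ) ⬝ᵥ x) * ((v₀ : Fin n → ℝ) ⬝ᵥ y) * ((v₀ : Fin n → ℝ) ⬝ᵥ z)) +
        tri (noiseTensor a) x y z := by
  rw [← tri_rank_one, ← tri_add]
  rfl

lemma dotProduct_transpose_mulVec (Q : Matrix (Fin n) (Fin n) ℝ) (v z : Fin n → ℝ) :
    v ⬝ᵥ (Qᵀ *ᵥ z) = (Q *ᵥ v) ⬝ᵥ z := by
  rw [Matrix.dotProduct_mulVec, Matrix.vecMul_transpose]

/-- The block form of the spiked tensor: the signal, two cross terms, and the noise. -/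
lemma blockForm_spiked (τ : ℝ) (v₀ : EuclideanSpace ℝ (Fin n)) (a : Sym (Fin n) 3 → ℝ)
    (Q : Matrix (Fin n) (Fin n) ℝ) (σ : Equiv.Perm (Fin n)) (c : Fin 3) (x y : Fin n → ℝ) :
    blockForm (spikedTensor τ v₀ a) Q σ c x y =
      τ ^ 2 * ((∑ i, mask σ (c + 1) (Q *ᵥ v₀) i ^ 2) * (∑ i, mask σ (c + 2) (Q *ᵥ v₀) i ^ 2)) *
        ((mask σ c (Q *ᵥ v₀) ⬝ᵥ x) * (mask σ c (Q *ᵥ v₀) ⬝ᵥ y)) +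
      τ * (mask σ c (Q *ᵥ v₀) ⬝ᵥ x) * tri (noiseTensor a) (Qᵀ *ᵥ mask σ (c + 1) (Q *ᵥ v₀))
        (Qᵀ *ᵥ mask σ (c + 2) (Q *ᵥ v₀)) (Qᵀ *ᵥ mask σ c y) +
      τ * (mask σ c (Q *ᵥ v₀) ⬝ᵥ y) * tri (noiseTensor a) (Qᵀ *ᵥ mask σ (c + 1) (Q *ᵥ v₀))
        (Qᵀ *ᵥ mask σ (c + 2) (Q *ᵥ v₀)) (Qᵀ *ᵥ mask σ c x) +
      blockForm (noiseTensor a) Q σ c x y := by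
  set u : Fin n → ℝ := Q *ᵥ v₀ with hu
  have hm : ∀ z, mask σ c u ⬝ᵥ z = u ⬝ᵥ mask σ c z := fun z =>
    Finset.sum_congr rfl fun i _ => by simp only [mask]; ring
  have hq : ∀ i, (v₀ : Fin n → ℝ) ⬝ᵥ Q i = u i := fun i => dotProduct_comm _ _
  have ht : ∀ i j z, tri (spikedTensor τ v₀ a) (Q i) (Q j) (Qᵀ *ᵥ z) =
      τ * (u i * u j * (u ⬝ᵥ z)) + tri (noiseTensor a) (Q i) (Q j) (Qᵀ *ᵥ z) := fun i j z => by
    rw [tri_spiked, hq, hq, dotProduct_transpose_mulVec]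
  -- The cross term, a sum over `Y × Z` weighted by `u i * u j`, collapses to one value of the
  -- trilinear form of the noise at the projections of `u`. The bound `O(√n)` therefore applies to
  -- it directly.
  have hcross : ∀ z, tri (noiseTensor a) (Qᵀ *ᵥ mask σ (c + 1) u) (Qᵀ *ᵥ mask σ (c + 2) u) z =
      ∑ i, ∑ j, mask σ (c + 1) 1 i * mask σ (c + 2) 1 j *
        (u i * u j * tri (noiseTensor a) (Q i) (Q j) z) := fun z => by
    rw [tri_transpose_mulVec_left]
    refine Finset.sum_congr rfl fun i _ => ?_
    rw [tri_transpose_mulVec_mid, Finset.mul_sum]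
    exact Finset.sum_congr rfl fun j _ => by simp only [mask, Pi.one_apply]; ring
  have hsq : (∑ i, mask σ (c + 1) u i ^ 2) * (∑ i, mask σ (c + 2) u i ^ 2) =
      ∑ i, ∑ j, mask σ (c + 1) 1 i * mask σ (c + 2) 1 j * (u i * u j) ^ 2 := by
    rw [Finset.sum_mul_sum]
    refine Finset.sum_congr rfl fun i _ => Finset.sum_congr rfl fun j _ => ?_
    simp only [mask, Pi.one_apply]
    split_ifs <;> ring
  rw [hm, hm, hcross, hcross, hsq, blockForm, blockForm, ← add_sub_assoc]
  congr 1
  simp only [ht, Finset.mul_sum, Finset.sum_mul, ← Finset.sum_add_distrib]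
  exact Finset.sum_congr rfl fun _ _ => Finset.sum_congr rfl fun _ _ => by ring

end SpikedTensor

namespace SpikedTensor

variable {n : ℕ}

/-! ### Recovery on the good event -/

/-- The direction of the signal in part `c`. -/
def partDirection (σ : Equiv.Perm (Fin n)) (c : Fin 3) (u : Fin n → ℝ) :
    EuclideanSpace ℝ (Fin n) :=
  WithLp.toLp 2 ((Real.sqrt (∑ i, mask σ c u i ^ 2))⁻¹ • mask σ c u)

lemma norm_partDirection {σ : Equiv.Perm (Fin n)} {c : Fin 3} {u : Fin n → ℝ}
    (h : 0 < ∑ i, mask σ c u i ^ 2) : ‖partDirection σ c u‖ = 1 := by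
  have h1 : ‖partDirection σ c u‖ ^ 2 = 1 := by
    rw [EuclideanSpace.real_norm_sq_eq]
    simp only [partDirection, Pi.smul_apply, smul_eq_mul, mul_pow, ← Finset.mul_sum]
    rw [inv_pow, Real.sq_sqrt h.le, inv_mul_cancel₀ h.ne']
  exact (pow_eq_one_iff_of_nonneg (norm_nonneg _) (by norm_num)).1 h1

lemma inner_partDirection {σ : Equiv.Perm (Fin n)} {c : Fin 3} {u : Fin n → ℝ}
    (x : EuclideanSpace ℝ (Fin n)) :
    inner ℝ (partDirection σ c u) x =
      (Real.sqrt (∑ i, mask σ c u i ^ 2))⁻¹ * (mask σ c u ⬝ᵥ x) := by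
  rw [inner_eq_dotProduct, partDirection, smul_dotProduct, smul_eq_mul]

lemma inner_partDirection_self {σ : Equiv.Perm (Fin n)} {c : Fin 3} {u : EuclideanSpace ℝ (Fin n)}
    (h : 0 < ∑ i, mask σ c u i ^ 2) :
    inner ℝ u (partDirection σ c u) = Real.sqrt (∑ i, mask σ c u i ^ 2) := by
  rw [real_inner_comm, inner_partDirection]
  have e : mask σ c u ⬝ᵥ (u : Fin n → ℝ) = ∑ i, mask σ c u i ^ 2 := by
    simp_rw [sq, sum_mask_mul]; rfl
  rw [e]
  have h2 := Real.sq_sqrt h.le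
  have h3 := Real.sqrt_pos.2 h
  field_simp
  linarith

lemma norm_toLp_transpose_mulVec {R : Matrix (Fin n) (Fin n) ℝ} (hR : R * Rᵀ = 1)
    (x : Fin n → ℝ) : ‖WithLp.toLp 2 (Rᵀ *ᵥ x)‖ = ‖WithLp.toLp 2 x‖ := by
  have hRt : Rᵀ * Rᵀᵀ = 1 := by rw [Matrix.transpose_transpose]; exact mul_eq_one_comm.1 hR
  rw [← sq_eq_sq₀ (norm_nonneg _) (norm_nonneg _), EuclideanSpace.real_norm_sq_eq,
    EuclideanSpace.real_norm_sq_eq]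
  exact sum_mulVec_sq hRt x

lemma norm_toLp_mask_le (σ : Equiv.Perm (Fin n)) (c : Fin 3) (x : EuclideanSpace ℝ (Fin n)) :
    ‖WithLp.toLp 2 (mask σ c x)‖ ≤ ‖x‖ := by
  rw [← sq_le_sq₀ (norm_nonneg _) (norm_nonneg _), EuclideanSpace.real_norm_sq_eq,
    EuclideanSpace.real_norm_sq_eq]
  exact sum_mask_sq_le σ c x

/-- On the good event the block matrix is a small perturbation of a rank one matrix. -/
lemma blockForm_near_rank_one {τ ε : ℝ} {v₀ : EuclideanSpace ℝ (Fin n)} {a : Sym (Fin n) 3 → ℝ}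
    {R : Matrix (Fin n) (Fin n) ℝ} {σ : Equiv.Perm (Fin n)} (hR : R * Rᵀ = 1) (hv : ‖v₀‖ = 1)
    (hε0 : 0 < ε) (hτ0 : 0 < τ) (h1 : Real.sqrt n ≤ ε * τ) (h2 : n * Real.sqrt n ≤ (ε * τ) ^ 2)
    (hε1 : ε ≤ 1)
    (G1 : ∀ x y z : EuclideanSpace ℝ (Fin n),
      |tri (noiseTensor a) x y z| ≤ 80 * Real.sqrt n * ‖x‖ * ‖y‖ * ‖z‖)
    (G2 : ∀ (c : Fin 3) (x y : EuclideanSpace ℝ (Fin n)),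
      |blockForm (noiseTensor a) R σ c x y| ≤ 2000 * (n * Real.sqrt n) * ‖x‖ * ‖y‖)
    (hm : ∀ c, 1 / 4 ≤ ∑ i, mask σ c (R *ᵥ v₀) i ^ 2) (c : Fin 3) :
    ∃ l : ℝ, 0 < l ∧ ∀ x y : EuclideanSpace ℝ (Fin n),
      |inner ℝ x (Matrix.toEuclideanLin (blockMat (spikedTensor τ v₀ a) R σ c) y) -
        l * (inner ℝ (partDirection σ c (R *ᵥ v₀)) x *
          inner ℝ (partDirection σ c (R *ᵥ v₀)) y)| ≤ 140000 * ε * l * ‖x‖ * ‖y‖ := by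
  set u : Fin n → ℝ := R *ᵥ v₀ with hu
  set m : Fin 3 → ℝ := fun c => ∑ i, mask σ c u i ^ 2 with hmdef
  have hm' : ∀ c, 1 / 4 ≤ m c := hm
  have hm0 : ∀ c, 0 < m c := fun c => lt_of_lt_of_le (by norm_num) (hm' c)
  have hRR : Rᵀᵀ = R := Matrix.transpose_transpose R
  have hRt : Rᵀ * Rᵀᵀ = 1 := by rw [hRR]; exact mul_eq_one_comm.1 hR
  have hunorm : ‖WithLp.toLp 2 u‖ = 1 := by
    have := norm_toLp_transpose_mulVec hRt (v₀ : Fin n → ℝ)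
    rw [hRR] at this
    exact this.trans hv
  have hpn : ∀ d, ‖WithLp.toLp 2 (Rᵀ *ᵥ mask σ d u)‖ ≤ 1 := fun d => by
    rw [norm_toLp_transpose_mulVec hR]
    exact (norm_toLp_mask_le σ d (WithLp.toLp 2 u)).trans hunorm.le
  have hyn : ∀ y : EuclideanSpace ℝ (Fin n), ‖WithLp.toLp 2 (Rᵀ *ᵥ mask σ c y)‖ ≤ ‖y‖ := fun y => by
    rw [norm_toLp_transpose_mulVec hR]; exact norm_toLp_mask_le σ c y
  have hsx : ∀ x : EuclideanSpace ℝ (Fin n), |mask σ c u ⬝ᵥ (x : Fin n → ℝ)| ≤ ‖x‖ := fun x => by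
    have := abs_real_inner_le_norm (WithLp.toLp 2 (mask σ c u)) x
    rw [inner_eq_dotProduct] at this
    refine this.trans ?_
    have h := (norm_toLp_mask_le σ c (WithLp.toLp 2 u)).trans hunorm.le
    exact mul_le_of_le_one_left (norm_nonneg _) h
  have hs0 : 0 ≤ Real.sqrt n := Real.sqrt_nonneg _
  have hcross : ∀ y : EuclideanSpace ℝ (Fin n),
      |tri (noiseTensor a) (Rᵀ *ᵥ mask σ (c + 1) u) (Rᵀ *ᵥ mask σ (c + 2) u)
        (Rᵀ *ᵥ mask σ c y)| ≤ 80 * Real.sqrt n * ‖y‖ := fun y => by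
    refine (G1 (WithLp.toLp 2 (Rᵀ *ᵥ mask σ (c + 1) u)) (WithLp.toLp 2 (Rᵀ *ᵥ mask σ (c + 2) u))
      (WithLp.toLp 2 (Rᵀ *ᵥ mask σ c y))).trans ?_
    have h3 := mul_le_mul (mul_le_one₀ (hpn (c + 1)) (norm_nonneg _) (hpn (c + 2))) (hyn y)
      (norm_nonneg _) zero_le_one
    have := mul_le_mul_of_nonneg_left h3 (by positivity : 0 ≤ 80 * Real.sqrt n)
    linarith
  refine ⟨τ ^ 2 * (m (c + 1) * m (c + 2)) * m c, ?_, fun x y => ?_⟩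
  · have := hm0 c; have := hm0 (c + 1); have := hm0 (c + 2); positivity
  rw [inner_blockMat, blockForm_spiked, inner_partDirection, inner_partDirection]
  have hsq : (Real.sqrt (m c))⁻¹ * (Real.sqrt (m c))⁻¹ = (m c)⁻¹ := by
    rw [← mul_inv, Real.mul_self_sqrt (hm0 c).le]
  set sx := mask σ c u ⬝ᵥ (x : Fin n → ℝ)
  set sy := mask σ c u ⬝ᵥ (y : Fin n → ℝ)
  set tx := tri (noiseTensor a) (Rᵀ *ᵥ mask σ (c + 1) u) (Rᵀ *ᵥ mask σ (c + 2) u)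
    (Rᵀ *ᵥ mask σ c x)
  set ty := tri (noiseTensor a) (Rᵀ *ᵥ mask σ (c + 1) u) (Rᵀ *ᵥ mask σ (c + 2) u)
    (Rᵀ *ᵥ mask σ c y)
  set b := blockForm (noiseTensor a) R σ c x y
  have e : τ ^ 2 * (m (c + 1) * m (c + 2)) * (sx * sy) + τ * sx * ty + τ * sy * tx + b -
      τ ^ 2 * (m (c + 1) * m (c + 2)) * m c *
        ((Real.sqrt (m c))⁻¹ * sx * ((Real.sqrt (m c))⁻¹ * sy)) =
      τ * sx * ty + τ * sy * tx + b := by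
    have : m c * ((Real.sqrt (m c))⁻¹ * sx * ((Real.sqrt (m c))⁻¹ * sy)) = sx * sy := by
      have h3 : (Real.sqrt (m c))⁻¹ * sx * ((Real.sqrt (m c))⁻¹ * sy) = (m c)⁻¹ * (sx * sy) := by
        rw [← hsq]; ring
      rw [h3, ← mul_assoc, mul_inv_cancel₀ (hm0 c).ne', one_mul]
    linear_combination (-(τ ^ 2 * (m (c + 1) * m (c + 2)))) * this
  change |τ ^ 2 * (m (c + 1) * m (c + 2)) * (sx * sy) + τ * sx * ty + τ * sy * tx + b -
      τ ^ 2 * (m (c + 1) * m (c + 2)) * m c *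
        ((Real.sqrt (m c))⁻¹ * sx * ((Real.sqrt (m c))⁻¹ * sy))| ≤ _
  rw [e]
  have hx0 := norm_nonneg x
  have hy0 := norm_nonneg y
  have b1 : |τ * sx * ty| ≤ τ * (80 * Real.sqrt n) * (‖x‖ * ‖y‖) := by
    rw [abs_mul, abs_mul, abs_of_pos hτ0]
    have := mul_le_mul (hsx x) (hcross y) (abs_nonneg _) hx0
    have := mul_le_mul_of_nonneg_left this hτ0.le
    linarith
  have b2 : |τ * sy * tx| ≤ τ * (80 * Real.sqrt n) * (‖x‖ * ‖y‖) := by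
    rw [abs_mul, abs_mul, abs_of_pos hτ0]
    have := mul_le_mul (hsx y) (hcross x) (abs_nonneg _) hy0
    have := mul_le_mul_of_nonneg_left this hτ0.le
    linarith
  have b3 := G2 c x y
  have b4 : |τ * sx * ty + τ * sy * tx + b| ≤
      (160 * (τ * Real.sqrt n) + 2000 * (n * Real.sqrt n)) * (‖x‖ * ‖y‖) := by
    refine (abs_add_le _ _).trans ((add_le_add (abs_add_le _ _) le_rfl).trans ?_)
    linarith
  refine b4.trans ?_
  -- Here the signal strength enters: `√n ≤ ε τ` controls the cross terms, and `n^{3/2} ≤ (ε τ)² ≤ ε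
  -- τ²` the pure noise.
  have c1 : 160 * (τ * Real.sqrt n) + 2000 * (n * Real.sqrt n) ≤ 2160 * (ε * τ ^ 2) := by
    have d1 : τ * Real.sqrt n ≤ ε * τ ^ 2 := by
      have := mul_le_mul_of_nonneg_left h1 hτ0.le
      linarith
    have d2 : (ε * τ) ^ 2 ≤ ε * τ ^ 2 := by
      have : ε ^ 2 ≤ ε := by nlinarith
      have := mul_le_mul_of_nonneg_right this (sq_nonneg τ)
      linarith
    linarith
  -- Each part carries mass at least `1 / 4`, so `l ≥ τ² / 64`, and `2160 * 64 ≤ 140000`.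
  have c2 : 1 / 64 ≤ m (c + 1) * m (c + 2) * m c := by
    have d1 := mul_le_mul (hm' (c + 1)) (hm' (c + 2)) (by norm_num) (hm0 _).le
    have d2 := mul_le_mul d1 (hm' c) (by norm_num) (mul_pos (hm0 _) (hm0 _)).le
    linarith
  have c3 : 2160 * (ε * τ ^ 2) ≤ 140000 * ε * (τ ^ 2 * (m (c + 1) * m (c + 2)) * m c) := by
    have hp : 0 ≤ ε * τ ^ 2 := by positivity
    have := mul_le_mul_of_nonneg_left c2 hp
    linarith
  have := mul_le_mul_of_nonneg_right (c1.trans c3) (mul_nonneg hx0 hy0)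
  linarith

lemma norm_normalized_le (x : EuclideanSpace ℝ (Fin n)) : ‖normalized x‖ ≤ 1 := by
  rw [normalized, norm_smul, norm_inv, norm_norm]
  exact inv_mul_le_one

lemma norm_powerIterate_le (M : Matrix (Fin n) (Fin n) ℝ) (g : Fin n → ℝ) (k : ℕ) :
    ‖powerIterate M g k‖ ≤ 1 := by
  cases k <;> exact norm_normalized_le _

/-- The sign rule picks the direction of the signal. -/
lemma norm_fixSign_sub_le {τ θ : ℝ} {v₀ : EuclideanSpace ℝ (Fin n)} {a : Sym (Fin n) 3 → ℝ}
    {R : Matrix (Fin n) (Fin n) ℝ} (hR : R * Rᵀ = 1) (hv : ‖v₀‖ = 1)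
    (hτ : 6000 * Real.sqrt n < τ)
    (G1 : ∀ x y z : EuclideanSpace ℝ (Fin n),
      |tri (noiseTensor a) x y z| ≤ 80 * Real.sqrt n * ‖x‖ * ‖y‖ * ‖z‖)
    {q x : EuclideanSpace ℝ (Fin n)} (hx : ‖x‖ ≤ 1) (hθ : θ ≤ 1 / 4) {s : ℝ}
    (hs : s = 1 ∨ s = -1) (hxq : ‖x - s • q‖ ≤ θ)
    (huq : 1 / 2 ≤ inner ℝ (WithLp.toLp 2 (R *ᵥ v₀) : EuclideanSpace ℝ (Fin n)) q) :
    ‖fixSign (rotMat (spikedTensor τ v₀ a) R) x - q‖ ≤ θ := by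
  have hRR : Rᵀᵀ = R := Matrix.transpose_transpose R
  have hRt : Rᵀ * Rᵀᵀ = 1 := by rw [hRR]; exact mul_eq_one_comm.1 hR
  have hunorm : ‖(WithLp.toLp 2 (R *ᵥ v₀) : EuclideanSpace ℝ (Fin n))‖ = 1 := by
    have := norm_toLp_transpose_mulVec hRt (v₀ : Fin n → ℝ)
    rw [hRR] at this
    exact this.trans hv
  set u : EuclideanSpace ℝ (Fin n) := WithLp.toLp 2 (R *ᵥ v₀) with hu
  have hτ0 : 0 < τ := lt_of_le_of_lt (by positivity) hτ
  have hcub : cubicForm (rotMat (spikedTensor τ v₀ a) R) x =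
      τ * (inner ℝ u x) ^ 3 + tri (noiseTensor a) (Rᵀ *ᵥ x) (Rᵀ *ᵥ x) (Rᵀ *ᵥ x) := by
    rw [cubicForm_rotMat, tri_spiked, dotProduct_transpose_mulVec, inner_eq_dotProduct]
    ring
  have hnoise : |tri (noiseTensor a) (Rᵀ *ᵥ x) (Rᵀ *ᵥ x) (Rᵀ *ᵥ x)| ≤ 80 * Real.sqrt n := by
    have hy : ‖WithLp.toLp 2 (Rᵀ *ᵥ (x : Fin n → ℝ))‖ ≤ 1 := by
      rw [norm_toLp_transpose_mulVec hR]; exact hx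
    refine (G1 (WithLp.toLp 2 (Rᵀ *ᵥ x)) (WithLp.toLp 2 (Rᵀ *ᵥ x))
      (WithLp.toLp 2 (Rᵀ *ᵥ x))).trans ?_
    have h3 := mul_le_one₀ (mul_le_one₀ hy (norm_nonneg _) hy) (norm_nonneg _) hy
    have := mul_le_mul_of_nonneg_left h3 (by positivity : 0 ≤ 80 * Real.sqrt n)
    linarith
  have hux : |inner ℝ u x - s * inner ℝ u q| ≤ 1 / 4 := by
    have := abs_real_inner_le_norm u (x - s • q)
    rw [inner_sub_right, inner_smul_right, hunorm, one_mul] at this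
    exact this.trans (hxq.trans hθ)
  have hn := abs_le.1 hnoise
  have hux' := abs_le.1 hux
  -- In both cases `|⟨u, x⟩| ≥ 1 / 4`, so the signal part of the cubic form has size at least `τ /
  -- 64 > 80 √n` and beats the noise.
  rcases hs with rfl | rfl
  · have h1 : 1 / 4 ≤ inner ℝ u x := by linarith [hux'.1]
    have h2 : (1 / 4 : ℝ) ^ 3 ≤ (inner ℝ u x) ^ 3 := pow_le_pow_left₀ (by norm_num) h1 3
    have h3 := mul_le_mul_of_nonneg_left h2 hτ0.le
    have h4 : 0 ≤ cubicForm (rotMat (spikedTensor τ v₀ a) R) x := by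
      rw [hcub]; norm_num at h3; linarith [hn.1]
    rw [fixSign, if_pos h4]
    simpa using hxq
  · have h1 : 1 / 4 ≤ -inner ℝ u x := by linarith [hux'.2]
    have h2 : (1 / 4 : ℝ) ^ 3 ≤ (-inner ℝ u x) ^ 3 := pow_le_pow_left₀ (by norm_num) h1 3
    have h3 := mul_le_mul_of_nonneg_left h2 hτ0.le
    have h4 : ¬ 0 ≤ cubicForm (rotMat (spikedTensor τ v₀ a) R) x := by
      rw [hcub, not_le]
      have e : τ * (-inner ℝ u x) ^ 3 = -(τ * (inner ℝ u x) ^ 3) := by ring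
      rw [e] at h3
      norm_num at h3
      linarith [hn.2, Real.sqrt_nonneg n]
    rw [fixSign, if_neg h4]
    have e : -x - q = -(x - (-1 : ℝ) • q) := by simp; abel
    rw [e, norm_neg]
    exact hxq

/-- A second-order lower bound is needed: the masses of the three parts add up to one, so the linear
terms cancel in the sum over the parts. A mass error of `n^{-1/4}` then costs only `n^{-1/2}`. -/
lemma one_add_half_sub_le_sqrt {x : ℝ} (hx : -1 ≤ x) : 1 + x / 2 - x ^ 2 / 2 ≤ Real.sqrt (1 + x) := by
  rcases le_total 0 (1 + x / 2 - x ^ 2 / 2) with h | h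
  · apply Real.le_sqrt_of_sq_le
    have e : (1 + x / 2 - x ^ 2 / 2) = (1 + x) * (1 - x / 2) := by ring
    rw [e, mul_pow]
    have h1 : (1 + x) * (1 - x / 2) ^ 2 ≤ 1 := by
      have h2 : 0 ≤ 1 - x / 2 := by
        by_contra hcon
        push Not at hcon
        have : 0 < 1 + x := by linarith
        nlinarith
      nlinarith [mul_nonneg (sq_nonneg x) (by linarith : (0 : ℝ) ≤ 3 - x)]
    have := mul_le_mul_of_nonneg_left h1 (by linarith : 0 ≤ 1 + x)
    linarith
  · exact h.trans (Real.sqrt_nonneg _)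

/-- Three vectors close to the directions of the signal in the three parts add up to a vector
that is well correlated with the signal. -/
lemma inner_normalized_sum_ge {σ : Equiv.Perm (Fin n)} {u S : EuclideanSpace ℝ (Fin n)}
    {δ θ : ℝ} (hu : ‖u‖ = 1) (hδ : δ ≤ 1 / 12) (hθ0 : 0 ≤ θ) (hθ : θ ≤ 1 / 24)
    (hm : ∀ c, |∑ i, mask σ c u i ^ 2 - 1 / 3| ≤ δ) {v : Fin 3 → EuclideanSpace ℝ (Fin n)}
    (hv : ∀ c, ‖v c - partDirection σ c u‖ ≤ θ) (hS : S = ∑ c, v c) :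
    1 - (14 * δ ^ 2 + 6 * θ) ≤ ‖S‖⁻¹ * inner ℝ S u := by
  have hm' := fun c => abs_le.1 (hm c)
  have hm0 : ∀ c, 0 < ∑ i, mask σ c u i ^ 2 := fun c => by linarith [(hm' c).1]
  set z : EuclideanSpace ℝ (Fin n) := ∑ c, partDirection σ c u with hz
  have hSz : ‖S - z‖ ≤ 3 * θ := by
    rw [hS, hz, ← Finset.sum_sub_distrib]
    refine (norm_sum_le _ _).trans ((Finset.sum_le_sum fun c _ => hv c).trans (le_of_eq ?_))
    simp
  have hortho : ∀ c d, inner ℝ (partDirection σ c u) (partDirection σ d u) =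
      if c = d then (1 : ℝ) else 0 := by
    intro c d
    split_ifs with h
    · rw [h, real_inner_self_eq_norm_sq, norm_partDirection (hm0 d)]; norm_num
    · rw [inner_partDirection, partDirection, dotProduct_smul]
      have : mask σ c (u : Fin n → ℝ) ⬝ᵥ mask σ d u = 0 := by
        refine Finset.sum_eq_zero fun i _ => ?_
        by_cases hi : i ∈ partSet σ d
        · rw [mask_eq_zero (Ne.symm h) _ hi, zero_mul]
        · have : mask σ d (u : Fin n → ℝ) i = 0 := by
            have h3 : ¬ (σ i : ℕ) % 3 = (d : ℕ) := fun e => hi (by simp [partSet, e])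
            simp [mask, h3]
          rw [this, mul_zero]
      rw [this, smul_zero, mul_zero]
  have hznorm : ‖z‖ = Real.sqrt 3 := by
    have : ‖z‖ ^ 2 = 3 := by
      rw [← real_inner_self_eq_norm_sq, hz]
      simp_rw [sum_inner, inner_sum, hortho]
      simp
    rw [← this, Real.sqrt_sq (norm_nonneg _)]
  have h3 : Real.sqrt 3 * Real.sqrt 3 = 3 := Real.mul_self_sqrt (by norm_num)
  have h3p : 1 ≤ Real.sqrt 3 := Real.one_le_sqrt.2 (by norm_num)
  have hsum : ∑ c, ∑ i, mask σ c u i ^ 2 = 1 := by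
    rw [sum_sum_mask_sq, ← EuclideanSpace.real_norm_sq_eq, hu]; norm_num
  have hδ2 : ∀ c, (∑ i, mask σ c u i ^ 2 - 1 / 3) ^ 2 ≤ δ ^ 2 := fun c => by
    rw [← sq_abs]; exact pow_le_pow_left₀ (abs_nonneg _) (hm c) 2
  -- The inner product is the sum of the square roots of the masses. The square root bound is used
  -- at `3 m - 1`; each part loses `9 δ² / 2`, and the linear terms add up to zero.
  have huz : 3 - 27 / 2 * δ ^ 2 ≤ Real.sqrt 3 * inner ℝ u z := by
    rw [hz, inner_sum, Finset.mul_sum]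
    have h4 : ∀ c : Fin 3, 1 + 3 * (∑ i, mask σ c u i ^ 2 - 1 / 3) / 2 - 9 * δ ^ 2 / 2 ≤
        Real.sqrt 3 * inner ℝ u (partDirection σ c u) := fun c => by
      rw [inner_partDirection_self (hm0 c), ← Real.sqrt_mul (by norm_num)]
      have h5 := one_add_half_sub_le_sqrt (x := 3 * (∑ i, mask σ c u i ^ 2 - 1 / 3))
        (by linarith [(hm' c).1])
      have e : 1 + 3 * (∑ i, mask σ c u i ^ 2 - 1 / 3) = 3 * ∑ i, mask σ c u i ^ 2 := by ring
      rw [e] at h5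
      refine le_trans ?_ h5
      nlinarith [hδ2 c]
    refine le_trans (le_of_eq ?_) (Finset.sum_le_sum fun c _ => h4 c)
    rw [Fin.sum_univ_three] at hsum ⊢
    linarith
  have huS : inner ℝ u z - 3 * θ ≤ inner ℝ S u := by
    have := abs_le.1 (abs_real_inner_le_norm u (S - z))
    rw [inner_sub_right, hu, one_mul] at this
    have hc := real_inner_comm S u
    linarith [this.1]
  have hSn : ‖S‖ ≤ Real.sqrt 3 + 3 * θ := by
    rw [← hznorm]
    have := norm_add_le z (S - z)
    rw [add_sub_cancel] at this
    linarith
  have hS0 : 0 < ‖S‖ := by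
    have := norm_sub_norm_le z (z - S)
    rw [sub_sub_cancel, hznorm, norm_sub_rev] at this
    linarith
  rw [← div_eq_inv_mul, le_div_iff₀ hS0]
  have hK : 0 ≤ 14 * δ ^ 2 + 6 * θ := by positivity
  have huz2 : Real.sqrt 3 - 27 / 2 * δ ^ 2 ≤ inner ℝ u z := by
    have h6 : Real.sqrt 3 * (Real.sqrt 3 - 27 / 2 * δ ^ 2) ≤ Real.sqrt 3 * inner ℝ u z := by
      have : 1 * (27 / 2 * δ ^ 2) ≤ Real.sqrt 3 * (27 / 2 * δ ^ 2) :=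
        mul_le_mul_of_nonneg_right h3p (by positivity)
      nlinarith
    exact le_of_mul_le_mul_left h6 (by linarith)
  rcases le_total (14 * δ ^ 2 + 6 * θ) 1 with hK1 | hK1
  · have h7 := mul_le_mul_of_nonneg_left hSn (by linarith : 0 ≤ 1 - (14 * δ ^ 2 + 6 * θ))
    have h8 : 1 * (14 * δ ^ 2 + 6 * θ) ≤ Real.sqrt 3 * (14 * δ ^ 2 + 6 * θ) :=
      mul_le_mul_of_nonneg_right h3p hK
    have h9 : 0 ≤ (14 * δ ^ 2 + 6 * θ) * θ := mul_nonneg hK hθ0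
    nlinarith
  · have h7 : (1 - (14 * δ ^ 2 + 6 * θ)) * ‖S‖ ≤ 0 :=
      mul_nonpos_of_nonpos_of_nonneg (by linarith) hS0.le
    have h8 : δ ^ 2 ≤ 1 / 144 := by
      have : 0 ≤ δ := (abs_nonneg _).trans (hm 0)
      nlinarith
    linarith
end SpikedTensor

/-! ### The conditions on noise and coins that force success -/

namespace SpikedTensor

variable {n : ℕ}

/-- The event on which the algorithm is shown to succeed. -/
structure IsGood (τ : ℝ) (v₀ : EuclideanSpace ℝ (Fin n)) (a : Sym (Fin n) 3 → ℝ)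
    (ρ : Coins n) : Prop where
  tri_le : ∀ x y z : EuclideanSpace ℝ (Fin n),
    |tri (noiseTensor a) x y z| ≤ 80 * Real.sqrt n * ‖x‖ * ‖y‖ * ‖z‖
  blockForm_le : ∀ (c : Fin 3) (x y : EuclideanSpace ℝ (Fin n)),
    |blockForm (noiseTensor a) ρ.1.1 ρ.2.1 c x y| ≤ 2000 * (n * Real.sqrt n) * ‖x‖ * ‖y‖
  mask_near : ∀ c, |∑ i, mask ρ.2.1 c (ρ.1.1 *ᵥ v₀) i ^ 2 - 1 / 3| ≤ (Real.sqrt (Real.sqrt n))⁻¹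
  start_ge : ∀ c, ∃ w, IsTopSingularVector (blockMatrix (spikedTensor τ v₀ a) ρ.1 ρ.2.1 c) w ∧
    ((n : ℝ) ^ 11)⁻¹ ≤ |inner ℝ w (WithLp.toLp 2 (ρ.2.2 c))|
  start_le : ∀ c, ‖WithLp.toLp 2 (ρ.2.2 c)‖ ≤ (n : ℝ) ^ 6

lemma SO_mul_transpose (R : SO n) : R.1 * R.1ᵀ = 1 :=
  (Matrix.mem_orthogonalGroup_iff (Fin n) ℝ).1 R.2.1

lemma sign_mul {s t : ℝ} (hs : s = 1 ∨ s = -1) (ht : t = 1 ∨ t = -1) : s * t = 1 ∨ s * t = -1 := by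
  rcases hs with rfl | rfl <;> rcases ht with rfl | rfl <;> simp

lemma norm_sign_smul_sub {E : Type*} [NormedAddCommGroup E] [NormedSpace ℝ E] {s t : ℝ}
    (hs : s = 1 ∨ s = -1) (x q : E) : ‖s • x - (s * t) • q‖ = ‖x - t • q‖ := by
  rw [mul_smul, ← smul_sub, norm_smul]
  rcases hs with rfl | rfl <;> simp

lemma inner_recover (T : Tensor n) (k : ℕ) (ρ : Coins n) (v₀ : EuclideanSpace ℝ (Fin n))
    {S : EuclideanSpace ℝ (Fin n)}
    (hS : S = ∑ c, fixSign (rotMat T ρ.1.1) (iterate T ρ k c)) :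
    inner ℝ (recover T k ρ) v₀ = ‖S‖⁻¹ * inner ℝ S (WithLp.toLp 2 (ρ.1.1 *ᵥ v₀)) := by
  have e : recover T k ρ = normalized (WithLp.toLp 2 (ρ.1.1ᵀ *ᵥ S)) := by rw [hS]; rfl
  rw [e, normalized, norm_toLp_transpose_mulVec (SO_mul_transpose ρ.1), real_inner_smul_left]
  congr 1
  rw [real_inner_comm, inner_eq_dotProduct, dotProduct_transpose_mulVec, real_inner_comm,
    inner_eq_dotProduct]

/-- On the good event the algorithm succeeds. -/
theorem IsGood.recovery {ε τ : ℝ} {v₀ : EuclideanSpace ℝ (Fin n)} {a : Sym (Fin n) 3 → ℝ}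
    {ρ : Coins n} (h : IsGood τ v₀ a ρ) (hn : 12 ^ 4 ≤ n) (hε : Real.log n / Real.sqrt n ≤ ε)
    (hε1 : ε ≤ 1 / 10 ^ 8) (hτ : (n : ℝ) ^ (3 / 4 : ℝ) / ε ≤ τ) (hv : ‖v₀‖ = 1) {k : ℕ}
    (hk : 18 * Real.log n ≤ k) :
    (∀ (c : Fin 3) (w : EuclideanSpace ℝ (Fin n)),
      IsTopSingularVector (blockMatrix (spikedTensor τ v₀ a) ρ.1 ρ.2.1 c) w →
      ∃ s : ℝ, (s = 1 ∨ s = -1) ∧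
        ‖iterate (spikedTensor τ v₀ a) ρ k c - s • w‖ ≤ 3000000 * ε) ∧
    1 - 3000000 * ε ≤ inner ℝ (recover (spikedTensor τ v₀ a) k ρ) v₀ := by
  have hnR : (12 : ℝ) ^ 4 ≤ n := by exact_mod_cast hn
  have hn0 : (0 : ℝ) < n := lt_of_lt_of_le (by norm_num) hnR
  have hss : Real.sqrt n * Real.sqrt n = n := Real.mul_self_sqrt hn0.le
  have hs144 : 144 ≤ Real.sqrt n := Real.le_sqrt_of_sq_le (by linarith)
  have hss12 : 12 ≤ Real.sqrt (Real.sqrt n) := Real.le_sqrt_of_sq_le (by linarith)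
  have hlog : 1 ≤ Real.log n := by
    rw [Real.le_log_iff_exp_le hn0]
    linarith [Real.exp_one_lt_d9]
  have hsinv : (Real.sqrt n)⁻¹ ≤ ε := by
    refine le_trans ?_ hε
    rw [inv_eq_one_div]
    exact div_le_div_of_nonneg_right hlog (by linarith)
  have hε0 : 0 < ε := lt_of_lt_of_le (by positivity) hsinv
  have hninv : (n : ℝ)⁻¹ ≤ ε := by
    refine le_trans (inv_anti₀ (by linarith) ?_) hsinv
    nlinarith
  have hετ : (n : ℝ) ^ (3 / 4 : ℝ) ≤ ε * τ := by
    rw [div_le_iff₀ hε0] at hτ; linarith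
  have hpow : ((n : ℝ) ^ (3 / 4 : ℝ)) ^ 2 = n * Real.sqrt n := by
    rw [← Real.rpow_natCast, ← Real.rpow_mul hn0.le, Real.sqrt_eq_rpow]
    nth_rewrite 2 [← Real.rpow_one (n : ℝ)]
    rw [← Real.rpow_add hn0]; norm_num
  have hp0 : (0 : ℝ) < (n : ℝ) ^ (3 / 4 : ℝ) := Real.rpow_pos_of_pos hn0 _
  have h2 : n * Real.sqrt n ≤ (ε * τ) ^ 2 := by
    rw [← hpow]; exact pow_le_pow_left₀ hp0.le hετ 2
  have h1 : Real.sqrt n ≤ ε * τ := by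
    refine le_trans ?_ hετ
    rw [Real.sqrt_eq_rpow]
    exact Real.rpow_le_rpow_of_exponent_le (by linarith) (by norm_num)
  have hτ0 : 0 < τ := by
    by_contra hcon
    push Not at hcon
    have := mul_nonpos_of_nonneg_of_nonpos hε0.le hcon
    linarith
  -- From `√n ≤ ε τ` and `ε ≤ 10^{-8}`, with room to spare for the sign rule.
  have hτ1 : 6000 * Real.sqrt n < τ := by
    have := mul_le_mul_of_nonneg_right hε1 hτ0.le
    nlinarith
  set R := ρ.1.1
  set σ := ρ.2.1
  have hR : R * Rᵀ = 1 := SO_mul_transpose ρ.1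
  have hδ : (Real.sqrt (Real.sqrt n))⁻¹ ≤ 1 / 12 := by
    rw [inv_eq_one_div]; exact one_div_le_one_div_of_le (by norm_num) hss12
  -- The squared mass error equals `n^{-1/2}`, which is at most `ε` because `log n ≥ 1`.
  have hδ2 : (Real.sqrt (Real.sqrt n))⁻¹ ^ 2 ≤ ε := by
    rw [inv_pow, Real.sq_sqrt (Real.sqrt_nonneg _)]; exact hsinv
  have hm : ∀ c, 1 / 4 ≤ ∑ i, mask σ c (R *ᵥ v₀) i ^ 2 := fun c => by
    have := (abs_le.1 (h.mask_near c)).1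
    linarith
  have hq : ∀ c, ‖partDirection σ c (R *ᵥ v₀)‖ = 1 := fun c =>
    norm_partDirection (by linarith [hm c])
  have hη : 140000 * ε ≤ 1 / 20 := by linarith
  have key : ∀ c (w : EuclideanSpace ℝ (Fin n)),
      IsTopSingularVector (blockMatrix (spikedTensor τ v₀ a) ρ.1 σ c) w →
      (∃ s : ℝ, (s = 1 ∨ s = -1) ∧ ‖w - s • partDirection σ c (R *ᵥ v₀)‖ ≤ 3 * (140000 * ε)) ∧
      0 < ‖Matrix.toEuclideanLin (blockMatrix (spikedTensor τ v₀ a) ρ.1 σ c) w‖ ∧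
      ∀ x, inner ℝ w x = 0 →
        ‖Matrix.toEuclideanLin (blockMatrix (spikedTensor τ v₀ a) ρ.1 σ c) x‖ ≤
          ‖Matrix.toEuclideanLin (blockMatrix (spikedTensor τ v₀ a) ρ.1 σ c) w‖ / 4 * ‖x‖ := by
    intro c w hw
    obtain ⟨l, hl, hT⟩ := blockForm_near_rank_one hR hv hε0 hτ0 h1 h2 (by linarith) h.tri_le
      h.blockForm_le hm c
    exact top_singular_near (isSymmetric_blockMat _ R σ c) (hq c) hl (by linarith) hη hT hw.1 hw.2
  -- The exponent is `17 = 6 + 11`: norm of the starting vector over its overlap with the top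
  -- singular vector. As `1 / 4 ≤ exp (-1)`, `18 log n` steps gain `n^{-18}`, and `1 / n ≤ ε`.
  have hdecay : (1 / 4 : ℝ) ^ k * (n : ℝ) ^ 17 ≤ ε := by
    have e1 : (1 / 4 : ℝ) ^ k ≤ ((n : ℝ) ^ 18)⁻¹ := by
      have e2 : (1 / 4 : ℝ) ≤ Real.exp (-1) := by
        rw [Real.exp_neg, ← inv_eq_one_div]
        exact inv_anti₀ (Real.exp_pos _) (by linarith [Real.exp_one_lt_d9])
      refine (pow_le_exp (by norm_num) e2 k).trans ?_
      rw [← Real.exp_log (by positivity : (0 : ℝ) < ((n : ℝ) ^ 18)⁻¹), Real.exp_le_exp,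
        Real.log_inv, Real.log_pow]
      push_cast
      linarith
    have e3 := mul_le_mul_of_nonneg_right e1 (by positivity : (0 : ℝ) ≤ (n : ℝ) ^ 17)
    have e4 : ((n : ℝ) ^ 18)⁻¹ * (n : ℝ) ^ 17 = (n : ℝ)⁻¹ := by field_simp
    linarith
  -- The overlap of the start is known for one top singular vector only; comparison with the signal
  -- direction makes the result independent of this choice. The constant is `3 * 140000 + 2`.
  have near : ∀ c, ∃ s : ℝ, (s = 1 ∨ s = -1) ∧
      ‖iterate (spikedTensor τ v₀ a) ρ k c - s • partDirection σ c (R *ᵥ v₀)‖ ≤ 420002 * ε := by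
    intro c
    obtain ⟨w, hw, hwg⟩ := h.start_ge c
    obtain ⟨⟨t, ht, hwq⟩, hpos, hgap⟩ := key c w hw
    have hwg0 : 0 < |inner ℝ w (WithLp.toLp 2 (ρ.2.2 c))| := lt_of_lt_of_le (by positivity) hwg
    obtain ⟨s, hs, hsw⟩ := exists_sign_power_near (isSymmetric_blockMat _ R σ c) hw.1 hw.2 hpos
      hgap (abs_pos.1 hwg0) k
    refine ⟨s * t, sign_mul hs ht, ?_⟩
    have d1 : ‖iterate (spikedTensor τ v₀ a) ρ k c - s • w‖ ≤ 2 * ε := by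
      rw [iterate, powerIterate_eq]
      refine hsw.trans ?_
      have d2 : ‖WithLp.toLp 2 (ρ.2.2 c)‖ / |inner ℝ w (WithLp.toLp 2 (ρ.2.2 c))| ≤ (n : ℝ) ^ 17 := by
        rw [div_le_iff₀ hwg0]
        have d3 := mul_le_mul_of_nonneg_left hwg (by positivity : (0 : ℝ) ≤ (n : ℝ) ^ 17)
        have d4 : (n : ℝ) ^ 17 * ((n : ℝ) ^ 11)⁻¹ = (n : ℝ) ^ 6 := by field_simp
        linarith [h.start_le c]
      have d5 := mul_le_mul_of_nonneg_left d2 (by positivity : (0 : ℝ) ≤ (1 / 4 : ℝ) ^ k)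
      linarith
    have d6 := norm_sub_le_norm_sub_add_norm_sub (iterate (spikedTensor τ v₀ a) ρ k c) (s • w)
      ((s * t) • partDirection σ c (R *ᵥ v₀))
    rw [norm_sign_smul_sub hs] at d6
    linarith
  refine ⟨fun c w hw => ?_, ?_⟩
  · obtain ⟨s, hs, hx⟩ := near c
    obtain ⟨⟨t, ht, hwq⟩, -, -⟩ := key c w hw
    refine ⟨s * t, sign_mul hs ht, ?_⟩
    have e1 : ‖(s * t) • w - s • partDirection σ c (R *ᵥ v₀)‖ ≤ 3 * (140000 * ε) := by
      have : s = s * t * t := by rcases ht with rfl | rfl <;> ring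
      nth_rewrite 2 [this]
      rwa [norm_sign_smul_sub (sign_mul hs ht)]
    have e2 := norm_sub_le_norm_sub_add_norm_sub (iterate (spikedTensor τ v₀ a) ρ k c)
      (s • partDirection σ c (R *ᵥ v₀)) ((s * t) • w)
    rw [norm_sub_rev (s • _)] at e2
    linarith
  · rw [inner_recover _ k ρ v₀ rfl]
    have hunorm : ‖(WithLp.toLp 2 (R *ᵥ v₀) : EuclideanSpace ℝ (Fin n))‖ = 1 := by
      have hRR : Rᵀᵀ = R := Matrix.transpose_transpose R
      have := norm_toLp_transpose_mulVec (R := Rᵀ)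
        (by rw [hRR]; exact mul_eq_one_comm.1 hR) (v₀ : Fin n → ℝ)
      rw [hRR] at this
      exact this.trans hv
    -- The loss is `14 δ² + 6 θ ≤ (14 + 6 * 420002) ε`.
    refine le_trans ?_ (inner_normalized_sum_ge (σ := σ) (θ := 420002 * ε) hunorm hδ
      (by linarith) (by linarith) h.mask_near (fun c => ?_) rfl)
    · linarith
    · obtain ⟨s, hs, hx⟩ := near c
      refine norm_fixSign_sub_le hR hv hτ1 h.tri_le (norm_powerIterate_le _ _ _) (by linarith) hs
        hx ?_
      have := inner_partDirection_self (σ := σ) (c := c) (u := WithLp.toLp 2 (R *ᵥ v₀))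
        (by have := hm c; exact lt_of_lt_of_le (by norm_num) this)
      refine le_trans ?_ this.ge
      exact Real.le_sqrt_of_sq_le (by have := hm c; norm_num; linarith)

end SpikedTensor

/-! ### Gaussian vectors and rotations -/

lemma gaussianPi_map_mulVec {ι : Type*} [Fintype ι] [DecidableEq ι] {R : Matrix ι ι ℝ}
    (hR : R * Rᵀ = 1) : (gaussianPi ι).map (fun x => R *ᵥ x) = gaussianPi ι := by
  have hRt : Rᵀ * R = 1 := mul_eq_one_comm.1 hR
  let f : EuclideanSpace ℝ ι →ₗᵢ[ℝ] EuclideanSpace ℝ ι :=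
    ⟨Matrix.toEuclideanLin R, fun x => by
      rw [← sq_eq_sq₀ (norm_nonneg _) (norm_nonneg _), ← real_inner_self_eq_norm_sq,
        ← real_inner_self_eq_norm_sq]
      have h1 : ∀ y z : EuclideanSpace ℝ ι, inner ℝ y z = (y : ι → ℝ) ⬝ᵥ (z : ι → ℝ) := fun y z => by
        simp [PiLp.inner_apply, dotProduct, mul_comm]
      rw [h1, h1]
      change (R *ᵥ (x : ι → ℝ)) ⬝ᵥ (R *ᵥ (x : ι → ℝ)) = _
      rw [Matrix.dotProduct_mulVec, ← Matrix.mulVec_transpose, Matrix.mulVec_mulVec, hRt,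
        Matrix.one_mulVec]⟩
  let F := f.toLinearIsometryEquiv rfl
  have hc : Continuous (fun x : ι → ℝ => R *ᵥ x) := Continuous.matrix_mulVec continuous_const
    continuous_id
  have h := stdGaussian_map F
  rw [← map_pi_eq_stdGaussian, Measure.map_map F.continuous.measurable (by fun_prop)] at h
  have h2 := congrArg (Measure.map (WithLp.ofLp (p := 2) (V := ι → ℝ))) h
  rw [Measure.map_map (by fun_prop) (F.continuous.measurable.comp (by fun_prop)),
    Measure.map_map (by fun_prop) (by fun_prop)] at h2
  have e1 : (WithLp.ofLp (p := 2) (V := ι → ℝ)) ∘ (F ∘ (WithLp.toLp 2)) = fun x => R *ᵥ x := by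
    ext x; rfl
  have e2 : (WithLp.ofLp (p := 2) (V := ι → ℝ)) ∘ (WithLp.toLp 2) = id := rfl
  rw [e1, e2, Measure.map_id] at h2
  exact h2

lemma gaussianPi_singleton_zero {ι : Type*} [Fintype ι] [Nonempty ι] :
    gaussianPi ι {0} = 0 := by
  have := nullSingletonClass_gaussianReal (μ := 0) (v := 1) one_ne_zero
  rw [Measure.pi_singleton]
  exact Finset.prod_eq_zero (Finset.mem_univ (Classical.arbitrary ι)) (measure_singleton _)

namespace SpikedTensor

variable {n : ℕ}

/-! ### Haar measure on the rotation group -/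

instance : (rotationLaw n).IsHaarMeasure := by unfold rotationLaw; infer_instance

instance : IsProbabilityMeasure (rotationLaw n) :=
  ⟨by
    have h := Measure.haarMeasure_self (K₀ := (⊤ : TopologicalSpace.PositiveCompacts (SO n)))
    rwa [TopologicalSpace.PositiveCompacts.coe_top] at h⟩

lemma eq_rotationLaw_of_mul_left (μ : Measure (SO n)) [IsProbabilityMeasure μ]
    [μ.IsMulLeftInvariant] : μ = rotationLaw n := by
  have h := Measure.isMulInvariant_eq_smul_of_compactSpace μ (rotationLaw n)
  have h1 := congrArg (fun ν : Measure (SO n) => ν Set.univ) h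
  simp only [measure_univ, Measure.smul_apply] at h1
  rw [ENNReal.smul_def, smul_eq_mul, mul_one] at h1
  have h2 : Measure.haarScalarFactor μ (rotationLaw n) = 1 := by exact_mod_cast h1.symm
  rw [h, h2, one_smul]

instance : (rotationLaw n).IsMulRightInvariant := ⟨fun g => by
  have : IsProbabilityMeasure ((rotationLaw n).map (· * g)) :=
    Measure.isProbabilityMeasure_map (by fun_prop)
  exact eq_rotationLaw_of_mul_left _⟩

/-- Inversion exchanges right and left invariance. The right-handed form is needed because row-wise
Gram–Schmidt commutes with multiplication from the right. -/
lemma eq_rotationLaw_of_mul_right (μ : Measure (SO n)) [IsProbabilityMeasure μ]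
    [μ.IsMulRightInvariant] : μ = rotationLaw n := by
  have : IsProbabilityMeasure μ.inv := Measure.isProbabilityMeasure_map (by fun_prop)
  have : IsProbabilityMeasure (rotationLaw n).inv := Measure.isProbabilityMeasure_map (by fun_prop)
  rw [← Measure.inv_inv μ, eq_rotationLaw_of_mul_left μ.inv,
    eq_rotationLaw_of_mul_left (rotationLaw n).inv]

/-- The reflection in the hyperplane orthogonal to `u`. -/
def reflection (u : Fin n → ℝ) : Matrix (Fin n) (Fin n) ℝ :=
  1 - (2 / (u ⬝ᵥ u)) • Matrix.vecMulVec u u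

lemma reflection_mulVec (u x : Fin n → ℝ) :
    reflection u *ᵥ x = x - (2 / (u ⬝ᵥ u) * (u ⬝ᵥ x)) • u := by
  rw [reflection, Matrix.sub_mulVec, Matrix.one_mulVec, Matrix.smul_mulVec,
    Matrix.vecMulVec_mulVec]
  ext i
  simp
  ring

lemma reflection_transpose (u : Fin n → ℝ) : (reflection u)ᵀ = reflection u := by
  simp [reflection, Matrix.transpose_vecMulVec]

lemma reflection_mul_self {u : Fin n → ℝ} (hu : u ⬝ᵥ u ≠ 0) : reflection u * reflection u = 1 := by
  refine Matrix.ext_of_mulVec_single fun i => ?_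
  rw [← Matrix.mulVec_mulVec, Matrix.one_mulVec, reflection_mulVec, reflection_mulVec,
    dotProduct_sub, dotProduct_smul]
  ext j
  simp
  field_simp
  ring

lemma det_reflection {u : Fin n → ℝ} (hu : u ⬝ᵥ u ≠ 0) : (reflection u).det = -1 := by
  have e : reflection u = 1 + Matrix.replicateCol Unit (-(2 / (u ⬝ᵥ u)) • u) *
      Matrix.replicateRow Unit u := by
    rw [reflection, sub_eq_add_neg]
    congr 1
    ext i j
    simp [Matrix.mul_apply, Matrix.vecMulVec_apply]
    ring
  rw [e, Matrix.det_one_add_replicateCol_mul_replicateRow, dotProduct_smul, smul_eq_mul]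
  field_simp
  ring

/-- The reflection along `v - w` carries `v` to `w` but has determinant `-1`. A second reflection
along some `u` orthogonal to `w`, which exists since `n ≥ 2`, fixes `w` and corrects the
determinant. -/
lemma exists_rotation (hn : 2 ≤ n) {v w : Fin n → ℝ} (hv : v ⬝ᵥ v = 1) (hw : w ⬝ᵥ w = 1) :
    ∃ S : SO n, S.1 *ᵥ v = w := by
  by_cases hvw : v = w
  · exact ⟨1, by rw [hvw]; exact Matrix.one_mulVec w⟩
  obtain ⟨u, hu0, huw⟩ : ∃ u : Fin n → ℝ, u ⬝ᵥ u ≠ 0 ∧ u ⬝ᵥ w = 0 := by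
    let f : (Fin n → ℝ) →ₗ[ℝ] ℝ := ⟨⟨fun u => u ⬝ᵥ w, fun a b => add_dotProduct a b w⟩,
      fun c a => smul_dotProduct c a w⟩
    have hk : f.ker ≠ ⊥ := LinearMap.ker_ne_bot_of_finrank_lt (by simp; omega)
    obtain ⟨u, hu, hu0⟩ := Submodule.exists_mem_ne_zero_of_ne_bot hk
    exact ⟨u, fun h => hu0 (dotProduct_self_eq_zero.1 h), hu⟩
  have hd0 : (v - w) ⬝ᵥ (v - w) ≠ 0 := fun h => hvw (sub_eq_zero.1 (dotProduct_self_eq_zero.1 h))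
  refine ⟨⟨reflection u * reflection (v - w), ?_, ?_⟩, ?_⟩
  · refine Matrix.mem_unitaryGroup_iff.2 ?_
    change reflection u * reflection (v - w) * (reflection u * reflection (v - w))ᴴ = 1
    rw [Matrix.conjTranspose_eq_transpose_of_trivial, Matrix.transpose_mul, reflection_transpose,
      reflection_transpose, Matrix.mul_assoc, ← Matrix.mul_assoc (reflection (v - w)),
      reflection_mul_self hd0, Matrix.one_mul, reflection_mul_self hu0]
  · change (reflection u * reflection (v - w)).det = 1
    rw [Matrix.det_mul, det_reflection hu0, det_reflection hd0]; norm_num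
  · change (reflection u * reflection (v - w)) *ᵥ v = w
    have h1 : reflection (v - w) *ᵥ v = w := by
      rw [reflection_mulVec]
      have h2 : 2 / ((v - w) ⬝ᵥ (v - w)) * ((v - w) ⬝ᵥ v) = 1 := by
        have h3 : (v - w) ⬝ᵥ (v - w) = 2 * ((v - w) ⬝ᵥ v) := by
          simp only [sub_dotProduct, dotProduct_sub, hv, hw, dotProduct_comm w v]; ring
        rw [h3] at hd0 ⊢
        have : (v - w) ⬝ᵥ v ≠ 0 := fun h => hd0 (by rw [h, mul_zero])
        field_simp
      rw [h2, one_smul, sub_sub_cancel]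
    rw [← Matrix.mulVec_mulVec, h1, reflection_mulVec, huw, mul_zero, zero_smul, sub_zero]

lemma continuous_SO_mulVec : Continuous fun p : SO n × (Fin n → ℝ) => p.1.1 *ᵥ p.2 :=
  Continuous.matrix_mulVec (continuous_subtype_val.comp continuous_fst) continuous_snd

lemma measurable_SO_mulVec : Measurable fun p : SO n × (Fin n → ℝ) => p.1.1 *ᵥ p.2 :=
  continuous_SO_mulVec.measurable

/-- A random rotation of a fixed vector has the direction of a Gaussian vector. -/
lemma rotationLaw_mulVec_mem (hn : 2 ≤ n) {v : Fin n → ℝ} (hv : v ⬝ᵥ v = 1) {B : Set (Fin n → ℝ)}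
    (hB : MeasurableSet B) (hs : ∀ c : ℝ, 0 < c → ∀ x, c • x ∈ B ↔ x ∈ B) :
    rotationLaw n {R | R.1 *ᵥ v ∈ B} = gaussianPi (Fin n) B := by
  have hP : MeasurableSet {p : SO n × (Fin n → ℝ) | p.1.1 *ᵥ p.2 ∈ B} := measurable_SO_mulVec hB
  -- The probability that a random rotation of a Gaussian vector lies in the cone `B` is computed in
  -- both orders. With the rotation fixed, Gaussian invariance gives the right-hand side; with the
  -- vector fixed, only its direction matters and right invariance of Haar measure replaces it by
  -- `v`.
  have h1 : ((rotationLaw n).prod (gaussianPi (Fin n))) {p | p.1.1 *ᵥ p.2 ∈ B} =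
      gaussianPi (Fin n) B := by
    rw [Measure.prod_apply hP]
    have : ∀ R : SO n, gaussianPi (Fin n) (Prod.mk R ⁻¹' {p | p.1.1 *ᵥ p.2 ∈ B}) =
        gaussianPi (Fin n) B := fun R => by
      have h := gaussianPi_map_mulVec (SO_mul_transpose R)
      nth_rewrite 2 [← h]
      have hm : Measurable fun x : Fin n → ℝ => R.1 *ᵥ x :=
        (measurable_SO_mulVec (n := n)).comp measurable_prodMk_left
      rw [Measure.map_apply hm hB]
      rfl
    simp_rw [this]
    simp
  have : Nonempty (Fin n) := ⟨⟨0, by omega⟩⟩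
  have hne : ∀ᵐ x ∂gaussianPi (Fin n), x ≠ 0 := by
    rw [ae_iff]
    simpa using gaussianPi_singleton_zero (ι := Fin n)
  rw [← h1, Measure.prod_apply_symm hP]
  have h2 : ∀ᵐ x ∂gaussianPi (Fin n),
      rotationLaw n ((fun R => (R, x)) ⁻¹' {p | p.1.1 *ᵥ p.2 ∈ B}) =
        rotationLaw n {R | R.1 *ᵥ v ∈ B} := by
    filter_upwards [hne] with x hx
    have hx0 : 0 < x ⬝ᵥ x := lt_of_le_of_ne (dotProduct_self_star_nonneg (v := x))
      fun h => hx (dotProduct_self_eq_zero.1 h.symm)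
    have hc : 0 < (Real.sqrt (x ⬝ᵥ x))⁻¹ := inv_pos.2 (Real.sqrt_pos.2 hx0)
    obtain ⟨S, hS⟩ := exists_rotation hn (v := v) (w := (Real.sqrt (x ⬝ᵥ x))⁻¹ • x) hv (by
      rw [smul_dotProduct, dotProduct_smul, smul_eq_mul, smul_eq_mul, ← mul_assoc, ← mul_inv,
        Real.mul_self_sqrt hx0.le, inv_mul_cancel₀ hx0.ne'])
    rw [← measure_preimage_mul_right (rotationLaw n) S {R : SO n | R.1 *ᵥ v ∈ B}]
    congr 1
    ext R
    change R.1 *ᵥ x ∈ B ↔ (R.1 * S.1) *ᵥ v ∈ B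
    rw [← Matrix.mulVec_mulVec, hS, Matrix.mulVec_smul, hs _ hc]
  rw [lintegral_congr_ae h2]
  simp

end SpikedTensor

namespace SpikedTensor

variable {n : ℕ}

/-! ### Measurability -/

section Measurability

variable {Ω : Type*} [MeasurableSpace Ω] {T : Ω → Tensor n} {Q : Ω → Matrix (Fin n) (Fin n) ℝ}
  {σ : Ω → Equiv.Perm (Fin n)} {x y z : Ω → Fin n → ℝ}

lemma measurable_mask (hσ : Measurable σ) (hx : ∀ i, Measurable fun ω => x ω i) (c : Fin 3)
    (i : Fin n) : Measurable fun ω => mask (σ ω) c (x ω) i := by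
  have h : Measurable fun s : Equiv.Perm (Fin n) =>
      (if (s i : ℕ) % 3 = (c : ℕ) then 1 else 0 : ℝ) := measurable_from_top
  exact (h.comp hσ).mul (hx i)

lemma measurable_transpose_mulVec (hQ : ∀ i j, Measurable fun ω => Q ω i j)
    (hx : ∀ i, Measurable fun ω => x ω i) (i : Fin n) :
    Measurable fun ω => ((Q ω)ᵀ *ᵥ x ω) i := by
  simp only [Matrix.mulVec, dotProduct, Matrix.transpose_apply]
  exact Finset.measurable_sum _ fun j _ => (hQ j i).mul (hx j)

lemma measurable_mulVec (hQ : ∀ i j, Measurable fun ω => Q ω i j)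
    (hx : ∀ i, Measurable fun ω => x ω i) (i : Fin n) : Measurable fun ω => (Q ω *ᵥ x ω) i := by
  simp only [Matrix.mulVec, dotProduct]
  exact Finset.measurable_sum _ fun j _ => (hQ i j).mul (hx j)

lemma measurable_tri (hT : ∀ i j k, Measurable fun ω => T ω i j k)
    (hx : ∀ i, Measurable fun ω => x ω i) (hy : ∀ i, Measurable fun ω => y ω i)
    (hz : ∀ i, Measurable fun ω => z ω i) : Measurable fun ω => tri (T ω) (x ω) (y ω) (z ω) := by
  simp only [tri]
  exact Finset.measurable_sum _ fun i _ => Finset.measurable_sum _ fun j _ =>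
    Finset.measurable_sum _ fun k _ => (hT i j k).mul (((hx i).mul (hy j)).mul (hz k))

lemma measurable_blockForm (hT : ∀ i j k, Measurable fun ω => T ω i j k)
    (hQ : ∀ i j, Measurable fun ω => Q ω i j) (hσ : Measurable σ) (c : Fin 3)
    (hx : ∀ i, Measurable fun ω => x ω i) (hy : ∀ i, Measurable fun ω => y ω i) :
    Measurable fun ω => blockForm (T ω) (Q ω) (σ ω) c (x ω) (y ω) := by
  simp only [blockForm]
  have h1 : ∀ (d : Fin 3) (i : Fin n), Measurable fun ω => mask (σ ω) d 1 i := fun d i =>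
    measurable_mask hσ (fun _ => measurable_const) d i
  refine Measurable.sub ?_ (Measurable.const_mul ?_ _)
  · exact Finset.measurable_sum _ fun i _ => Finset.measurable_sum _ fun j _ =>
      ((h1 _ i).mul (h1 _ j)).mul
        ((measurable_tri hT (hQ i) (hQ j)
          (measurable_transpose_mulVec hQ (measurable_mask hσ hx c))).mul
        (measurable_tri hT (hQ i) (hQ j)
          (measurable_transpose_mulVec hQ (measurable_mask hσ hy c))))
  · exact Finset.measurable_sum _ fun i _ =>
      (measurable_mask hσ hx c i).mul (measurable_mask hσ hy c i)

lemma blockMat_apply (T : Tensor n) (Q : Matrix (Fin n) (Fin n) ℝ) (σ : Equiv.Perm (Fin n))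
    (c : Fin 3) (i j : Fin n) :
    blockMat T Q σ c i j = blockForm T Q σ c (Pi.single i 1) (Pi.single j 1) := by
  rw [← dotProduct_blockMat]
  simp

lemma measurable_blockMat (hT : ∀ i j k, Measurable fun ω => T ω i j k)
    (hQ : ∀ i j, Measurable fun ω => Q ω i j) (hσ : Measurable σ) (c : Fin 3) (i j : Fin n) :
    Measurable fun ω => blockMat (T ω) (Q ω) (σ ω) c i j := by
  simp only [blockMat_apply]
  exact measurable_blockForm hT hQ hσ c (fun _ => measurable_const) (fun _ => measurable_const)

lemma measurable_normalized {x : Ω → EuclideanSpace ℝ (Fin n)}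
    (hx : ∀ i, Measurable fun ω => x ω i) (i : Fin n) : Measurable fun ω => normalized (x ω) i := by
  simp only [normalized, PiLp.smul_apply, smul_eq_mul, EuclideanSpace.norm_eq, Real.norm_eq_abs,
    sq_abs]
  exact ((Finset.measurable_sum _ fun j _ => (hx j).pow_const 2).sqrt.inv).mul (hx i)

lemma measurable_powerIterate (hQ : ∀ i j, Measurable fun ω => Q ω i j)
    (hx : ∀ i, Measurable fun ω => x ω i) (k : ℕ) (i : Fin n) :
    Measurable fun ω => powerIterate (Q ω) (x ω) k i := by
  induction k generalizing i with
  | zero => exact measurable_normalized hx i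
  | succ k ih => exact measurable_normalized (fun i => measurable_mulVec hQ ih i) i

end Measurability

lemma measurable_SO_apply (i j : Fin n) : Measurable fun R : SO n => R.1 i j :=
  (Continuous.matrix_elem continuous_subtype_val i j : Continuous fun R : SO n => R.1 i j).measurable

lemma measurable_noiseTensor (i j k : Fin n) :
    Measurable fun a : Sym (Fin n) 3 → ℝ => noiseTensor a i j k := measurable_pi_apply _

lemma measurable_spikedTensor (τ : ℝ) (v₀ : EuclideanSpace ℝ (Fin n)) (i j k : Fin n) :
    Measurable fun a : Sym (Fin n) 3 → ℝ => spikedTensor τ v₀ a i j k :=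
  (measurable_noiseTensor i j k).const_add _

/-- The pairs of a matrix and a vector such that some top singular vector of the matrix is
correlated with the vector. -/
def goodStart (n : ℕ) (δ : ℝ) : Set ((Fin n → Fin n → ℝ) × (Fin n → ℝ)) :=
  {p | ∃ w, IsTopSingularVector (Matrix.of p.1) w ∧ δ ≤ |inner ℝ w (WithLp.toLp 2 p.2)|}

/-- The set is the projection of a closed set along the compact unit sphere. This provides
measurability without selecting a singular vector measurably. -/
lemma isClosed_goodStart (n : ℕ) (δ : ℝ) : IsClosed (goodStart n δ) := by
  let X := Metric.sphere (0 : EuclideanSpace ℝ (Fin n)) 1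
  let Y := (Fin n → Fin n → ℝ) × (Fin n → ℝ)
  have hM : ∀ f : X × Y → EuclideanSpace ℝ (Fin n), Continuous f →
      Continuous fun q : X × Y => ‖Matrix.toEuclideanLin (Matrix.of q.2.1) (f q)‖ := fun f hf => by
    refine Continuous.norm ?_
    change Continuous fun q : X × Y => WithLp.toLp 2 ((Matrix.of q.2.1) *ᵥ (f q).ofLp)
    refine (PiLp.continuous_toLp 2 _).comp (Continuous.matrix_mulVec ?_ ?_)
    · exact (continuous_fst.comp continuous_snd)
    · exact (PiLp.continuous_ofLp 2 _).comp hf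
  have hcl1 : IsClosed {q : X × Y | ∀ u : EuclideanSpace ℝ (Fin n), ‖u‖ = 1 →
      ‖Matrix.toEuclideanLin (Matrix.of q.2.1) u‖ ≤
        ‖Matrix.toEuclideanLin (Matrix.of q.2.1) q.1.1‖} := by
    simp only [Set.ofPred_forall]
    exact isClosed_iInter fun u => isClosed_iInter fun _ => isClosed_le (hM _ continuous_const)
      (hM _ (continuous_subtype_val.comp continuous_fst))
  have hcl2 : IsClosed {q : X × Y | δ ≤ |inner ℝ q.1.1 (WithLp.toLp 2 q.2.2)|} :=
    isClosed_le continuous_const (Continuous.abs (Continuous.inner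
      (continuous_subtype_val.comp continuous_fst)
      ((PiLp.continuous_toLp 2 _).comp (continuous_snd.comp continuous_snd))))
  have h := isClosedMap_snd_of_compactSpace (X := X) (Y := Y) _ (hcl1.inter hcl2)
  convert h using 1
  ext p
  constructor
  · rintro ⟨w, hw, hwp⟩
    exact ⟨(⟨w, mem_sphere_zero_iff_norm.2 hw.1⟩, p), ⟨hw.2, hwp⟩, rfl⟩
  · rintro ⟨⟨w, q⟩, ⟨h1, h2⟩, rfl⟩
    exact ⟨w.1, ⟨mem_sphere_zero_iff_norm.1 w.2, h1⟩, h2⟩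

lemma exists_isTopSingularVector (hn : 0 < n) (M : Matrix (Fin n) (Fin n) ℝ) :
    ∃ w, IsTopSingularVector M w := by
  have hne : (Metric.sphere (0 : EuclideanSpace ℝ (Fin n)) 1).Nonempty :=
    ⟨EuclideanSpace.single ⟨0, hn⟩ 1, by simp⟩
  obtain ⟨w, hw, hmax⟩ := (isCompact_sphere (0 : EuclideanSpace ℝ (Fin n)) 1).exists_isMaxOn hne
    (f := fun u => ‖Matrix.toEuclideanLin M u‖)
    ((LinearMap.continuous_of_finiteDimensional (Matrix.toEuclideanLin M)).norm).continuousOn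
  exact ⟨w, by simpa using hw, fun u hu => hmax (by simp [hu])⟩

/-- For a fixed matrix, one top singular vector can be chosen before the start is drawn; the overlap
is then a standard Gaussian and has density below `1 / 2`. -/
lemma gaussianPi_not_goodStart (hn : 0 < n) (M : Fin n → Fin n → ℝ) (δ : ℝ) :
    gaussianPi (Fin n) {g | (M, g) ∉ goodStart n δ} ≤ ENNReal.ofReal δ := by
  obtain ⟨w, hw⟩ := exists_isTopSingularVector hn (Matrix.of M)
  refine (measure_mono fun g hg => ?_).trans
    (gaussianPi_small_ball (fun i => w i) (by
      rw [← EuclideanSpace.real_norm_sq_eq, hw.1]; norm_num) δ)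
  change |∑ i, w i * g i| < δ
  by_contra hcon
  push Not at hcon
  refine hg ⟨w, hw, ?_⟩
  rw [inner_eq_dotProduct]
  exact hcon

/-! ### The mass of a random direction in the three parts -/

/-- The event is homogeneous in `x`, so that it can be transferred to a random direction. With `r =
n^{1/4}`, both `∑ x²` and its restriction to the part are within `r³ / 4` of their means, outside
probability of order `exp (-√n / 128)`. The deviation is then at most `r³ / 3 + 1`, which is less
than `r³ - r² / 4 ≤ r⁻¹ ∑ x²`. -/
lemma gaussianPi_mask_tail (hn : 12 ^ 4 ≤ n) (σ : Equiv.Perm (Fin n)) (c : Fin 3) :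
    gaussianPi (Fin n) {x | (Real.sqrt (Real.sqrt n))⁻¹ * ∑ i, x i ^ 2 <
        |∑ i, mask σ c x i ^ 2 - (∑ i, x i ^ 2) / 3|} ≤
      ENNReal.ofReal (4 * Real.exp (-(Real.sqrt n / 128))) := by
  have hnR : (12 : ℝ) ^ 4 ≤ n := by exact_mod_cast hn
  set r := Real.sqrt (Real.sqrt n) with hr
  have hs0 := Real.sqrt_nonneg (n : ℝ)
  have hr2 : r ^ 2 = Real.sqrt n := Real.sq_sqrt hs0
  have hr4 : r ^ 4 = n := by
    have : r ^ 4 = (r ^ 2) ^ 2 := by ring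
    rw [this, hr2, Real.sq_sqrt (by linarith)]
  have hr12 : 12 ≤ r := Real.le_sqrt_of_sq_le (Real.le_sqrt_of_sq_le (by linarith))
  have hcm : ∀ x : Fin n → ℝ, ∑ i, mask σ c x i ^ 2 =
      ∑ i, (if (σ i : ℕ) % 3 = (c : ℕ) then (1 : ℝ) else 0) * x i ^ 2 := fun x =>
    Finset.sum_congr rfl fun i _ => by simp only [mask]; split_ifs <;> simp
  have hcard : ∑ i, (if (σ i : ℕ) % 3 = (c : ℕ) then (1 : ℝ) else 0) = (partSet σ c).card := by
    rw [Finset.sum_boole]; rfl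
  have hpc : ((partSet σ c).card : ℝ) ≤ n := by
    have := Finset.card_le_univ (partSet σ c)
    rw [Fintype.card_fin] at this
    exact_mod_cast this
  have hpc' := abs_le.1 (card_partSet σ c)
  have t1 := gaussianPi_weighted_sq_tail (ι := Fin n) (fun _ => 1) (b := 1) (l := 1 / (16 * r))
    (t := r ^ 3 / 4) (fun _ => zero_le_one) (fun _ => le_rfl) (by positivity) (by
      rw [mul_one, div_le_div_iff₀ (by positivity) (by norm_num)]; linarith)
  have t2 := gaussianPi_weighted_sq_tail (ι := Fin n)
    (fun i => if (σ i : ℕ) % 3 = (c : ℕ) then (1 : ℝ) else 0) (b := 1) (l := 1 / (16 * r))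
    (t := r ^ 3 / 4) (fun i => by split_ifs <;> norm_num)
    (fun i => by split_ifs <;> norm_num) (by positivity) (by
      rw [mul_one, div_le_div_iff₀ (by positivity) (by norm_num)]; linarith)
  have hexp : ∀ m : ℝ, m ≤ n →
      2 * Real.exp (2 * (1 / (16 * r)) ^ 2 * 1 * m - 1 / (16 * r) * (r ^ 3 / 4)) ≤
        2 * Real.exp (-(Real.sqrt n / 128)) := fun m hm => by
    gcongr
    have e1 : 2 * (1 / (16 * r)) ^ 2 * 1 * (n : ℝ) = r ^ 2 / 128 := by
      rw [← hr4]; field_simp; norm_num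
    have e2 : 1 / (16 * r) * (r ^ 3 / 4) = r ^ 2 / 64 := by field_simp; norm_num
    have e3 : 2 * (1 / (16 * r)) ^ 2 * 1 * m ≤ 2 * (1 / (16 * r)) ^ 2 * 1 * (n : ℝ) :=
      mul_le_mul_of_nonneg_left hm (by positivity)
    rw [e2, ← hr2]
    linarith
  have t1' := t1.trans (hexp _ (by simp))
  have t2' := t2.trans (hexp _ (by rw [hcard]; exact hpc))
  rw [← ofReal_measureReal (measure_ne_top _ _)]
  apply ENNReal.ofReal_le_ofReal
  refine (measureReal_mono (μ := gaussianPi (Fin n)) (fun x hx => ?_)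
    (measure_ne_top _ _)).trans ((measureReal_union_le _ _).trans
      ((add_le_add t1' t2').trans (by linarith)))
  by_contra hcon
  simp only [Set.mem_union, Set.mem_ofPred_eq, not_or, not_le] at hcon
  obtain ⟨h1, h2⟩ := hcon
  rw [hcard, ← hcm] at h2
  simp only [one_mul, Finset.sum_const, Finset.card_univ, Fintype.card_fin, nsmul_eq_mul,
    mul_one] at h1
  have h1' := abs_lt.1 h1
  have h2' := abs_lt.1 h2
  have hlow : r ^ 3 - r ^ 2 / 4 ≤ r⁻¹ * ∑ i, x i ^ 2 := by
    have : r⁻¹ * (r ^ 4 - r ^ 3 / 4) ≤ r⁻¹ * ∑ i, x i ^ 2 :=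
      mul_le_mul_of_nonneg_left (by rw [hr4]; linarith) (by positivity)
    refine le_trans (le_of_eq ?_) this
    field_simp
  have hup : |∑ i, mask σ c x i ^ 2 - (∑ i, x i ^ 2) / 3| ≤ r ^ 3 / 3 + 1 := by
    rw [abs_le]; constructor <;> linarith
  have hx' : r⁻¹ * ∑ i, x i ^ 2 < |∑ i, mask σ c x i ^ 2 - (∑ i, x i ^ 2) / 3| := hx
  have h3 : 12 * r ^ 2 ≤ r ^ 3 := by
    have := mul_le_mul_of_nonneg_right hr12 (sq_nonneg r)
    linarith [pow_succ' r 2]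
  have h4 : 144 ≤ r ^ 2 := by nlinarith
  linarith

lemma rotationLaw_mask_tail (hn : 12 ^ 4 ≤ n) {v : EuclideanSpace ℝ (Fin n)} (hv : ‖v‖ = 1)
    (σ : Equiv.Perm (Fin n)) (c : Fin 3) :
    rotationLaw n {R | (Real.sqrt (Real.sqrt n))⁻¹ <
        |∑ i, mask σ c (R.1 *ᵥ v) i ^ 2 - 1 / 3|} ≤
      ENNReal.ofReal (4 * Real.exp (-(Real.sqrt n / 128))) := by
  have hv1 : (v : Fin n → ℝ) ⬝ᵥ (v : Fin n → ℝ) = 1 := by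
    rw [← inner_eq_dotProduct, real_inner_self_eq_norm_sq, hv]; norm_num
  have hm : ∀ i, Measurable fun x : Fin n → ℝ => mask σ c x i := fun i =>
    measurable_mask measurable_const (fun i => measurable_pi_apply i) c i
  refine le_trans (le_of_eq ?_) (gaussianPi_mask_tail hn σ c)
  rw [← rotationLaw_mulVec_mem (by omega) hv1]
  · congr 1
    ext R
    have h1 : ∑ i, (R.1 *ᵥ (v : Fin n → ℝ)) i ^ 2 = 1 := by
      rw [sum_mulVec_sq (SO_mul_transpose R), ← EuclideanSpace.real_norm_sq_eq, hv]; norm_num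
    simp only [Set.mem_ofPred_eq, h1, mul_one]
  · refine measurableSet_lt (Measurable.const_mul ?_ _) (Measurable.abs (Measurable.sub ?_ ?_))
    · fun_prop
    · exact Finset.measurable_sum _ fun i _ => (hm i).pow_const 2
    · fun_prop
  · intro d hd x
    have e : ∀ y : Fin n → ℝ, ∑ i, (d • y) i ^ 2 = d ^ 2 * ∑ i, y i ^ 2 := fun y => by
      simp [mul_pow, Finset.mul_sum]
    simp only [Set.mem_ofPred_eq, mask_smul, e]
    have e2 : d ^ 2 * ∑ i, mask σ c x i ^ 2 - d ^ 2 * (∑ i, x i ^ 2) / 3 =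
        d ^ 2 * (∑ i, mask σ c x i ^ 2 - (∑ i, x i ^ 2) / 3) := by ring
    rw [e2, abs_mul, abs_of_pos (by positivity : 0 < d ^ 2), mul_left_comm]
    exact mul_lt_mul_iff_right₀ (by positivity)

end SpikedTensor

/-! ### The probability of the good event -/

lemma MeasureTheory.Measure.prod_le_of_left {α β : Type*} [MeasurableSpace α] [MeasurableSpace β]
    {μ : Measure α} {ν : Measure β} [SFinite μ] [IsProbabilityMeasure ν] {s : Set (α × β)}
    (hs : MeasurableSet s) {δ : ENNReal} (h : ∀ y, μ {x | (x, y) ∈ s} ≤ δ) :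
    (μ.prod ν) s ≤ δ := by
  rw [Measure.prod_apply_symm hs]
  exact (lintegral_mono h).trans (by simp)

lemma MeasureTheory.Measure.prod_le_of_right {α β : Type*} [MeasurableSpace α] [MeasurableSpace β]
    {μ : Measure α} {ν : Measure β} [SFinite ν] [IsProbabilityMeasure μ] {s : Set (α × β)}
    (hs : MeasurableSet s) {δ : ENNReal} (h : ∀ x, ν {y | (x, y) ∈ s} ≤ δ) :
    (μ.prod ν) s ≤ δ := by
  rw [Measure.prod_apply hs]
  exact (lintegral_mono h).trans (by simp)

namespace SpikedTensor

variable {n : ℕ}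

instance : IsProbabilityMeasure (permLaw n) := by unfold permLaw; infer_instance

/-- The law of the three starting vectors. -/
abbrev startLaw (n : ℕ) : Measure (Fin 3 → Fin n → ℝ) :=
  Measure.pi fun _ => gaussianPi (Fin n)

instance : IsProbabilityMeasure (coinLaw n) := by unfold coinLaw; infer_instance

lemma coinLaw_le_of_rotation {s : Set (Coins n)} (hs : MeasurableSet s) {δ : ENNReal}
    (h : ∀ q, rotationLaw n {R | (R, q) ∈ s} ≤ δ) : coinLaw n s ≤ δ :=
  Measure.prod_le_of_left hs h

lemma coinLaw_le_of_start {s : Set (Coins n)} (hs : MeasurableSet s) {δ : ENNReal}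
    (h : ∀ R σ, startLaw n {g | (R, σ, g) ∈ s} ≤ δ) : coinLaw n s ≤ δ :=
  Measure.prod_le_of_right hs fun R =>
    Measure.prod_le_of_right (hs.preimage measurable_prodMk_left) (h R)

lemma startLaw_eval (c : Fin 3) {s : Set (Fin n → ℝ)} (hs : MeasurableSet s) :
    startLaw n {g | g c ∈ s} = gaussianPi (Fin n) s :=
  (measurePreserving_eval (fun _ : Fin 3 => gaussianPi (Fin n)) c).measure_preimage
    hs.nullMeasurableSet

lemma noise_coin_tri_tail (n : ℕ) :
    ((noiseLaw n).prod (coinLaw n)) {ω | ∃ x ∈ unitNet n, ∃ y ∈ unitNet n, ∃ z ∈ unitNet n,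
      10 * Real.sqrt n ≤ |tri (noiseTensor ω.1) x y z|} ≤ ENNReal.ofReal (2 * Real.exp (-n)) := by
  refine le_trans (le_of_eq ?_) (tri_noise_net_tail n)
  rw [← mul_one (noiseLaw n _), ← measure_univ (μ := coinLaw n), ← Measure.prod_prod]
  congr 1
  ext ω
  simp

lemma measurable_coins_apply (i j : Fin n) :
    Measurable fun ω : (Sym (Fin n) 3 → ℝ) × Coins n => ω.2.1.1 i j :=
  (measurable_SO_apply i j).comp (measurable_fst.comp measurable_snd)

lemma measurable_coins_perm :
    Measurable fun ω : (Sym (Fin n) 3 → ℝ) × Coins n => ω.2.2.1 := by fun_prop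

lemma noise_coin_blockForm_tail (hn : 1 ≤ n) :
    ((noiseLaw n).prod (coinLaw n)) {ω | ∃ c : Fin 3, ∃ x ∈ unitNet n, ∃ y ∈ unitNet n,
        1000 * (n * Real.sqrt n) < |blockForm (noiseTensor ω.1) ω.2.1.1 ω.2.2.1 c (x + y) (x + y)| ∨
        1000 * (n * Real.sqrt n) <
          |blockForm (noiseTensor ω.1) ω.2.1.1 ω.2.2.1 c (x - y) (x - y)|} ≤
      ENNReal.ofReal (12 * Real.exp (-n)) := by
  have hm : ∀ (c : Fin 3) (u : EuclideanSpace ℝ (Fin n)),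
      MeasurableSet {ω : (Sym (Fin n) 3 → ℝ) × Coins n |
        1000 * (n * Real.sqrt n) < |blockForm (noiseTensor ω.1) ω.2.1.1 ω.2.2.1 c u u|} :=
    fun c u => by
    have h : Measurable fun ω : (Sym (Fin n) 3 → ℝ) × Coins n =>
        blockForm (noiseTensor ω.1) ω.2.1.1 ω.2.2.1 c u u :=
      measurable_blockForm (T := fun ω : (Sym (Fin n) 3 → ℝ) × Coins n => noiseTensor ω.1)
        (Q := fun ω => ω.2.1.1) (σ := fun ω => ω.2.2.1) (x := fun _ => u) (y := fun _ => u)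
        (fun i j k => (measurable_noiseTensor i j k).comp measurable_fst) measurable_coins_apply
        measurable_coins_perm c (fun _ => measurable_const) (fun _ => measurable_const)
    exact measurableSet_lt measurable_const h.abs
  refine Measure.prod_le_of_left ?_ fun ρ =>
    blockForm_noise_net_tail (SO_mul_transpose ρ.1) ρ.2.1 hn
  have hU := MeasurableSet.iUnion fun c => Finset.measurableSet_biUnion (unitNet n) fun x _ =>
    Finset.measurableSet_biUnion (unitNet n) fun y _ => (hm c (x + y)).union (hm c (x - y))
  convert hU using 1
  ext ω
  simp only [Set.mem_iUnion, Set.mem_union, Set.mem_ofPred_eq, exists_prop, WithLp.ofLp_add,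
    WithLp.ofLp_sub]

lemma noise_coin_mask_tail (hn : 12 ^ 4 ≤ n) {v : EuclideanSpace ℝ (Fin n)} (hv : ‖v‖ = 1)
    (c : Fin 3) :
    ((noiseLaw n).prod (coinLaw n)) {ω | (Real.sqrt (Real.sqrt n))⁻¹ <
        |∑ i, mask ω.2.2.1 c (ω.2.1.1 *ᵥ v) i ^ 2 - 1 / 3|} ≤
      ENNReal.ofReal (4 * Real.exp (-(Real.sqrt n / 128))) := by
  have hm : MeasurableSet {ω : (Sym (Fin n) 3 → ℝ) × Coins n | (Real.sqrt (Real.sqrt n))⁻¹ <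
        |∑ i, mask ω.2.2.1 c (ω.2.1.1 *ᵥ v) i ^ 2 - 1 / 3|} :=
    by
    have h : ∀ i, Measurable fun ω : (Sym (Fin n) 3 → ℝ) × Coins n =>
        mask ω.2.2.1 c (ω.2.1.1 *ᵥ v) i :=
      measurable_mask (σ := fun ω : (Sym (Fin n) 3 → ℝ) × Coins n => ω.2.2.1)
        (x := fun ω => ω.2.1.1 *ᵥ v) measurable_coins_perm
        (measurable_mulVec (Q := fun ω : (Sym (Fin n) 3 → ℝ) × Coins n => ω.2.1.1)
          (x := fun _ => v) measurable_coins_apply fun _ => measurable_const) c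
    have h2 : Measurable fun ω : (Sym (Fin n) 3 → ℝ) × Coins n =>
        |∑ i, mask ω.2.2.1 c (ω.2.1.1 *ᵥ v) i ^ 2 - 1 / 3| :=
      ((Finset.measurable_sum _ fun i _ => (h i).pow_const 2).sub_const _).abs
    exact measurableSet_lt measurable_const h2
  exact Measure.prod_le_of_right hm fun a =>
    coinLaw_le_of_rotation (hm.preimage measurable_prodMk_left) fun q =>
      rotationLaw_mask_tail hn hv q.1 c

lemma noise_coin_start_tail (hn : 0 < n) (τ : ℝ) (v₀ : EuclideanSpace ℝ (Fin n)) (c : Fin 3)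
    (δ : ℝ) :
    ((noiseLaw n).prod (coinLaw n)) {ω |
        ((fun i j => blockMatrix (spikedTensor τ v₀ ω.1) ω.2.1 ω.2.2.1 c i j), ω.2.2.2 c) ∉
          goodStart n δ} ≤ ENNReal.ofReal δ := by
  have hcl : MeasurableSet (goodStart n δ) := (isClosed_goodStart n δ).measurableSet
  have hf : Measurable fun ω : (Sym (Fin n) 3 → ℝ) × Coins n =>
      (((fun i j => blockMatrix (spikedTensor τ v₀ ω.1) ω.2.1 ω.2.2.1 c i j), ω.2.2.2 c) :
        (Fin n → Fin n → ℝ) × (Fin n → ℝ)) := by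
    refine Measurable.prodMk (measurable_pi_lambda _ fun i => measurable_pi_lambda _ fun j => ?_) ?_
    · exact measurable_blockMat (fun i j k => (measurable_spikedTensor τ v₀ i j k).comp
        measurable_fst) measurable_coins_apply measurable_coins_perm c i j
    · fun_prop
  have hm := hf hcl.compl
  refine Measure.prod_le_of_right hm fun a =>
    coinLaw_le_of_start (hm.preimage measurable_prodMk_left) fun R σ => ?_
  have h := gaussianPi_not_goodStart hn
    (fun i j => blockMatrix (spikedTensor τ v₀ a) R σ c i j) δ
  refine le_trans (le_of_eq ?_) h
  exact startLaw_eval c (s := {g | ((fun i j => blockMatrix (spikedTensor τ v₀ a) R σ c i j), g) ∉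
    goodStart n δ}) (hcl.compl.preimage measurable_prodMk_left)

lemma noise_coin_norm_tail (hn : 0 < n) (c : Fin 3) :
    ((noiseLaw n).prod (coinLaw n)) {ω | (n : ℝ) ^ 12 ≤ ∑ i, ω.2.2.2 c i ^ 2} ≤
      ENNReal.ofReal (((n : ℝ) ^ 11)⁻¹) := by
  have hm : MeasurableSet {ω : (Sym (Fin n) 3 → ℝ) × Coins n |
      (n : ℝ) ^ 12 ≤ ∑ i, ω.2.2.2 c i ^ 2} := measurableSet_le (by fun_prop) (by fun_prop)
  have hnR : (0 : ℝ) < n := by exact_mod_cast hn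
  refine Measure.prod_le_of_right hm fun a =>
    coinLaw_le_of_start (hm.preimage measurable_prodMk_left) fun R σ => ?_
  have h := gaussianPi_sum_sq_ge (ι := Fin n) (t := (n : ℝ) ^ 12) (by positivity)
  rw [Fintype.card_fin] at h
  have e : (n : ℝ) / n ^ 12 = ((n : ℝ) ^ 11)⁻¹ := by field_simp
  rw [e] at h
  refine le_trans (le_of_eq ?_) h
  exact startLaw_eval c (s := {g | (n : ℝ) ^ 12 ≤ ∑ i, g i ^ 2})
    (measurableSet_le (by fun_prop) (by fun_prop))

/-- The twentieth term of the exponential series turns the tail in `√n` into the power `n^{-10}`. -/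
lemma exp_neg_sqrt_le (hn : 0 < n) :
    Real.exp (-(Real.sqrt n / 128)) ≤ 128 ^ 20 * (20).factorial / (n : ℝ) ^ 10 := by
  have hnR : (0 : ℝ) < n := by exact_mod_cast hn
  have h := Real.pow_div_factorial_le_exp (Real.sqrt n / 128) (by positivity) 20
  have e : (Real.sqrt n) ^ 20 = (n : ℝ) ^ 10 := by
    have : (Real.sqrt n) ^ 20 = (Real.sqrt n ^ 2) ^ 10 := by ring
    rw [this, Real.sq_sqrt hnR.le]
  rw [div_pow, e] at h
  rw [Real.exp_neg]
  have hf : (0 : ℝ) < (20).factorial := by exact_mod_cast Nat.factorial_pos 20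
  refine (inv_anti₀ (by positivity) h).trans (le_of_eq ?_)
  field_simp

/-- Union bound. The coefficient `26 = 2 + 12 + 3 * 4` collects the trilinear, block and mass
events; `6 = 3 * 2` collects small overlap and large norm of the three starting vectors.
Independence lets each event be estimated with the other variables frozen. -/
lemma noise_coin_not_isGood_le (hn : 12 ^ 4 ≤ n) (τ : ℝ) {v₀ : EuclideanSpace ℝ (Fin n)}
    (hv : ‖v₀‖ = 1) :
    ((noiseLaw n).prod (coinLaw n)) {ω | ¬ IsGood τ v₀ ω.1 ω.2} ≤
      ENNReal.ofReal ((26 * (128 ^ 20 * (20).factorial) + 6) / (n : ℝ) ^ 10) := by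
  have hn0 : 0 < n := lt_of_lt_of_le (by norm_num) hn
  have hnR : (1 : ℝ) ≤ n := by exact_mod_cast hn0
  set μ := (noiseLaw n).prod (coinLaw n)
  set B1 := {ω : (Sym (Fin n) 3 → ℝ) × Coins n | ∃ x ∈ unitNet n, ∃ y ∈ unitNet n,
    ∃ z ∈ unitNet n, 10 * Real.sqrt n ≤ |tri (noiseTensor ω.1) x y z|} with hB1
  set B2 := {ω : (Sym (Fin n) 3 → ℝ) × Coins n | ∃ c : Fin 3, ∃ x ∈ unitNet n, ∃ y ∈ unitNet n,
        1000 * (n * Real.sqrt n) < |blockForm (noiseTensor ω.1) ω.2.1.1 ω.2.2.1 c (x + y) (x + y)| ∨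
        1000 * (n * Real.sqrt n) <
          |blockForm (noiseTensor ω.1) ω.2.1.1 ω.2.2.1 c (x - y) (x - y)|} with hB2
  set B3 := fun c => {ω : (Sym (Fin n) 3 → ℝ) × Coins n | (Real.sqrt (Real.sqrt n))⁻¹ <
        |∑ i, mask ω.2.2.1 c (ω.2.1.1 *ᵥ v₀) i ^ 2 - 1 / 3|} with hB3
  set B4 := fun c => {ω : (Sym (Fin n) 3 → ℝ) × Coins n |
        ((fun i j => blockMatrix (spikedTensor τ v₀ ω.1) ω.2.1 ω.2.2.1 c i j), ω.2.2.2 c) ∉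
          goodStart n ((n : ℝ) ^ 11)⁻¹} with hB4
  set B5 := fun c => {ω : (Sym (Fin n) 3 → ℝ) × Coins n | (n : ℝ) ^ 12 ≤ ∑ i, ω.2.2.2 c i ^ 2}
    with hB5
  have hsub : {ω | ¬ IsGood τ v₀ ω.1 ω.2} ⊆
      (B1 ∪ B2) ∪ ⋃ c : Fin 3, (B3 c ∪ B4 c ∪ B5 c) := by
    intro ω hω
    by_contra hcon
    simp only [Set.mem_union, Set.mem_iUnion, not_or, not_exists] at hcon
    obtain ⟨⟨h1, h2⟩, h3⟩ := hcon
    refine hω ⟨fun x y z => ?_, fun c x y => ?_, fun c => ?_, fun c => ?_, fun c => ?_⟩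
    · have h4 : ∀ x ∈ unitNet n, ∀ y ∈ unitNet n, ∀ z ∈ unitNet n,
          |tri (noiseTensor ω.1) x y z| ≤ 10 * Real.sqrt n := fun x hx y hy z hz => by
        by_contra hlt
        exact h1 ⟨x, hx, y, hy, z, hz, (not_le.1 hlt).le⟩
      have := abs_tri_le_of_net h4 x y z
      linarith
    · have h4 : ∀ x ∈ unitNet n, ∀ y ∈ unitNet n,
          |blockForm (noiseTensor ω.1) ω.2.1.1 ω.2.2.1 c (x + y) (x + y)| ≤
            1000 * (n * Real.sqrt n) ∧
          |blockForm (noiseTensor ω.1) ω.2.1.1 ω.2.2.1 c (x - y) (x - y)| ≤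
            1000 * (n * Real.sqrt n) := fun x hx y hy => by
        constructor
        · by_contra hlt
          exact h2 ⟨c, x, hx, y, hy, Or.inl (not_le.1 hlt)⟩
        · by_contra hlt
          exact h2 ⟨c, x, hx, y, hy, Or.inr (not_le.1 hlt)⟩
      have := abs_blockForm_le_of_net h4 x y
      linarith
    · exact not_lt.1 (h3 c).1.1
    · exact not_not.1 (h3 c).1.2
    · have h4 : ∑ i, ω.2.2.2 c i ^ 2 < (n : ℝ) ^ 12 := not_le.1 (h3 c).2
      rw [← sq_le_sq₀ (norm_nonneg _) (by positivity), EuclideanSpace.real_norm_sq_eq, ← pow_mul]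
      exact h4.le
  have hE := exp_neg_sqrt_le hn0
  set e := 128 ^ 20 * ((20).factorial : ℝ) / (n : ℝ) ^ 10 with he
  have hexp : Real.exp (-n) ≤ e := by
    refine le_trans (Real.exp_le_exp.2 (neg_le_neg ?_)) hE
    have : Real.sqrt n ≤ n := by
      rw [Real.sqrt_le_left (by linarith)]
      nlinarith
    linarith [Real.sqrt_nonneg n]
  have hd : ((n : ℝ) ^ 11)⁻¹ ≤ 1 / (n : ℝ) ^ 10 := by
    rw [← one_div]
    exact one_div_le_one_div_of_le (by positivity) (pow_le_pow_right₀ hnR (by norm_num))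
  have he0 : 0 ≤ e := by positivity
  have hd0 : (0 : ℝ) ≤ 1 / (n : ℝ) ^ 10 := by positivity
  have b1 : μ B1 ≤ ENNReal.ofReal (2 * e) :=
    (noise_coin_tri_tail n).trans (ENNReal.ofReal_le_ofReal (by linarith))
  have b2 : μ B2 ≤ ENNReal.ofReal (12 * e) :=
    (noise_coin_blockForm_tail hn0).trans (ENNReal.ofReal_le_ofReal (by linarith))
  have b3 : ∀ c, μ (B3 c) ≤ ENNReal.ofReal (4 * e) := fun c =>
    (noise_coin_mask_tail hn hv c).trans (ENNReal.ofReal_le_ofReal (by linarith))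
  have b4 : ∀ c, μ (B4 c) ≤ ENNReal.ofReal (1 / (n : ℝ) ^ 10) := fun c =>
    (noise_coin_start_tail hn0 τ v₀ c _).trans (ENNReal.ofReal_le_ofReal hd)
  have b5 : ∀ c, μ (B5 c) ≤ ENNReal.ofReal (1 / (n : ℝ) ^ 10) := fun c =>
    (noise_coin_norm_tail hn0 c).trans (ENNReal.ofReal_le_ofReal hd)
  have b6 : ∀ c, μ (B3 c ∪ B4 c ∪ B5 c) ≤ ENNReal.ofReal (4 * e + 2 * (1 / (n : ℝ) ^ 10)) :=
    fun c => by
    refine (measure_union_le _ _).trans ((add_le_add ((measure_union_le _ _).trans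
      (add_le_add (b3 c) (b4 c))) (b5 c)).trans (le_of_eq ?_))
    rw [← ENNReal.ofReal_add (by positivity) hd0, ← ENNReal.ofReal_add (by positivity) hd0]
    congr 1
    ring
  refine (measure_mono hsub).trans ((measure_union_le _ _).trans ((add_le_add
    ((measure_union_le _ _).trans (add_le_add b1 b2)) ((measure_iUnion_fintype_le _ _).trans
      (Finset.sum_le_sum fun c _ => b6 c))).trans (le_of_eq ?_)))
  rw [← ENNReal.ofReal_add (by positivity) (by positivity),
    ← ENNReal.ofReal_sum_of_nonneg (fun _ _ => by positivity),
    ← ENNReal.ofReal_add (by positivity) (Finset.sum_nonneg fun _ _ => by positivity)]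
  congr 1
  rw [Fin.sum_const, he]
  simp only [nsmul_eq_mul]
  push_cast
  ring

lemma norm_recover_le (T : Tensor n) (k : ℕ) (ρ : Coins n) : ‖recover T k ρ‖ ≤ 1 :=
  norm_normalized_le _

/-- The algorithm recovers the signal with high probability. -/
theorem exists_recovery_const :
    ∃ C₀ : ℝ, 0 < C₀ ∧ ∀ C : ℝ, C₀ ≤ C → ∀ n : ℕ, 2 ≤ n → ∀ ε : ℝ,
      Real.log n / Real.sqrt n ≤ ε → ∀ τ : ℝ, (n : ℝ) ^ (3 / 4 : ℝ) / ε ≤ τ →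
        ∀ v₀ : EuclideanSpace ℝ (Fin n), ‖v₀‖ = 1 →
          ((noiseLaw n).prod (coinLaw n)) {ω | ¬ ∀ k : ℕ, 18 * Real.log n ≤ k →
            (∀ (a : Fin 3) (w : EuclideanSpace ℝ (Fin n)),
              IsTopSingularVector (blockMatrix (spikedTensor τ v₀ ω.1) ω.2.1 ω.2.2.1 a) w →
              ∃ s : ℝ, (s = 1 ∨ s = -1) ∧
                ‖iterate (spikedTensor τ v₀ ω.1) ω.2 k a - s • w‖ ≤ C * ε) ∧
            1 - C * ε ≤ inner ℝ (recover (spikedTensor τ v₀ ω.1) k ω.2) v₀} ≤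
          ENNReal.ofReal (C / (n : ℝ) ^ 10) := by
  refine ⟨26 * (128 ^ 20 * (20).factorial) + 6 + 12 ^ 40 + 10 ^ 9, by positivity, ?_⟩
  intro C hC n hn ε hε τ hτ v₀ hv
  have hf : (0 : ℝ) < (20).factorial := by exact_mod_cast Nat.factorial_pos 20
  have hCa : 26 * (128 ^ 20 * ((20).factorial : ℝ)) + 6 ≤ C :=
    le_trans (by norm_num : _ ≤ _) hC
  have hCb : (12 : ℝ) ^ 40 ≤ C := by
    have : (0 : ℝ) ≤ 26 * (128 ^ 20 * ((20).factorial : ℝ)) + 6 := by positivity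
    linarith
  have hCc : (10 : ℝ) ^ 9 ≤ C := by
    have : (0 : ℝ) ≤ 26 * (128 ^ 20 * ((20).factorial : ℝ)) + 6 := by positivity
    linarith
  have hn0 : (0 : ℝ) < n := by exact_mod_cast (by omega : 0 < n)
  -- For small `n` the probability bound exceeds one, since `C ≥ 12 ^ 40 = (12 ^ 4) ^ 10`.
  by_cases hn4 : 12 ^ 4 ≤ n
  swap
  · refine prob_le_one.trans ?_
    rw [← ENNReal.ofReal_one]
    apply ENNReal.ofReal_le_ofReal
    rw [one_le_div (by positivity)]
    have h1 : (n : ℝ) ≤ 12 ^ 4 := by exact_mod_cast (not_le.1 hn4).le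
    have h2 := pow_le_pow_left₀ hn0.le h1 10
    linarith
  -- For large `ε` both claims are trivial: all vectors have norm at most one and `C * ε ≥ 2`.
  by_cases hε1 : ε ≤ 1 / 10 ^ 8
  swap
  · have h2 : 2 ≤ C * ε := by
      have := mul_le_mul hCc (not_le.1 hε1).le (by norm_num) (by linarith)
      linarith
    refine le_trans (le_of_eq ?_) (zero_le)
    convert measure_empty (μ := (noiseLaw n).prod (coinLaw n))
    rw [Set.eq_empty_iff_forall_notMem]
    intro ω hω
    refine hω fun k _ => ⟨fun a w hw => ⟨1, Or.inl rfl, ?_⟩, ?_⟩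
    · have h3 := norm_sub_le (iterate (spikedTensor τ v₀ ω.1) ω.2 k a) ((1 : ℝ) • w)
      have h4 : ‖iterate (spikedTensor τ v₀ ω.1) ω.2 k a‖ ≤ 1 := norm_powerIterate_le _ _ _
      rw [one_smul, hw.1] at h3
      rw [one_smul]
      linarith
    · have h3 := (abs_le.1 (abs_real_inner_le_norm (recover (spikedTensor τ v₀ ω.1) k ω.2) v₀)).1
      rw [hv, mul_one] at h3
      have h4 := norm_recover_le (spikedTensor τ v₀ ω.1) k ω.2
      linarith
  have hε0 : 0 ≤ ε := le_trans (div_nonneg (Real.log_natCast_nonneg n) (Real.sqrt_nonneg _)) hε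
  refine (measure_mono fun ω hω => ?_).trans ((noise_coin_not_isGood_le hn4 τ hv).trans
    (ENNReal.ofReal_le_ofReal (div_le_div_of_nonneg_right hCa (by positivity))))
  intro hgood
  refine hω fun k hk => ?_
  obtain ⟨h1, h2⟩ := hgood.recovery hn4 hε hε1 hτ hv hk
  have h3 : 3000000 * ε ≤ C * ε := mul_le_mul_of_nonneg_right (by linarith) hε0
  refine ⟨fun a w hw => ?_, by linarith⟩
  obtain ⟨s, hs, h4⟩ := h1 a w hw
  exact ⟨s, hs, h4.trans h3⟩

end SpikedTensor

namespace RealMachine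

/-! ### Running time -/

/-- A bound for the evaluation time in terms of bounds for the index variables. -/
def Expr.cost : Expr → Env → ℕ
  | .num _, _ => 1
  | .idx _, _ => 1
  | .load _ _ _ _, _ => 1
  | .add x y, B => x.cost B + y.cost B + 1
  | .sub x y, B => x.cost B + y.cost B + 1
  | .mul x y, B => x.cost B + y.cost B + 1
  | .div x y, B => x.cost B + y.cost B + 1
  | .sqrt x, B => x.cost B + 1
  | .ifLe x y s t, B => x.cost B + y.cost B + (s.cost B + t.cost B) + 1
  | .sum i b x, B => B b * (x.cost (Function.update B i (B b)) + 1) + 1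

/-- A bound for the running time in terms of bounds for the index variables. -/
def Program.cost : Program → Env → ℕ
  | .store _ _ _ _ x, B => x.cost B + 1
  | .seq p q, B => p.cost B + q.cost B + 1
  | .loop i b p, B => B b * (p.cost (Function.update B i (B b)) + 1) + 1

lemma update_le_update {e B : Env} (h : ∀ i, e i ≤ B i) {b l : ℕ} (hl : l < e b) (i : ℕ) :
    ∀ j, Function.update e i l j ≤ Function.update B i (B b) j := fun j => by
  rcases eq_or_ne j i with rfl | hj
  · simpa using (hl.le.trans (h b))
  · simpa [hj] using h j

lemma Expr.time_le (x : Expr) (m : Mem) {e B : Env} (h : ∀ i, e i ≤ B i) :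
    x.time m e ≤ x.cost B := by
  induction x generalizing e B with
  | num | idx | load => simp [Expr.time, Expr.cost]
  | add x y hx hy | sub x y hx hy | mul x y hx hy | div x y hx hy =>
    simp only [Expr.time, Expr.cost]
    have := hx h
    have := hy h
    omega
  | sqrt x hx =>
    simp only [Expr.time, Expr.cost]
    have := hx h
    omega
  | ifLe x y s t hx hy hs ht =>
    simp only [Expr.time, Expr.cost]
    have := hx h
    have := hy h
    have := hs h
    have := ht h
    split_ifs <;> omega
  | sum i b x hx =>
    simp only [Expr.time, Expr.cost]
    have h1 : ∑ l ∈ Finset.range (e b), (x.time m (Function.update e i l) + 1) ≤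
        ∑ _l ∈ Finset.range (e b), (x.cost (Function.update B i (B b)) + 1) :=
      Finset.sum_le_sum fun l hl =>
        Nat.add_le_add_right (hx (update_le_update h (Finset.mem_range.1 hl) i)) 1
    rw [Finset.sum_const, Finset.card_range, smul_eq_mul] at h1
    exact Nat.add_le_add_right (h1.trans (Nat.mul_le_mul_right _ (h b))) 1

lemma iterateBody_time_le {body : ℕ → Mem → Mem × ℕ} {c N : ℕ}
    (h : ∀ l < N, ∀ m, (body l m).2 ≤ c) (m : Mem) :
    (iterateBody body m N).2 ≤ N * (c + 1) + 1 := by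
  induction N with
  | zero => simp [iterateBody]
  | succ N ih =>
    have h1 := ih fun l hl => h l (Nat.lt_succ_of_lt hl)
    have h2 := h N (Nat.lt_succ_self N) (iterateBody body m N).1
    simp only [iterateBody]
    rw [Nat.succ_mul]
    omega

lemma Program.exec_time_le (p : Program) {e B : Env} (h : ∀ i, e i ≤ B i) (m : Mem) :
    (p.exec e m).2 ≤ p.cost B := by
  induction p generalizing e B m with
  | store b i j k x =>
    simp only [Program.exec, Program.cost]
    exact Nat.add_le_add_right (x.time_le m h) 1
  | seq p q hp hq =>
    simp only [Program.exec, Program.cost]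
    have := hp h m
    have := hq h (p.exec e m).1
    omega
  | loop i b p hp =>
    simp only [Program.exec, Program.cost]
    refine (iterateBody_time_le (c := p.cost (Function.update B i (B b)))
      (fun l hl m' => hp (update_le_update h hl i) m') m).trans ?_
    exact Nat.add_le_add_right (Nat.mul_le_mul_right _ (h b)) 1

/-! ### Loops that fill arrays -/

/-- The expression does not read the array `b`. -/
def Expr.Avoids (b : ℕ) : Expr → Prop
  | .num _ => True
  | .idx _ => True
  | .load b' _ _ _ => b' ≠ b
  | .add x y => x.Avoids b ∧ y.Avoids b
  | .sub x y => x.Avoids b ∧ y.Avoids b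
  | .mul x y => x.Avoids b ∧ y.Avoids b
  | .div x y => x.Avoids b ∧ y.Avoids b
  | .sqrt x => x.Avoids b
  | .ifLe x y s t => x.Avoids b ∧ y.Avoids b ∧ s.Avoids b ∧ t.Avoids b
  | .sum _ _ x => x.Avoids b

lemma Expr.eval_congr {x : Expr} {b : ℕ} (hx : x.Avoids b) {m m' : Mem}
    (h : ∀ b', b' ≠ b → m' b' = m b') (e : Env) : x.eval m' e = x.eval m e := by
  induction x generalizing e with
  | num | idx => rfl
  | load b' i j k => simp only [Expr.eval, h b' hx]
  | add x y ihx ihy | sub x y ihx ihy | mul x y ihx ihy | div x y ihx ihy =>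
    simp only [Expr.eval, ihx hx.1, ihy hx.2]
  | sqrt x ihx => simp only [Expr.eval, ihx hx]
  | ifLe x y s t ihx ihy ihs iht =>
    simp only [Expr.eval, ihx hx.1, ihy hx.2.1, ihs hx.2.2.1, iht hx.2.2.2]
  | sum i b' x ihx => simp only [Expr.eval, ihx hx]

lemma iterateBody_induction {body : ℕ → Mem → Mem × ℕ} {m : Mem} {N : ℕ} {P : ℕ → Mem → Prop}
    (h0 : P 0 m) (hs : ∀ l < N, ∀ m', P l m' → P (l + 1) (body l m').1) :
    P N (iterateBody body m N).1 := by
  induction N with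
  | zero => exact h0
  | succ N ih =>
    exact hs N (Nat.lt_succ_self N) _ (ih fun l hl => hs l (Nat.lt_succ_of_lt hl))

lemma exec_seq_fst (p q : Program) (e : Env) (m : Mem) :
    ((Program.seq p q).exec e m).1 = (q.exec e (p.exec e m).1).1 := rfl

/-- Store the value of `x` in the cell `0` of the array `b`; index variable `9` stands for `0`. -/
def cellP (b : ℕ) (x : Expr) : Program := .store b 9 9 9 x

/-- Fill the array `b` with a vector; the index is variable `2`. -/
def vecP (b : ℕ) (x : Expr) : Program := .loop 2 0 (.store b 2 9 9 x)

/-- Fill one row of the array `b`; the column is variable `3`. -/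
def rowP (b : ℕ) (x : Expr) : Program := .loop 3 0 (.store b 2 3 9 x)

/-- Fill the array `b` with a matrix; the indices are the variables `2` and `3`. -/
def matP (b : ℕ) (x : Expr) : Program := .loop 2 0 (rowP b x)

/-- The array holds the given number in its cell `0`. -/
def IsCell (A : ℕ → ℕ → ℕ → ℝ) (c : ℝ) : Prop := A 0 0 0 = c

/-- The array holds the given vector. -/
def IsVec {n : ℕ} (A : ℕ → ℕ → ℕ → ℝ) (x : Fin n → ℝ) : Prop := ∀ i : Fin n, A i 0 0 = x i

/-- The array holds the given matrix. -/
def IsMat {n : ℕ} (A : ℕ → ℕ → ℕ → ℝ) (Q : Fin n → Fin n → ℝ) : Prop :=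
  ∀ i j : Fin n, A i j 0 = Q i j

section Spec

variable {n : ℕ} {e : Env} {m : Mem} {b : ℕ} {x : Expr}

lemma cellP_spec (h9 : e 9 = 0) {c : ℝ} (hc : x.eval m e = c) :
    IsCell (((cellP b x).exec e m).1 b) c ∧ ∀ b', b' ≠ b → ((cellP b x).exec e m).1 b' = m b' := by
  refine ⟨by simp [cellP, Program.exec, IsCell, h9, hc], fun b' hb => ?_⟩
  ext i j k
  simp [cellP, Program.exec, hb]

/-- A loop that fills an initial segment of a vector. -/
lemma loop_store_spec (h9 : e 9 = 0) {i N : ℕ} (hi : i ≠ 9) (hx : x.Avoids b) :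
    (∀ l < e N, ((Program.loop i N (.store b i 9 9 x)).exec e m).1 b l 0 0 =
      x.eval m (Function.update e i l)) ∧
    ∀ b', b' ≠ b → ((Program.loop i N (.store b i 9 9 x)).exec e m).1 b' = m b' := by
  -- Loop invariant: the first `L` cells are filled and the other arrays are untouched. As `x` does
  -- not read `b`, it still has the value it had in the initial memory.
  refine iterateBody_induction (P := fun L m' => (∀ l < L, m' b l 0 0 =
    x.eval m (Function.update e i l)) ∧ ∀ b', b' ≠ b → m' b' = m b') ⟨by simp, fun _ _ => rfl⟩ ?_
  intro l _ m' ⟨h1, h2⟩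
  have h9' : Function.update e i l 9 = 0 := by
    rw [Function.update_of_ne (Ne.symm hi), h9]
  refine ⟨fun l' hl' => ?_, fun b' hb' => ?_⟩
  · simp only [Program.exec, h9', Function.update_self, and_true, true_and]
    rcases eq_or_ne l' l with rfl | hne
    · rw [if_pos rfl, Expr.eval_congr hx h2]
    · rw [if_neg hne]
      exact h1 l' (by omega)
  · rw [← h2 b' hb']
    ext
    simp [Program.exec, hb']

lemma vecP_spec (h0 : e 0 = n) (h9 : e 9 = 0) (hx : x.Avoids b) {f : Fin n → ℝ}
    (hf : ∀ i : Fin n, x.eval m (Function.update e 2 i) = f i) :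
    IsVec (((vecP b x).exec e m).1 b) f ∧ ∀ b', b' ≠ b → ((vecP b x).exec e m).1 b' = m b' := by
  obtain ⟨h1, h2⟩ := loop_store_spec (m := m) (i := 2) (N := 0) h9 (by norm_num) hx
  exact ⟨fun i => (h1 i (by rw [h0]; exact i.2)).trans (hf i), h2⟩

lemma rowP_spec (h0 : e 0 = n) (h9 : e 9 = 0) (hx : x.Avoids b) :
    (∀ j < n, ((rowP b x).exec e m).1 b (e 2) j 0 = x.eval m (Function.update e 3 j)) ∧
    (∀ i, i ≠ e 2 → ((rowP b x).exec e m).1 b i = m b i) ∧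
    ∀ b', b' ≠ b → ((rowP b x).exec e m).1 b' = m b' := by
  rw [← h0]
  refine iterateBody_induction (P := fun L m' => (∀ j < L, m' b (e 2) j 0 =
    x.eval m (Function.update e 3 j)) ∧ (∀ i, i ≠ e 2 → m' b i = m b i) ∧
      ∀ b', b' ≠ b → m' b' = m b') ⟨by simp, fun _ _ => rfl, fun _ _ => rfl⟩ ?_
  intro l _ m' ⟨h1, h2, h3⟩
  have h9' : Function.update e 3 l 9 = 0 := by rw [Function.update_of_ne (by norm_num), h9]
  have h2' : Function.update e 3 l 2 = e 2 := by rw [Function.update_of_ne (by norm_num)]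
  refine ⟨fun j hj => ?_, fun i hi => ?_, fun b' hb' => ?_⟩
  · simp only [Program.exec, h9', h2', Function.update_self, and_true, true_and]
    rcases eq_or_ne j l with rfl | hne
    · rw [if_pos rfl, Expr.eval_congr hx h3]
    · rw [if_neg hne]
      exact h1 j (by omega)
  · rw [← h2 i hi]
    ext
    simp [Program.exec, hi]
  · rw [← h3 b' hb']
    ext
    simp [Program.exec, hb']

lemma matP_spec (h0 : e 0 = n) (h9 : e 9 = 0) (hx : x.Avoids b) {Q : Fin n → Fin n → ℝ}
    (hf : ∀ i j : Fin n, x.eval m (Function.update (Function.update e 2 i) 3 j) = Q i j) :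
    IsMat (((matP b x).exec e m).1 b) Q ∧ ∀ b', b' ≠ b → ((matP b x).exec e m).1 b' = m b' := by
  have h := iterateBody_induction (m := m) (N := e 0)
    (body := fun l m' => (rowP b x).exec (Function.update e 2 l) m')
    (P := fun L m' => (∀ i < L, ∀ j < n, m' b i j 0 =
      x.eval m (Function.update (Function.update e 2 i) 3 j)) ∧ ∀ b', b' ≠ b → m' b' = m b')
    ⟨by simp, fun _ _ => rfl⟩ (fun l hl m' ⟨h1, h2⟩ => by
      have h0' : Function.update e 2 l 0 = n := by rw [Function.update_of_ne (by norm_num), h0]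
      have h9' : Function.update e 2 l 9 = 0 := by rw [Function.update_of_ne (by norm_num), h9]
      obtain ⟨r1, r2, r3⟩ := rowP_spec (m := m') h0' h9' hx
      rw [Function.update_self] at r1 r2
      refine ⟨fun i hi j hj => ?_, fun b' hb' => (r3 b' hb').trans (h2 b' hb')⟩
      rcases eq_or_ne i l with rfl | hne
      · rw [r1 j hj, Expr.eval_congr hx h2]
      · rw [r2 i hne]
        exact h1 i (by omega) j hj)
  exact ⟨fun i j => (h.1 i (by rw [h0]; exact i.2) j j.2).trans (hf i j), h.2⟩

end Spec

end RealMachine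

namespace SpikedTensor

variable {n : ℕ}

/-! ### Gram–Schmidt orthogonalization of the rows of a matrix -/

/-- The matrix whose rows are the normalized Gram–Schmidt vectors of the rows of `G`. -/
def gsMat (G : Matrix (Fin n) (Fin n) ℝ) : Matrix (Fin n) (Fin n) ℝ := fun i j =>
  InnerProductSpace.gramSchmidtNormed ℝ
    (fun i => (WithLp.toLp 2 (G i) : EuclideanSpace ℝ (Fin n))) i j

/-- The Gram–Schmidt vectors before normalization. -/
def gsRaw (G : Matrix (Fin n) (Fin n) ℝ) (i j : Fin n) : ℝ :=
  G i j - ∑ l ∈ Finset.Iio i, (∑ m, gsMat G l m * G i m) * gsMat G l j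

lemma gsRaw_eq (G : Matrix (Fin n) (Fin n) ℝ) (i j : Fin n) :
    gsRaw G i j = InnerProductSpace.gramSchmidt ℝ
      (fun i => (WithLp.toLp 2 (G i) : EuclideanSpace ℝ (Fin n))) i j := by
  rw [InnerProductSpace.gramSchmidt_def, PiLp.sub_apply, gsRaw]
  congr 1
  rw [WithLp.ofLp_sum, Finset.sum_apply]
  refine Finset.sum_congr rfl fun l _ => ?_
  rw [Submodule.starProjection_singleton]
  simp only [gsMat, InnerProductSpace.gramSchmidtNormed, PiLp.smul_apply, smul_eq_mul,
    RCLike.ofReal_real_eq_id, id_eq]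
  set f := InnerProductSpace.gramSchmidt ℝ
    (fun i => (WithLp.toLp 2 (G i) : EuclideanSpace ℝ (Fin n))) l
  have e : ∑ m, ‖f‖⁻¹ * f m * G i m = ‖f‖⁻¹ * inner ℝ f (WithLp.toLp 2 (G i)) := by
    rw [inner_eq_dotProduct, dotProduct, Finset.mul_sum]
    exact Finset.sum_congr rfl fun m _ => by ring
  rw [e, div_eq_mul_inv, sq, mul_inv]
  ring

lemma gsMat_eq (G : Matrix (Fin n) (Fin n) ℝ) (i j : Fin n) :
    gsMat G i j = gsRaw G i j / Real.sqrt (∑ m, gsRaw G i m * gsRaw G i m) := by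
  simp only [gsRaw_eq, gsMat, InnerProductSpace.gramSchmidtNormed, PiLp.smul_apply, smul_eq_mul,
    RCLike.ofReal_real_eq_id, id_eq, EuclideanSpace.norm_eq, Real.norm_eq_abs, sq_abs, ← sq]
  rw [div_eq_inv_mul]

lemma sum_mul_vecMul {S : Matrix (Fin n) (Fin n) ℝ} (hS : S * Sᵀ = 1) (u v : Fin n → ℝ) :
    ∑ m, (u ᵥ* S) m * (v ᵥ* S) m = ∑ m, u m * v m := by
  change (u ᵥ* S) ⬝ᵥ (v ᵥ* S) = u ⬝ᵥ v
  rw [← Matrix.dotProduct_mulVec, ← Matrix.mulVec_transpose, Matrix.mulVec_mulVec, hS,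
    Matrix.one_mulVec]

/-- Right multiplication by an orthogonal matrix preserves the inner products of rows, so
Gram–Schmidt commutes with it; singular `G` are included, since a zero vector is normalized to zero.
This is the source of the invariance of the sampled rotation. -/
lemma gsMat_mul {S : Matrix (Fin n) (Fin n) ℝ} (hS : S * Sᵀ = 1) (G : Matrix (Fin n) (Fin n) ℝ) :
    gsMat (G * S) = gsMat G * S := by
  have key : ∀ i, gsMat (G * S) i = gsMat G i ᵥ* S := by
    intro i
    induction i using WellFoundedLT.induction with
    | ind i ih =>
      have hraw : gsRaw (G * S) i = gsRaw G i ᵥ* S := by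
        ext j
        have e1 : gsRaw G i = G i - ∑ l ∈ Finset.Iio i, (∑ m, gsMat G l m * G i m) • gsMat G l := by
          ext j
          simp [gsRaw, Finset.sum_apply]
        rw [e1, Matrix.sub_vecMul, Matrix.sum_vecMul, gsRaw, Pi.sub_apply, Finset.sum_apply]
        congr 1
        refine Finset.sum_congr rfl fun l hl => ?_
        rw [ih l (Finset.mem_Iio.1 hl), Matrix.smul_vecMul, Pi.smul_apply, smul_eq_mul]
        congr 1
        exact sum_mul_vecMul hS _ _
      ext j
      rw [gsMat_eq, hraw, sum_mul_vecMul hS]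
      have e2 : gsMat G i = (Real.sqrt (∑ m, gsRaw G i m * gsRaw G i m))⁻¹ • gsRaw G i := by
        ext j
        rw [gsMat_eq, div_eq_inv_mul]; rfl
      rw [e2, Matrix.smul_vecMul, Pi.smul_apply, smul_eq_mul, div_eq_inv_mul]
  ext i j
  rw [key i]
  rfl

lemma measurable_gsMat {Ω : Type*} [MeasurableSpace Ω] {G : Ω → Matrix (Fin n) (Fin n) ℝ}
    (hG : ∀ i j, Measurable fun ω => G ω i j) (i j : Fin n) :
    Measurable fun ω => gsMat (G ω) i j := by
  induction i using WellFoundedLT.induction generalizing j with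
  | ind i ih =>
    have hraw : ∀ j, Measurable fun ω => gsRaw (G ω) i j := fun j => by
      simp only [gsRaw]
      exact (hG i j).sub (Finset.measurable_sum _ fun l hl =>
        (Finset.measurable_sum _ fun m _ => (ih l (Finset.mem_Iio.1 hl) m).mul (hG i m)).mul
          (ih l (Finset.mem_Iio.1 hl) j))
    simp only [gsMat_eq]
    exact (hraw j).div (Finset.measurable_sum _ fun m _ => (hraw m).mul (hraw m)).sqrt

end SpikedTensor

namespace SpikedTensor

variable {n : ℕ}

/-! ### The power step in factored form -/

/-- The algorithm with a general matrix in place of the rotation. -/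
def recoverMat (T : Tensor n) (Q : Matrix (Fin n) (Fin n) ℝ) (σ : Equiv.Perm (Fin n))
    (g : Fin 3 → Fin n → ℝ) (k : ℕ) : EuclideanSpace ℝ (Fin n) :=
  normalized (Matrix.toEuclideanLin Qᵀ
    (∑ a : Fin 3, fixSign (rotMat T Q) (powerIterate (blockMat T Q σ a) (g a) k)))

lemma recover_eq (T : Tensor n) (k : ℕ) (ρ : Coins n) :
    recover T k ρ = recoverMat T ρ.1.1 ρ.2.1 ρ.2.2 k := rfl

lemma mask_eq_mul (σ : Equiv.Perm (Fin n)) (c : Fin 3) (x : Fin n → ℝ) (i : Fin n) :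
    mask σ c x i = mask σ c 1 i * x i := by simp [mask]

lemma sum_mul_eq_tri (T : Tensor n) (u v w : Fin n → ℝ) :
    ∑ j, (∑ i, u i * ∑ k, T i j k * w k) * v j = tri T u v w := by
  simp only [tri, Finset.mul_sum, Finset.sum_mul]
  rw [Finset.sum_comm]
  exact Finset.sum_congr rfl fun _ _ => Finset.sum_congr rfl fun _ _ =>
    Finset.sum_congr rfl fun _ _ => by ring

/-- Only the order of a fivefold sum changes: on the left one index is eliminated at a time, on the
right the trilinear form appears. -/
lemma sum_contraction (T : Tensor n) (Q W : Matrix (Fin n) (Fin n) ℝ) (q : Fin n → ℝ) :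
    ∑ m, q m * ∑ j, ∑ l, T j l m * ∑ b, (∑ a, Q a j * W a b) * Q b l =
      ∑ a, ∑ b, W a b * tri T (Q a) (Q b) q := by
  have h1 : ∑ m, q m * ∑ j, ∑ l, T j l m * ∑ b, (∑ a, Q a j * W a b) * Q b l =
      ∑ m, ∑ j, ∑ l, ∑ b, ∑ a, W a b * (T j l m * (Q a j * Q b l * q m)) := by
    simp only [Finset.mul_sum, Finset.sum_mul]
    exact Finset.sum_congr rfl fun _ _ => Finset.sum_congr rfl fun _ _ =>
      Finset.sum_congr rfl fun _ _ => Finset.sum_congr rfl fun _ _ =>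
        Finset.sum_congr rfl fun _ _ => by ring
  have h2 : ∑ a, ∑ b, W a b * tri T (Q a) (Q b) q =
      ∑ a, ∑ b, ∑ j, ∑ l, ∑ m, W a b * (T j l m * (Q a j * Q b l * q m)) := by
    simp only [tri, Finset.mul_sum]
  rw [h1, h2]
  let F : (Fin n × Fin n × Fin n × Fin n × Fin n) → ℝ := fun p =>
    W p.1 p.2.1 * (T p.2.2.1 p.2.2.2.1 p.2.2.2.2 *
      (Q p.1 p.2.2.1 * Q p.2.1 p.2.2.2.1 * q p.2.2.2.2))
  let e : (Fin n × Fin n × Fin n × Fin n × Fin n) ≃ (Fin n × Fin n × Fin n × Fin n × Fin n) :=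
    ⟨fun p => (p.2.2.2.2, p.2.2.2.1, p.2.1, p.2.2.1, p.1),
      fun p => (p.2.2.2.2, p.2.2.1, p.2.2.2.1, p.2.1, p.1), fun _ => rfl, fun _ => rfl⟩
  have h3 := Equiv.sum_comp e F
  simp only [Fintype.sum_prod_type] at h3
  exact h3

/-- One multiplication by the block matrix, in the order in which the program computes it. -/
lemma blockMat_mulVec_apply (T : Tensor n) (Q : Matrix (Fin n) (Fin n) ℝ)
    (σ : Equiv.Perm (Fin n)) (a : Fin 3) (x : Fin n → ℝ) (i : Fin n) :
    mask σ a 1 i * (∑ m, Q i m * ∑ j, ∑ l, T j l m * ∑ d, (∑ c, Q c j *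
        (mask σ (a + 1) 1 c * mask σ (a + 2) 1 d *
          ∑ l, (∑ j, Q c j * ∑ k, T j l k * ∑ i, Q i k * (mask σ a 1 i * x i)) * Q d l)) * Q d l) -
      (n : ℝ) * n / 9 * (mask σ a 1 i * x i) = (blockMat T Q σ a *ᵥ x) i := by
  -- The innermost sum is the masked vector rotated back. The next three contractions give the
  -- matrix of the values `tri T (Q c) (Q d) _`, which is masked to `Y × Z` and then passed through
  -- the transposed contractions. Each stage costs at most `O(n³)`.
  have hy : ∀ k, ∑ i, Q i k * (mask σ a 1 i * x i) = (Qᵀ *ᵥ mask σ a x) k := fun k => by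
    simp only [Matrix.mulVec, dotProduct, Matrix.transpose_apply]
    exact Finset.sum_congr rfl fun l _ => by rw [mask_eq_mul σ a x l]
  simp only [hy, sum_mul_eq_tri]
  rw [sum_contraction T Q (fun c d => mask σ (a + 1) 1 c * mask σ (a + 2) 1 d *
    tri T (Q c) (Q d) (Qᵀ *ᵥ mask σ a x)) (Q i)]
  have h1 : (blockMat T Q σ a *ᵥ x) i = blockForm T Q σ a (Pi.single i 1) x := by
    rw [← dotProduct_blockMat, single_one_dotProduct]
  have hs : mask σ a (Pi.single i 1) = mask σ a 1 i • Pi.single i (1 : ℝ) := by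
    ext l
    rw [mask_eq_mul, Pi.smul_apply, smul_eq_mul]
    rcases eq_or_ne l i with rfl | h
    · rfl
    · simp [h]
  have hrow : Qᵀ *ᵥ Pi.single i (1 : ℝ) = Q i := by
    ext j; simp
  have hmm : mask σ a 1 i * mask σ a 1 i = mask σ a 1 i := by
    simp only [mask]; split_ifs <;> simp
  rw [h1, blockForm, hs, Matrix.mulVec_smul, hrow]
  simp only [tri_smul_right]
  congr 1
  · simp only [Finset.mul_sum]
    exact Finset.sum_congr rfl fun _ _ => Finset.sum_congr rfl fun _ _ => by ring
  · have : ∑ l, (mask σ a 1 i • Pi.single i (1 : ℝ)) l * mask σ a x l = mask σ a 1 i * x i := by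
      rw [Finset.sum_eq_single i]
      · rw [Pi.smul_apply, Pi.single_eq_same, smul_eq_mul, mul_one, mask_eq_mul σ a x,
          ← mul_assoc, hmm]
      · intro l _ hl
        simp [hl]
      · simp
    rw [this]
    ring

end SpikedTensor

namespace RealMachine

open SpikedTensor

variable {n : ℕ} {e : Env}

/-- The array holds the given tensor. -/
def IsTen {n : ℕ} (A : ℕ → ℕ → ℕ → ℝ) (T : Tensor n) : Prop := ∀ i j k : Fin n, A i j k = T i j k

/-- Composition rule in continuation form: the rest of the program is verified for an arbitrary
memory with the recorded contents, so the executed prefix never appears in later goals. -/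
lemma vecP_seq (h0 : e 0 = n) (h9 : e 9 = 0) {m : Mem} {b : ℕ} {x : Expr} (hx : x.Avoids b)
    (f : Fin n → ℝ) (hf : ∀ i : Fin n, x.eval m (Function.update e 2 i) = f i) {q : Program}
    {P : Mem → Prop}
    (h : ∀ m' : Mem, IsVec (m' b) f → (∀ b', b' ≠ b → m' b' = m b') → P (q.exec e m').1) :
    P ((Program.seq (vecP b x) q).exec e m).1 :=
  h _ (vecP_spec h0 h9 hx hf).1 (vecP_spec h0 h9 hx hf).2

lemma matP_seq (h0 : e 0 = n) (h9 : e 9 = 0) {m : Mem} {b : ℕ} {x : Expr} (hx : x.Avoids b)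
    (f : Fin n → Fin n → ℝ)
    (hf : ∀ i j : Fin n, x.eval m (Function.update (Function.update e 2 i) 3 j) = f i j)
    {q : Program} {P : Mem → Prop}
    (h : ∀ m' : Mem, IsMat (m' b) f → (∀ b', b' ≠ b → m' b' = m b') → P (q.exec e m').1) :
    P ((Program.seq (matP b x) q).exec e m).1 :=
  h _ (matP_spec h0 h9 hx hf).1 (matP_spec h0 h9 hx hf).2

lemma cellP_seq (h9 : e 9 = 0) {m : Mem} {b : ℕ} {x : Expr} {c : ℝ} (hc : x.eval m e = c)
    {q : Program} {P : Mem → Prop}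
    (h : ∀ m' : Mem, IsCell (m' b) c → (∀ b', b' ≠ b → m' b' = m b') → P (q.exec e m').1) :
    P ((Program.seq (cellP b x) q).exec e m).1 :=
  h _ (cellP_spec h9 hc).1 (cellP_spec h9 hc).2

/-! ### Programs -/

/-- Store the normalization of the vector in array `b` in the array `b'`. -/
def normP (b b' : ℕ) : Program :=
  .seq (cellP 11 (.sqrt (.sum 4 0 (.mul (.load b 4 9 9) (.load b 4 9 9)))))
    (vecP b' (.div (.load b 2 9 9) (.load 11 9 9 9)))

lemma normP_spec (h0 : e 0 = n) (h9 : e 9 = 0) {m : Mem} {b b' : ℕ} (hb : b ≠ 11)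
    (hbb : b ≠ b') (hb' : b' ≠ 11) {x : EuclideanSpace ℝ (Fin n)} (hx : IsVec (m b) x) :
    IsVec (((normP b b').exec e m).1 b') (normalized x) ∧
      ∀ c, c ≠ 11 → c ≠ b' → ((normP b b').exec e m).1 c = m c := by
  refine cellP_seq (P := fun m' => IsVec (m' b') (normalized x) ∧
    ∀ c, c ≠ 11 → c ≠ b' → m' c = m c) h9 (c := ‖x‖) ?_ fun m1 h11 o1 => ?_
  · simp only [Expr.eval, h0, Finset.sum_range, Function.update_self, ne_eq,
      show ¬ (9 : ℕ) = 4 by norm_num, not_false_eq_true, Function.update_of_ne, h9]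
    rw [EuclideanSpace.norm_eq]
    congr 1
    exact Finset.sum_congr rfl fun i _ => by rw [hx i, Real.norm_eq_abs, sq_abs, sq]
  · have h := vecP_spec (m := m1) (b := b') (x := .div (.load b 2 9 9) (.load 11 9 9 9))
      (f := normalized x) h0 h9 ⟨hbb, hb'.symm⟩ (fun i => by
        simp only [Expr.eval, Function.update_self, ne_eq, show ¬ (9 : ℕ) = 2 by norm_num,
          not_false_eq_true, Function.update_of_ne, h9]
        rw [h11, o1 b hb, hx i, div_eq_inv_mul]
        rfl)
    exact ⟨h.1, fun c hc hc' => (h.2 c hc').trans (o1 c hc)⟩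

/-- One step of the power method for part `a`; the iterate is in array `10`. -/
def stepP (a : Fin 3) : Program :=
  .seq (vecP 12 (.sum 4 0 (.mul (.load 3 4 2 9) (.mul (.load (20 + a) 4 9 9) (.load 10 4 9 9)))))
  (.seq (matP 13 (.sum 4 0 (.mul (.load 0 2 3 4) (.load 12 4 9 9))))
  (.seq (matP 14 (.sum 4 0 (.mul (.load 3 2 4 9) (.load 13 4 3 9))))
  (.seq (matP 15 (.mul (.mul (.load (20 + (a + 1 : Fin 3)) 2 9 9) (.load (20 + (a + 2 : Fin 3)) 3 9 9))
    (.sum 4 0 (.mul (.load 14 2 4 9) (.load 3 3 4 9)))))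
  (.seq (matP 16 (.sum 4 0 (.mul (.load 3 4 2 9) (.load 15 4 3 9))))
  (.seq (matP 17 (.sum 4 0 (.mul (.load 16 2 4 9) (.load 3 4 3 9))))
  (.seq (vecP 18 (.sum 4 0 (.sum 5 0 (.mul (.load 0 4 5 2) (.load 17 4 5 9)))))
  (.seq (vecP 19 (.sub (.mul (.load (20 + a) 2 9 9)
      (.sum 4 0 (.mul (.load 3 2 4 9) (.load 18 4 9 9))))
    (.mul (.div (.mul (.idx 0) (.idx 0)) (.num 9)) (.mul (.load (20 + a) 2 9 9) (.load 10 2 9 9)))))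
  (normP 19 10))))))))

/-- The arrays with the input tensor, the rotation and the parts. -/
structure IsReady (m : Mem) (T : Tensor n) (Q : Matrix (Fin n) (Fin n) ℝ)
    (σ : Equiv.Perm (Fin n)) : Prop where
  ten : IsTen (m 0) T
  mat : IsMat (m 3) Q
  parts : ∀ c : Fin 3, IsVec (m (20 + c)) (mask σ c 1)

lemma IsReady.congr {m m' : Mem} {T : Tensor n} {Q : Matrix (Fin n) (Fin n) ℝ}
    {σ : Equiv.Perm (Fin n)} (h : IsReady m T Q σ)
    (hm : ∀ b, b < 10 ∨ 20 ≤ b → b < 23 → m' b = m b) : IsReady m' T Q σ :=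
  ⟨by rw [hm 0 (by omega) (by omega)]; exact h.ten,
    by rw [hm 3 (by omega) (by omega)]; exact h.mat,
    fun c => by rw [hm (20 + c) (by omega) (by omega)]; exact h.parts c⟩

lemma stepP_spec (h0 : e 0 = n) (h9 : e 9 = 0) {m : Mem} {T : Tensor n}
    {Q : Matrix (Fin n) (Fin n) ℝ} {σ : Equiv.Perm (Fin n)} (hr : IsReady m T Q σ) (a : Fin 3)
    {x : EuclideanSpace ℝ (Fin n)} (hx : IsVec (m 10) x) :
    IsVec (((stepP a).exec e m).1 10)
      (normalized (Matrix.toEuclideanLin (blockMat T Q σ a) x)) ∧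
    ∀ b, b < 10 ∨ 20 ≤ b → ((stepP a).exec e m).1 b = m b := by
  obtain ⟨hT, hQ, hσ⟩ := hr
  have n92 : ¬ (9 : ℕ) = 2 := by norm_num
  have n93 : ¬ (9 : ℕ) = 3 := by norm_num
  have n94 : ¬ (9 : ℕ) = 4 := by norm_num
  have n95 : ¬ (9 : ℕ) = 5 := by norm_num
  have n02 : ¬ (0 : ℕ) = 2 := by norm_num
  have n03 : ¬ (0 : ℕ) = 3 := by norm_num
  have n04 : ¬ (0 : ℕ) = 4 := by norm_num
  have n24 : ¬ (2 : ℕ) = 4 := by norm_num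
  have n34 : ¬ (3 : ℕ) = 4 := by norm_num
  have n23 : ¬ (2 : ℕ) = 3 := by norm_num
  have n45 : ¬ (4 : ℕ) = 5 := by norm_num
  have n25 : ¬ (2 : ℕ) = 5 := by norm_num
  -- These are the intended contents of the arrays `12` to `18`, in the nesting of
  -- `blockMat_mulVec_apply`.
  let y : Fin n → ℝ := fun k => ∑ i, Q i k * (mask σ a 1 i * x i)
  let W1 : Fin n → Fin n → ℝ := fun j l => ∑ k, T j l k * y k
  let W2 : Fin n → Fin n → ℝ := fun c l => ∑ j, Q c j * W1 j l
  let W3 : Fin n → Fin n → ℝ := fun c d => mask σ (a + 1) 1 c * mask σ (a + 2) 1 d *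
    ∑ l, W2 c l * Q d l
  let W4 : Fin n → Fin n → ℝ := fun j d => ∑ c, Q c j * W3 c d
  let W5 : Fin n → Fin n → ℝ := fun j l => ∑ d, W4 j d * Q d l
  let z : Fin n → ℝ := fun m => ∑ j, ∑ l, T j l m * W5 j l
  -- The postcondition is hidden behind a variable so that the composition rules unify with it.
  obtain ⟨P, hP⟩ : ∃ P : Mem → Prop, P = fun m' => IsVec (m' 10)
    (normalized (Matrix.toEuclideanLin (blockMat T Q σ a) x)) ∧
      ∀ b, b < 10 ∨ 20 ≤ b → m' b = m b := ⟨_, rfl⟩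
  suffices h : P ((stepP a).exec e m).1 by rw [hP] at h; exact h
  refine vecP_seq h0 h9
    (by simp only [Expr.Avoids]; omega) y (fun i => ?_) fun m1 h12 o1 => ?_
  · simp only [Expr.eval, h0, h9, Finset.sum_range, Function.update_self, ne_eq,
      not_false_eq_true, Function.update_of_ne, n92, n94, n02, n24]
    exact Finset.sum_congr rfl fun l _ => by rw [hQ l i, hσ a l, hx l]
  refine matP_seq h0 h9 (by simp only [Expr.Avoids]; omega) W1 (fun i j => ?_) fun m2 h13 o2 => ?_
  · simp only [Expr.eval, h0, h9, Finset.sum_range, Function.update_self, ne_eq,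
      not_false_eq_true, Function.update_of_ne, n92, n93, n94, n02, n03, n24, n34, n23]
    rw [o1 0 (by norm_num)]
    exact Finset.sum_congr rfl fun l _ => by rw [hT i j l, h12 l]
  refine matP_seq h0 h9 (by simp only [Expr.Avoids]; omega) W2 (fun i j => ?_) fun m3 h14 o3 => ?_
  · simp only [Expr.eval, h0, h9, Finset.sum_range, Function.update_self, ne_eq,
      not_false_eq_true, Function.update_of_ne, n92, n93, n94, n02, n03, n24, n34, n23]
    rw [o2 3 (by norm_num), o1 3 (by norm_num)]
    exact Finset.sum_congr rfl fun l _ => by rw [hQ i l, h13 l j]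
  refine matP_seq h0 h9 (by simp only [Expr.Avoids]; omega) W3 (fun i j => ?_) fun m4 h15 o4 => ?_
  · simp only [Expr.eval, h0, h9, Finset.sum_range, Function.update_self, ne_eq,
      not_false_eq_true, Function.update_of_ne, n92, n93, n94, n02, n03, n24, n34, n23]
    rw [o3 (20 + _) (by omega), o2 (20 + _) (by omega), o1 (20 + _) (by omega),
      o3 (20 + (a + 2 : Fin 3)) (by omega), o2 (20 + (a + 2 : Fin 3)) (by omega),
      o1 (20 + (a + 2 : Fin 3)) (by omega), o3 3 (by norm_num), o2 3 (by norm_num),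
      o1 3 (by norm_num), hσ (a + 1) i, hσ (a + 2) j]
    exact congrArg _ (Finset.sum_congr rfl fun l _ => by rw [hQ j l, h14 i l])
  refine matP_seq h0 h9 (by simp only [Expr.Avoids]; omega) W4 (fun i j => ?_) fun m5 h16 o5 => ?_
  · simp only [Expr.eval, h0, h9, Finset.sum_range, Function.update_self, ne_eq,
      not_false_eq_true, Function.update_of_ne, n92, n93, n94, n02, n03, n24, n34, n23]
    rw [o4 3 (by norm_num), o3 3 (by norm_num), o2 3 (by norm_num), o1 3 (by norm_num)]
    exact Finset.sum_congr rfl fun l _ => by rw [hQ l i, h15 l j]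
  refine matP_seq h0 h9 (by simp only [Expr.Avoids]; omega) W5 (fun i j => ?_) fun m6 h17 o6 => ?_
  · simp only [Expr.eval, h0, h9, Finset.sum_range, Function.update_self, ne_eq,
      not_false_eq_true, Function.update_of_ne, n92, n93, n94, n02, n03, n24, n34, n23]
    rw [o5 3 (by norm_num), o4 3 (by norm_num), o3 3 (by norm_num), o2 3 (by norm_num),
      o1 3 (by norm_num)]
    exact Finset.sum_congr rfl fun l _ => by rw [hQ l j, h16 i l]
  have p6 : ∀ b, b < 10 ∨ 20 ≤ b → m6 b = m b := fun b hb => by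
    rw [o6 b (by omega), o5 b (by omega), o4 b (by omega), o3 b (by omega), o2 b (by omega),
      o1 b (by omega)]
  have hx6 : IsVec (m6 10) x := by
    rw [o6 10 (by norm_num), o5 10 (by norm_num), o4 10 (by norm_num), o3 10 (by norm_num),
      o2 10 (by norm_num), o1 10 (by norm_num)]
    exact hx
  refine vecP_seq h0 h9 (by simp only [Expr.Avoids]; omega) z (fun i => ?_) fun m7 h18 o7 => ?_
  · simp only [Expr.eval, h0, h9, Finset.sum_range, Function.update_self, ne_eq,
      not_false_eq_true, Function.update_of_ne, n92, n94, n95, n02, n04, n24, n25, n45]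
    rw [p6 0 (by norm_num)]
    exact Finset.sum_congr rfl fun l _ => Finset.sum_congr rfl fun l' _ => by rw [hT, h17]
  refine vecP_seq h0 h9 (by simp only [Expr.Avoids, true_and, and_true]; omega)
    (blockMat T Q σ a *ᵥ x) (fun i => ?_) fun m8 h19 o8 => ?_
  · simp only [Expr.eval, h0, h9, Finset.sum_range, Function.update_self, ne_eq,
      not_false_eq_true, Function.update_of_ne, n92, n94, n02, n24]
    rw [o7 (20 + a) (by omega), o7 3 (by norm_num), o7 10 (by norm_num), p6 (20 + a) (by omega),
      p6 3 (by norm_num), hσ a i, hx6 i, ← blockMat_mulVec_apply]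
    refine congrArg₂ _ (congrArg _ (Finset.sum_congr rfl fun l _ => by rw [hQ, h18])) ?_
    norm_num
  obtain ⟨q1, q2⟩ := normP_spec (e := e) (b := 19) (b' := 10) (m := m8)
    (x := Matrix.toEuclideanLin (blockMat T Q σ a) x) h0 h9 (by norm_num) (by norm_num)
    (by norm_num) h19
  rw [hP]
  refine ⟨q1, fun b hb => ?_⟩
  rw [q2 b (by omega) (by omega), o8 b (by omega), o7 b (by omega), p6 b hb]

end RealMachine

/-! ### Ranks and the sorting permutation -/

namespace SpikedTensor

variable {n : ℕ}

/-- The number of entries smaller than entry `i`. -/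
def rank (s : Fin n → ℝ) (i : Fin n) : ℕ := (Finset.univ.filter fun j => s j < s i).card

lemma rank_lt (s : Fin n → ℝ) (i : Fin n) : rank s i < n := by
  have h : (Finset.univ.filter fun j => s j < s i) ⊂ Finset.univ :=
    (Finset.filter_ssubset).2 ⟨i, Finset.mem_univ i, lt_irrefl _⟩
  have := Finset.card_lt_card h
  rwa [Finset.card_univ, Fintype.card_fin] at this

lemma rank_lt_rank {s : Fin n → ℝ} {i j : Fin n} (h : s i < s j) : rank s i < rank s j := by
  refine Finset.card_lt_card ((Finset.ssubset_iff_of_subset fun l hl => ?_).2 ⟨i, ?_, ?_⟩)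
  · simp only [Finset.mem_filter, Finset.mem_univ, true_and] at hl ⊢
    exact hl.trans h
  · simpa using h
  · simp

lemma rank_injective {s : Fin n → ℝ} (hs : Function.Injective s) : Function.Injective (rank s) := by
  intro i j h
  rcases lt_trichotomy (s i) (s j) with hlt | heq | hgt
  · exact absurd h (rank_lt_rank hlt).ne
  · exact hs heq
  · exact absurd h (rank_lt_rank hgt).ne'

/-- The permutation that sends every index to the rank of its entry (the identity if entries
coincide). -/
def sortPerm (s : Fin n → ℝ) : Equiv.Perm (Fin n) :=
  if h : Function.Injective s then
    Equiv.ofBijective (fun i => ⟨rank s i, rank_lt s i⟩)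
      (Finite.injective_iff_bijective.1 fun _ _ hij =>
        rank_injective h (congrArg Fin.val hij))
  else 1

lemma sortPerm_apply {s : Fin n → ℝ} (hs : Function.Injective s) (i : Fin n) :
    (sortPerm s i : ℕ) = rank s i := by
  rw [sortPerm, dif_pos hs]
  rfl

end SpikedTensor

namespace RealMachine

open SpikedTensor

variable {n : ℕ} {e : Env}

/-! ### The rotation -/

/-- Gram–Schmidt orthogonalization, in array `3`, of the matrix in the slice `0` of array `1`. -/
def gsRowP : Program :=
  .seq (.loop 4 2 (.store 5 4 9 9 (.sum 5 0 (.mul (.load 3 4 5 9) (.load 1 2 5 9)))))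
  (.seq (.loop 3 0 (.store 4 3 9 9
    (.sub (.load 1 2 3 9) (.sum 4 2 (.mul (.load 5 4 9 9) (.load 3 4 3 9))))))
  (.seq (cellP 6 (.sqrt (.sum 4 0 (.mul (.load 4 4 9 9) (.load 4 4 9 9)))))
  (rowP 3 (.div (.load 4 3 9 9) (.load 6 9 9 9)))))

lemma sum_range_fin (i : Fin n) (f : ℕ → ℝ) :
    ∑ l ∈ Finset.range i, f l = ∑ l ∈ Finset.Iio i, f l := by
  rw [← Nat.Iio_eq_range, ← Fin.map_valEmbedding_Iio, Finset.sum_map]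
  rfl

lemma gsRowP_spec (h0 : e 0 = n) (h9 : e 9 = 0) {m : Mem} {G : Matrix (Fin n) (Fin n) ℝ}
    (hG : IsMat (m 1) G) {i : Fin n} (hi : e 2 = i)
    (hQ : ∀ l < i, ∀ j : Fin n, m 3 l j 0 = gsMat G l j) :
    (∀ l ≤ i, ∀ j : Fin n, ((gsRowP).exec e m).1 3 l j 0 = gsMat G l j) ∧
      ∀ b, b ≠ 3 → b ≠ 4 → b ≠ 5 → b ≠ 6 → ((gsRowP).exec e m).1 b = m b := by
  have n92 : ¬ (9 : ℕ) = 2 := by norm_num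
  have n93 : ¬ (9 : ℕ) = 3 := by norm_num
  have n94 : ¬ (9 : ℕ) = 4 := by norm_num
  have n95 : ¬ (9 : ℕ) = 5 := by norm_num
  have n02 : ¬ (0 : ℕ) = 2 := by norm_num
  have n03 : ¬ (0 : ℕ) = 3 := by norm_num
  have n04 : ¬ (0 : ℕ) = 4 := by norm_num
  have n24 : ¬ (2 : ℕ) = 4 := by norm_num
  have n34 : ¬ (3 : ℕ) = 4 := by norm_num
  have n23 : ¬ (2 : ℕ) = 3 := by norm_num
  have n45 : ¬ (4 : ℕ) = 5 := by norm_num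
  have n25 : ¬ (2 : ℕ) = 5 := by norm_num
  -- The loop bound is index variable `2`, the current row number, so only earlier rows enter.
  -- Storing the coefficients first keeps the cost of a row at `O(n²)`.
  obtain ⟨a1, a2⟩ := loop_store_spec (e := e) (m := m) (b := 5) (i := 4) (N := 2)
    (x := .sum 5 0 (.mul (.load 3 4 5 9) (.load 1 2 5 9))) h9 (by norm_num)
    (by simp only [Expr.Avoids]; omega)
  set m1 := ((Program.loop 4 2 (.store 5 4 9 9
    (.sum 5 0 (.mul (.load 3 4 5 9) (.load 1 2 5 9))))).exec e m).1 with hm1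
  have c1 : ∀ l < i, m1 5 l 0 0 = ∑ j, gsMat G l j * G i j := fun l hl => by
    rw [a1 l (by rw [hi]; exact hl)]
    simp only [Expr.eval, h0, h9, hi, Finset.sum_range, Function.update_self, ne_eq,
      not_false_eq_true, Function.update_of_ne, n94, n95, n04, n24, n25, n45]
    exact Finset.sum_congr rfl fun j _ => by rw [hQ l hl j, hG i j]
  obtain ⟨b1, b2⟩ := loop_store_spec (e := e) (m := m1) (b := 4) (i := 3) (N := 0)
    (x := .sub (.load 1 2 3 9) (.sum 4 2 (.mul (.load 5 4 9 9) (.load 3 4 3 9)))) h9 (by norm_num)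
    (by simp only [Expr.Avoids]; omega)
  set m2 := ((Program.loop 3 0 (.store 4 3 9 9
    (.sub (.load 1 2 3 9) (.sum 4 2 (.mul (.load 5 4 9 9) (.load 3 4 3 9)))))).exec e m1).1
    with hm2
  have c2 : ∀ j : Fin n, m2 4 j 0 0 = gsRaw G i j := fun j => by
    rw [b1 j (by rw [h0]; exact j.2)]
    simp only [Expr.eval, h9, hi, Function.update_self, ne_eq,
      not_false_eq_true, Function.update_of_ne, n93, n94, n34, n23]
    rw [a2 1 (by norm_num), a2 3 (by norm_num), hG i j, gsRaw, sum_range_fin]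
    congr 1
    exact Finset.sum_congr rfl fun l hl => by
      rw [c1 l (Finset.mem_Iio.1 hl), hQ l (Finset.mem_Iio.1 hl) j]
  obtain ⟨d1, d2⟩ := cellP_spec (e := e) (m := m2) (b := 6)
    (x := .sqrt (.sum 4 0 (.mul (.load 4 4 9 9) (.load 4 4 9 9))))
    (c := Real.sqrt (∑ j, gsRaw G i j * gsRaw G i j)) h9 (by
      simp only [Expr.eval, h0, h9, Finset.sum_range, Function.update_self, ne_eq,
        not_false_eq_true, Function.update_of_ne, n94]
      congr 1
      exact Finset.sum_congr rfl fun j _ => by rw [c2 j])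
  set m3 := ((cellP 6 (.sqrt (.sum 4 0 (.mul (.load 4 4 9 9) (.load 4 4 9 9))))).exec e m2).1
    with hm3
  obtain ⟨e1, e2, e3⟩ := rowP_spec (e := e) (m := m3) (b := 3)
    (x := .div (.load 4 3 9 9) (.load 6 9 9 9)) h0 h9 (by simp only [Expr.Avoids]; omega)
  have hfin : ((gsRowP).exec e m).1 =
    ((rowP 3 (.div (.load 4 3 9 9) (.load 6 9 9 9))).exec e m3).1 := rfl
  rw [hfin]
  refine ⟨fun l hl j => ?_, fun b hb3 hb4 hb5 hb6 => ?_⟩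
  · rcases hl.eq_or_lt with rfl | hlt
    · have := e1 j j.2
      rw [hi] at this
      rw [this, gsMat_eq]
      simp only [Expr.eval, h9, Function.update_self, ne_eq, not_false_eq_true,
        Function.update_of_ne, n93]
      rw [d2 4 (by norm_num), c2 j, d1]
    · rw [e2 l (by rw [hi]; exact fun h => hlt.ne (Fin.ext h)), d2 3 (by norm_num),
        b2 3 (by norm_num), a2 3 (by norm_num), hQ l hlt j]
  · rw [e3 b hb3, d2 b hb6, b2 b hb4, a2 b hb5]

/-- Gram–Schmidt orthogonalization of all rows. -/
def gsP : Program := .loop 2 0 gsRowP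

lemma gsP_spec (h0 : e 0 = n) (h9 : e 9 = 0) {m : Mem} {G : Matrix (Fin n) (Fin n) ℝ}
    (hG : IsMat (m 1) G) :
    IsMat (((gsP).exec e m).1 3) (gsMat G) ∧
      ∀ b, b ≠ 3 → b ≠ 4 → b ≠ 5 → b ≠ 6 → ((gsP).exec e m).1 b = m b := by
  have h := iterateBody_induction (m := m) (N := e 0)
    (body := fun l m' => gsRowP.exec (Function.update e 2 l) m')
    (P := fun L m' => (∀ l : Fin n, (l : ℕ) < L → ∀ j : Fin n, m' 3 l j 0 = gsMat G l j) ∧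
      ∀ b, b ≠ 3 → b ≠ 4 → b ≠ 5 → b ≠ 6 → m' b = m b)
    ⟨by simp, fun _ _ _ _ _ => rfl⟩ (fun i hi m' ⟨h1, h2⟩ => by
      rw [h0] at hi
      have h0' : Function.update e 2 i 0 = n := by rw [Function.update_of_ne (by norm_num), h0]
      have h9' : Function.update e 2 i 9 = 0 := by rw [Function.update_of_ne (by norm_num), h9]
      have hG' : IsMat (m' 1) G := by
        rw [h2 1 (by norm_num) (by norm_num) (by norm_num) (by norm_num)]; exact hG
      obtain ⟨r1, r2⟩ := gsRowP_spec h0' h9' hG' (i := ⟨i, hi⟩) (Function.update_self ..)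
        (fun l hl j => h1 l hl j)
      exact ⟨fun l hl j => r1 l (Nat.lt_succ_iff.1 hl) j,
        fun b hb3 hb4 hb5 hb6 => (r2 b hb3 hb4 hb5 hb6).trans (h2 b hb3 hb4 hb5 hb6)⟩)
  exact ⟨fun i j => h.1 i (by rw [h0]; exact i.2) j, h.2⟩

/-! ### The partition -/

/-- Compute the ranks of the sorting keys. -/
def rankP : Program :=
  vecP 7 (.sum 4 0 (.ifLe (.load 1 2 0 9) (.load 1 4 0 9) (.num 0) (.num 1)))

lemma rankP_spec (h0 : e 0 = n) (h9 : e 9 = 0) {m : Mem} {s : Fin n → ℝ}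
    (hs : ∀ i : Fin n, m 1 i n 0 = s i) :
    IsVec (((rankP).exec e m).1 7) (fun i : Fin n => (rank s i : ℝ)) ∧
      ∀ b, b ≠ 7 → ((rankP).exec e m).1 b = m b := by
  refine vecP_spec h0 h9 (by simp [Expr.Avoids]) fun i => ?_
  simp only [Expr.eval, h0, h9, Finset.sum_range, Function.update_self, ne_eq,
    not_false_eq_true, Function.update_of_ne, show ¬ (9 : ℕ) = 2 by norm_num,
    show ¬ (9 : ℕ) = 4 by norm_num, show ¬ (0 : ℕ) = 2 by norm_num,
    show ¬ (0 : ℕ) = 4 by norm_num, show ¬ (2 : ℕ) = 4 by norm_num, hs, rank]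
  rw [Finset.card_filter]
  push_cast
  refine Finset.sum_congr rfl fun j _ => ?_
  rcases le_or_gt (s i) (s j) with h | h
  · rw [if_pos h, if_neg (not_lt.2 h)]
  · rw [if_neg (not_le.2 h), if_pos h]

/-- The remainder modulo `3` of the entries of array `7`. -/
def modE : Expr :=
  .sub (.load 7 2 9 9) (.mul (.num 3) (.sum 4 0
    (.ifLe (.add (.mul (.num 3) (.idx 4)) (.num 3)) (.load 7 2 9 9) (.num 1) (.num 0))))

/-- Integer division by comparisons: `r / 3` is the number of `l` with `3 l + 3 ≤ r`, and all of
them are below `n` since `r < n`. -/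
lemma sum_div_three {r : ℕ} (hr : r < n) :
    ∑ l : Fin n, (if (3 : ℝ) * ((l : ℕ) : ℝ) + 3 ≤ r then (1 : ℝ) else 0) = (r / 3 : ℕ) := by
  rw [← Finset.sum_range (fun l : ℕ => if (3 : ℝ) * (l : ℝ) + 3 ≤ r then (1 : ℝ) else 0),
    Finset.sum_boole]
  congr 1
  have : (Finset.range n).filter (fun l : ℕ => (3 : ℝ) * (l : ℝ) + 3 ≤ r) = Finset.range (r / 3) := by
    ext l
    have h : (3 : ℝ) * (l : ℝ) + 3 ≤ r ↔ 3 * l + 3 ≤ r := by norm_cast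
    rw [Finset.mem_filter, Finset.mem_range, Finset.mem_range, h]
    omega
  rw [this, Finset.card_range]

/-- The indicator of part `c`. -/
def partP (c : Fin 3) : Program :=
  vecP (20 + c) (.ifLe modE (.num c) (.ifLe (.num c) modE (.num 1) (.num 0)) (.num 0))

lemma partP_spec (h0 : e 0 = n) (h9 : e 9 = 0) {m : Mem} {σ : Equiv.Perm (Fin n)}
    (hσ : IsVec (m 7) (fun i : Fin n => ((σ i : ℕ) : ℝ))) (c : Fin 3) :
    IsVec (((partP c).exec e m).1 (20 + c)) (mask σ c 1) ∧
      ∀ b, b ≠ 20 + (c : ℕ) → ((partP c).exec e m).1 b = m b := by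
  refine vecP_spec h0 h9 (by simp only [modE, Expr.Avoids, true_and, and_true]; omega) fun i => ?_
  have hE : modE.eval m (Function.update e 2 i) = (((σ i : ℕ) % 3 : ℕ) : ℝ) := by
    simp only [modE, Expr.eval, h0, h9, Finset.sum_range, Function.update_self, ne_eq,
      not_false_eq_true, Function.update_of_ne, show ¬ (9 : ℕ) = 2 by norm_num,
      show ¬ (9 : ℕ) = 4 by norm_num, show ¬ (0 : ℕ) = 2 by norm_num,
      show ¬ (2 : ℕ) = 4 by norm_num, hσ i, Nat.cast_ofNat, Nat.cast_one, Nat.cast_zero]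
    rw [sum_div_three (σ i).2]
    have := Nat.div_add_mod (σ i : ℕ) 3
    have h2 : ((3 * ((σ i : ℕ) / 3) + (σ i : ℕ) % 3 : ℕ) : ℝ) = ((σ i : ℕ) : ℝ) := by rw [this]
    push_cast at h2 ⊢
    linarith
  simp only [Expr.eval, hE, mask, Pi.one_apply, mul_one, Nat.cast_le, Nat.cast_one, Nat.cast_zero]
  by_cases h1 : (σ i : ℕ) % 3 = c
  · simp [h1]
  · rw [if_neg h1]
    split_ifs with h2 h3
    · omega
    · rfl
    · rfl

/-! ### One run of the power method -/

/-- The starting vectors on the tape. -/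
def startE (a : Fin 3) : Expr :=
  if a = 0 then .load 1 0 2 9 else if a = 1 then .load 1 2 0 0 else .load 1 0 2 0

/-- The power method for part `a`; the result, with the sign fixed and rotated back, is in the
array `24 + a`. -/
def runP (a : Fin 3) : Program :=
  .seq (vecP 19 (startE a)) (.seq (normP 19 10) (.seq (.loop 7 1 (stepP a))
  (.seq (vecP 12 (.sum 4 0 (.mul (.load 3 4 2 9) (.load 10 4 9 9))))
  (.seq (cellP 11 (.sum 4 0 (.sum 5 0 (.sum 6 0 (.mul (.load 0 4 5 6)
    (.mul (.mul (.load 12 4 9 9) (.load 12 5 9 9)) (.load 12 6 9 9)))))))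
  (vecP (24 + a) (.ifLe (.num 0) (.load 11 9 9 9) (.load 12 2 9 9)
    (.sub (.num 0) (.load 12 2 9 9))))))))

lemma runP_spec (h0 : e 0 = n) (h9 : e 9 = 0) {m : Mem} {T : Tensor n}
    {Q : Matrix (Fin n) (Fin n) ℝ} {σ : Equiv.Perm (Fin n)} (hr : IsReady m T Q σ) (a : Fin 3)
    {g : Fin n → ℝ} (hg : ∀ i : Fin n, (startE a).eval m (Function.update e 2 i) = g i) :
    IsVec (((runP a).exec e m).1 (24 + a))
      (Matrix.toEuclideanLin Qᵀ
        (fixSign (rotMat T Q) (powerIterate (blockMat T Q σ a) g (e 1)))) ∧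
    ∀ b, b < 10 ∨ 20 ≤ b → b ≠ 24 + (a : ℕ) → ((runP a).exec e m).1 b = m b := by
  have n92 : ¬ (9 : ℕ) = 2 := by norm_num
  have n94 : ¬ (9 : ℕ) = 4 := by norm_num
  have n95 : ¬ (9 : ℕ) = 5 := by norm_num
  have n96 : ¬ (9 : ℕ) = 6 := by norm_num
  have n02 : ¬ (0 : ℕ) = 2 := by norm_num
  have n04 : ¬ (0 : ℕ) = 4 := by norm_num
  have n05 : ¬ (0 : ℕ) = 5 := by norm_num
  have n24 : ¬ (2 : ℕ) = 4 := by norm_num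
  have n45 : ¬ (4 : ℕ) = 5 := by norm_num
  have n46 : ¬ (4 : ℕ) = 6 := by norm_num
  have n56 : ¬ (5 : ℕ) = 6 := by norm_num
  obtain ⟨P, hP⟩ : ∃ P : Mem → Prop, P = fun m' => IsVec (m' (24 + a))
    (Matrix.toEuclideanLin Qᵀ
        (fixSign (rotMat T Q) (powerIterate (blockMat T Q σ a) g (e 1)))) ∧
    ∀ b, b < 10 ∨ 20 ≤ b → b ≠ 24 + (a : ℕ) → m' b = m b := ⟨_, rfl⟩
  suffices h : P ((runP a).exec e m).1 by rw [hP] at h; exact h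
  refine vecP_seq h0 h9 (by
    unfold startE; split_ifs <;> simp only [Expr.Avoids] <;> omega) g hg fun m1 h19 o1 => ?_
  obtain ⟨q1, q2⟩ := normP_spec (e := e) (b := 19) (b' := 10) (m := m1)
    (x := WithLp.toLp 2 g) h0 h9 (by norm_num) (by norm_num) (by norm_num) h19
  rw [exec_seq_fst]
  generalize ((normP 19 10).exec e m1).1 = m2 at q1 q2 ⊢
  have p2 : ∀ b, b < 10 ∨ 20 ≤ b → m2 b = m b := fun b hb => by
    rw [q2 b (by omega) (by omega), o1 b (by omega)]
  have hloop : IsVec ((((Program.loop 7 1 (stepP a)).exec e m2).1) 10)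
      (powerIterate (blockMat T Q σ a) g (e 1)) ∧ ∀ b, b < 10 ∨ 20 ≤ b →
        ((Program.loop 7 1 (stepP a)).exec e m2).1 b = m b :=
    iterateBody_induction (m := m2) (N := e 1)
    (body := fun l m' => (stepP a).exec (Function.update e 7 l) m')
    (P := fun L m' => IsVec (m' 10) (powerIterate (blockMat T Q σ a) g L) ∧
      ∀ b, b < 10 ∨ 20 ≤ b → m' b = m b)
    ⟨q1, p2⟩ (fun l _ m' ⟨h1, h2⟩ => by
      have h0' : Function.update e 7 l 0 = n := by rw [Function.update_of_ne (by norm_num), h0]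
      have h9' : Function.update e 7 l 9 = 0 := by rw [Function.update_of_ne (by norm_num), h9]
      obtain ⟨r1, r2⟩ := stepP_spec h0' h9' (hr.congr fun b hb _ => h2 b hb) a h1
      exact ⟨r1, fun b hb => (r2 b hb).trans (h2 b hb)⟩)
  rw [exec_seq_fst]
  generalize ((Program.loop 7 1 (stepP a)).exec e m2).1 = m3 at hloop ⊢
  obtain ⟨h10, p3⟩ := hloop
  obtain ⟨hT, hQ, -⟩ := hr.congr fun b hb _ => p3 b hb
  set x := powerIterate (blockMat T Q σ a) g (e 1) with hx
  -- After rotating the iterate back, the cubic form can be evaluated on the input tensor itself in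
  -- `O(n³)` steps, and the same vector, up to sign, is the contribution to the output.
  refine vecP_seq h0 h9 (by simp only [Expr.Avoids]; omega) (Qᵀ *ᵥ x) (fun i => ?_)
    fun m4 h12 o4 => ?_
  · simp only [Expr.eval, h0, h9, Finset.sum_range, Function.update_self, ne_eq,
      not_false_eq_true, Function.update_of_ne, n92, n94, n02, n24]
    exact Finset.sum_congr rfl fun l _ => by rw [hQ l i, h10 l]; rfl
  refine cellP_seq h9 (c := cubicForm (rotMat T Q) x) ?_ fun m5 h11 o5 => ?_
  · rw [cubicForm_rotMat]
    simp only [Expr.eval, h0, h9, Finset.sum_range, Function.update_self, ne_eq,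
      not_false_eq_true, Function.update_of_ne, n94, n95, n96, n04, n05, n45, n46, n56]
    rw [o4 0 (by norm_num)]
    exact Finset.sum_congr rfl fun i _ => Finset.sum_congr rfl fun j _ =>
      Finset.sum_congr rfl fun l _ => by rw [hT i j l, h12 i, h12 j, h12 l]
  obtain ⟨r1, r2⟩ := vecP_spec (e := e) (m := m5) (b := 24 + a)
    (x := .ifLe (.num 0) (.load 11 9 9 9) (.load 12 2 9 9) (.sub (.num 0) (.load 12 2 9 9)))
    (f := Matrix.toEuclideanLin Qᵀ (fixSign (rotMat T Q) x)) h0 h9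
    (by simp only [Expr.Avoids, true_and]; omega) (fun i => by
      simp only [Expr.eval, h9, Function.update_self, ne_eq,
        not_false_eq_true, Function.update_of_ne, n92, Nat.cast_zero]
      rw [h11, o5 12 (by norm_num), h12 i, fixSign]
      split_ifs
      · rfl
      · rw [map_neg, zero_sub]; rfl)
  rw [hP]
  exact ⟨r1, fun b hb hb' => by
    rw [r2 b hb', o5 b (by omega), o4 b (by omega), p3 b hb]⟩

/-! ### The whole algorithm -/

/-- The recovery algorithm. -/
def recoverP : Program :=
  .seq gsP (.seq rankP (.seq (partP 0) (.seq (partP 1) (.seq (partP 2)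
  (.seq (runP 0) (.seq (runP 1) (.seq (runP 2)
  (.seq (vecP 28 (.add (.add (.load 24 2 9 9) (.load 25 2 9 9)) (.load 26 2 9 9)))
    (normP 28 2)))))))))

/-- The Gaussian matrix on the tape. -/
def tapeMat (n : ℕ) (ω : Tape) : Matrix (Fin n) (Fin n) ℝ := fun i j => ω (i, j, 0)

/-- The sorting keys on the tape. -/
def tapeKeys (n : ℕ) (ω : Tape) : Fin n → ℝ := fun i => ω (i, n, 0)

/-- The starting vectors on the tape. -/
def tapeStart (n : ℕ) (ω : Tape) : Fin 3 → Fin n → ℝ := fun a i =>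
  if a = 0 then ω (n, i, 0) else if a = 1 then ω (i, n, n) else ω (n, i, n)

/-- The keys must be distinct, since only then are the computed ranks those of a permutation. The
Gram–Schmidt matrix is left as it is, possibly with determinant `-1` or even singular; its sign is
dealt with in the comparison of laws. -/
lemma recoverP_output (T : Tensor n) (k : ℕ) {ω : Tape}
    (hω : Function.Injective (tapeKeys n ω)) :
    recoverP.output T k ω =
      recoverMat T (gsMat (tapeMat n ω)) (sortPerm (tapeKeys n ω)) (tapeStart n ω) k := by
  set σ := sortPerm (tapeKeys n ω)
  set Q := gsMat (tapeMat n ω)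
  set e := initEnv n k with he
  have h0 : e 0 = n := rfl
  have h9 : e 9 = 0 := rfl
  set m := initMem T ω with hm
  have hT : IsTen (m 0) T := fun i j l => by simp [m, initMem]
  have hG : IsMat (m 1) (tapeMat n ω) := fun i j => by simp [m, initMem, tapeMat]
  have hK : ∀ i : Fin n, m 1 i n 0 = tapeKeys n ω i := fun i => by simp [m, initMem, tapeKeys]
  have hS : ∀ (a : Fin 3) (m' : Mem), m' 1 = m 1 → ∀ i : Fin n,
      (startE a).eval m' (Function.update e 2 i) = tapeStart n ω a i := fun a m' h1 i => by
    unfold startE tapeStart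
    split_ifs <;> simp [Expr.eval, h1, m, initMem, h0, h9]
  suffices h : IsVec ((recoverP.exec e m).1 2) (recoverMat T Q σ (tapeStart n ω) k) by
    ext i
    exact h i
  obtain ⟨P, hP⟩ : ∃ P : Mem → Prop, P = fun m' => IsVec (m' 2)
    (recoverMat T Q σ (tapeStart n ω) k) := ⟨_, rfl⟩
  suffices h : P (recoverP.exec e m).1 by rw [hP] at h; exact h
  obtain ⟨hQ, o1⟩ := gsP_spec h0 h9 hG
  rw [recoverP, exec_seq_fst]
  generalize (gsP.exec e m).1 = m1 at hQ o1 ⊢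
  obtain ⟨h7, o2⟩ := rankP_spec (m := m1) h0 h9 (s := tapeKeys n ω) (fun i => by
    rw [o1 1 (by norm_num) (by norm_num) (by norm_num) (by norm_num)]; exact hK i)
  rw [exec_seq_fst]
  generalize (rankP.exec e m1).1 = m2 at h7 o2 ⊢
  have hσ : IsVec (m2 7) (fun i : Fin n => ((σ i : ℕ) : ℝ)) := fun i => by
    rw [h7 i]
    exact congrArg _ (sortPerm_apply hω i).symm
  obtain ⟨h20, o3⟩ := partP_spec h0 h9 hσ 0
  rw [exec_seq_fst]
  generalize ((partP 0).exec e m2).1 = m3 at h20 o3 ⊢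
  obtain ⟨h21, o4⟩ := partP_spec (m := m3) h0 h9 (by rw [o3 7 (by norm_num)]; exact hσ) 1
  rw [exec_seq_fst]
  generalize ((partP 1).exec e m3).1 = m4 at h21 o4 ⊢
  obtain ⟨h22, o5⟩ := partP_spec (m := m4) h0 h9
    (by rw [o4 7 (by norm_num), o3 7 (by norm_num)]; exact hσ) 2
  rw [exec_seq_fst]
  generalize ((partP 2).exec e m4).1 = m5 at h22 o5 ⊢
  have hr5 : IsReady m5 T Q σ := by
    refine ⟨?_, ?_, fun c => ?_⟩
    · rw [o5 0 (by norm_num), o4 0 (by norm_num), o3 0 (by norm_num), o2 0 (by norm_num),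
        o1 0 (by norm_num) (by norm_num) (by norm_num) (by norm_num)]
      exact hT
    · rw [o5 3 (by norm_num), o4 3 (by norm_num), o3 3 (by norm_num), o2 3 (by norm_num)]
      exact hQ
    · fin_cases c
      · change IsVec (m5 20) _
        rw [o5 20 (by norm_num), o4 20 (by norm_num)]
        exact h20
      · change IsVec (m5 21) _
        rw [o5 21 (by norm_num)]
        exact h21
      · exact h22
  have h51 : m5 1 = m 1 := by
    rw [o5 1 (by norm_num), o4 1 (by norm_num), o3 1 (by norm_num), o2 1 (by norm_num),
      o1 1 (by norm_num) (by norm_num) (by norm_num) (by norm_num)]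
  obtain ⟨h24, o6⟩ := runP_spec h0 h9 hr5 0 (hS 0 m5 h51)
  rw [exec_seq_fst]
  generalize ((runP 0).exec e m5).1 = m6 at h24 o6 ⊢
  have hr6 : IsReady m6 T Q σ := hr5.congr fun b hb hb' => o6 b hb (by norm_num; omega)
  have h61 : m6 1 = m 1 := (o6 1 (by norm_num) (by norm_num)).trans h51
  obtain ⟨h25, o7⟩ := runP_spec h0 h9 hr6 1 (hS 1 m6 h61)
  rw [exec_seq_fst]
  generalize ((runP 1).exec e m6).1 = m7 at h25 o7 ⊢
  have hr7 : IsReady m7 T Q σ := hr6.congr fun b hb hb' => o7 b hb (by norm_num; omega)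
  have h71 : m7 1 = m 1 := (o7 1 (by norm_num) (by norm_num)).trans h61
  obtain ⟨h26, o8⟩ := runP_spec h0 h9 hr7 2 (hS 2 m7 h71)
  rw [exec_seq_fst]
  generalize ((runP 2).exec e m7).1 = m8 at h26 o8 ⊢
  refine vecP_seq h0 h9 (by simp only [Expr.Avoids]; omega) (Matrix.toEuclideanLin Qᵀ
    (∑ a : Fin 3, fixSign (rotMat T Q) (powerIterate (blockMat T Q σ a) (tapeStart n ω a) k)))
    (fun i => ?_) fun m9 h28 o9 => ?_
  · simp only [Expr.eval, h9, Function.update_self, ne_eq,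
      not_false_eq_true, Function.update_of_ne, show ¬ (9 : ℕ) = 2 by norm_num]
    rw [o8 24 (by norm_num) (by norm_num), o7 24 (by norm_num) (by norm_num),
      o8 25 (by norm_num) (by norm_num), Fin.sum_univ_three, map_add, map_add]
    exact congrArg₂ _ (congrArg₂ _ (h24 i) (h25 i)) (h26 i)
  rw [hP]
  exact (normP_spec (m := m9) h0 h9 (by norm_num) (by norm_num) (by norm_num) h28).1

end RealMachine

namespace RealMachine

/-! ### Running time of the recovery program -/

lemma startE_cost (a : Fin 3) (B : Env) : (startE a).cost B = 1 := by
  unfold startE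
  split_ifs <;> rfl

lemma recoverP_cost_le {n : ℕ} (hn : 1 ≤ n) (k : ℕ) :
    recoverP.cost (initEnv n k) ≤ 10000 * (n ^ 3 * (k + 1)) := by
  have h1 : n ≤ n ^ 3 := Nat.le_self_pow (by norm_num) n
  have h2 : n ^ 2 ≤ n ^ 3 := Nat.pow_le_pow_right hn (by norm_num)
  have h3 : 1 ≤ n ^ 3 := Nat.one_le_pow _ _ hn
  have k1 := Nat.mul_le_mul_left k h1
  have k2 := Nat.mul_le_mul_left k h2
  have k3 := Nat.mul_le_mul_left k h3
  simp [recoverP, gsP, gsRowP, cellP, rowP, vecP, matP, rankP, partP, modE, runP, stepP, normP,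
    Program.cost, Expr.cost, startE_cost, initEnv]
  ring_nf
  nlinarith
end RealMachine

namespace SpikedTensor

variable {n : ℕ}

/-! ### Changing the signs of the rows of the rotation -/

section Signs

variable {d : Fin n → ℝ}

/-- Multiply the coordinates by the entries of `d`. -/
def flip (d : Fin n → ℝ) (x : EuclideanSpace ℝ (Fin n)) : EuclideanSpace ℝ (Fin n) :=
  WithLp.toLp 2 fun i => d i * x i

lemma norm_flip (hd : ∀ i, d i * d i = 1) (x : EuclideanSpace ℝ (Fin n)) : ‖flip d x‖ = ‖x‖ := by
  rw [← sq_eq_sq₀ (norm_nonneg _) (norm_nonneg _), EuclideanSpace.real_norm_sq_eq,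
    EuclideanSpace.real_norm_sq_eq]
  refine Finset.sum_congr rfl fun i _ => ?_
  change (d i * x i) ^ 2 = x i ^ 2
  linear_combination x i ^ 2 * hd i

lemma normalized_flip (hd : ∀ i, d i * d i = 1) (x : EuclideanSpace ℝ (Fin n)) :
    normalized (flip d x) = flip d (normalized x) := by
  ext i
  rw [normalized, norm_flip hd]
  change ‖x‖⁻¹ * (d i * x i) = d i * (‖x‖⁻¹ * x i)
  ring

lemma transpose_diagonal_mul_mulVec (hd : ∀ i, d i * d i = 1) (Q : Matrix (Fin n) (Fin n) ℝ)
    (x : Fin n → ℝ) : (Matrix.diagonal d * Q)ᵀ *ᵥ (fun i => d i * x i) = Qᵀ *ᵥ x := by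
  ext j
  simp only [Matrix.mulVec, dotProduct, Matrix.transpose_apply, Matrix.diagonal_mul]
  refine Finset.sum_congr rfl fun i _ => ?_
  linear_combination Q i j * x i * hd i

lemma mask_flip (σ : Equiv.Perm (Fin n)) (c : Fin 3) (x : Fin n → ℝ) :
    mask σ c (fun i => d i * x i) = fun i => d i * mask σ c x i := by
  ext i
  simp only [mask]
  ring

lemma diagonal_mul_row (Q : Matrix (Fin n) (Fin n) ℝ) (i : Fin n) :
    (Matrix.diagonal d * Q) i = d i • Q i := by
  ext j
  simp [Matrix.diagonal_mul]

/-- The signs of the rows `Q i` and `Q j` occur twice each and cancel, while the vector in the third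
slot is unchanged because `D² = 1`. Conjugation by the diagonal sign matrix therefore relates the
two block matrices. -/
lemma blockForm_flip (hd : ∀ i, d i * d i = 1) (T : Tensor n) (Q : Matrix (Fin n) (Fin n) ℝ)
    (σ : Equiv.Perm (Fin n)) (c : Fin 3) (x y : Fin n → ℝ) :
    blockForm T (Matrix.diagonal d * Q) σ c (fun i => d i * x i) (fun i => d i * y i) =
      blockForm T Q σ c x y := by
  simp only [blockForm, mask_flip, transpose_diagonal_mul_mulVec hd, diagonal_mul_row,
    tri_smul_left, tri_smul_mid]
  congr 1
  · refine Finset.sum_congr rfl fun i _ => Finset.sum_congr rfl fun j _ => ?_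
    linear_combination mask σ (c + 1) 1 i * mask σ (c + 2) 1 j *
      tri T (Q i) (Q j) (Qᵀ *ᵥ mask σ c x) * tri T (Q i) (Q j) (Qᵀ *ᵥ mask σ c y) *
      (d j * d j * hd i + hd j)
  · congr 1
    refine Finset.sum_congr rfl fun i _ => ?_
    linear_combination mask σ c x i * mask σ c y i * hd i

lemma blockMat_flip (hd : ∀ i, d i * d i = 1) (T : Tensor n) (Q : Matrix (Fin n) (Fin n) ℝ)
    (σ : Equiv.Perm (Fin n)) (c : Fin 3) (y : EuclideanSpace ℝ (Fin n)) :
    Matrix.toEuclideanLin (blockMat T (Matrix.diagonal d * Q) σ c) (flip d y) =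
      flip d (Matrix.toEuclideanLin (blockMat T Q σ c) y) := by
  ext i
  change (blockMat T (Matrix.diagonal d * Q) σ c *ᵥ fun i => d i * y i) i =
    d i * (blockMat T Q σ c *ᵥ y) i
  have h1 : ∀ (M : Matrix (Fin n) (Fin n) ℝ) (z : Fin n → ℝ),
      (M *ᵥ z) i = Pi.single i 1 ⬝ᵥ (M *ᵥ z) := fun M z => (single_one_dotProduct _ _).symm
  rw [h1, h1, dotProduct_blockMat, dotProduct_blockMat]
  have e : (Pi.single i (1 : ℝ) : Fin n → ℝ) = fun j => d j * (d i • Pi.single i (1 : ℝ)) j := by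
    ext j
    rcases eq_or_ne j i with rfl | h
    · simp [hd j]
    · simp [h]
  rw [e, blockForm_flip hd, blockForm_comm, blockForm_smul_right, blockForm_comm, ← e]

lemma powerIterate_flip (hd : ∀ i, d i * d i = 1) (T : Tensor n) (Q : Matrix (Fin n) (Fin n) ℝ)
    (σ : Equiv.Perm (Fin n)) (c : Fin 3) (g : Fin n → ℝ) (k : ℕ) :
    powerIterate (blockMat T (Matrix.diagonal d * Q) σ c) (fun i => d i * g i) k =
      flip d (powerIterate (blockMat T Q σ c) g k) := by
  induction k with
  | zero => exact normalized_flip hd (WithLp.toLp 2 g)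
  | succ k ih => rw [powerIterate, ih, blockMat_flip hd, normalized_flip hd, powerIterate]

lemma fixSign_flip (hd : ∀ i, d i * d i = 1) (T : Tensor n) (Q : Matrix (Fin n) (Fin n) ℝ)
    (x : EuclideanSpace ℝ (Fin n)) :
    fixSign (rotMat T (Matrix.diagonal d * Q)) (flip d x) = flip d (fixSign (rotMat T Q) x) := by
  have e : cubicForm (rotMat T (Matrix.diagonal d * Q)) (flip d x) = cubicForm (rotMat T Q) x := by
    rw [cubicForm_rotMat, cubicForm_rotMat]
    change tri T ((Matrix.diagonal d * Q)ᵀ *ᵥ fun i => d i * x i)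
      ((Matrix.diagonal d * Q)ᵀ *ᵥ fun i => d i * x i)
      ((Matrix.diagonal d * Q)ᵀ *ᵥ fun i => d i * x i) = _
    rw [transpose_diagonal_mul_mulVec hd]
  rw [fixSign, fixSign, e]
  split_ifs
  · rfl
  · ext i
    change -(d i * x i) = d i * -x i
    ring

/-- The output does not change when the signs of rows of the rotation and of the coordinates of the
starting vectors are changed simultaneously. -/
lemma recoverMat_flip (hd : ∀ i, d i * d i = 1) (T : Tensor n) (Q : Matrix (Fin n) (Fin n) ℝ)
    (σ : Equiv.Perm (Fin n)) (g : Fin 3 → Fin n → ℝ) (k : ℕ) :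
    recoverMat T (Matrix.diagonal d * Q) σ (fun a i => d i * g a i) k =
      recoverMat T Q σ g k := by
  simp only [recoverMat, powerIterate_flip hd, fixSign_flip hd, map_sum]
  congr 1
  refine Finset.sum_congr rfl fun a _ => ?_
  exact congrArg (WithLp.toLp 2) (transpose_diagonal_mul_mulVec hd Q _)

end Signs

/-! ### Measurability of the algorithm -/

lemma measurable_recover (T : Tensor n) (k : ℕ) : Measurable (recover T k) := by
  have hR : ∀ i j, Measurable fun ρ : Coins n => ρ.1.1 i j := fun i j =>
    (measurable_SO_apply i j).comp measurable_fst
  have hσ : Measurable fun ρ : Coins n => ρ.2.1 := by fun_prop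
  have hT : ∀ i j l, Measurable fun _ : Coins n => T i j l := fun _ _ _ => measurable_const
  have hit : ∀ a i, Measurable fun ρ : Coins n => iterate T ρ k a i := fun a i =>
    measurable_powerIterate (Q := fun ρ : Coins n => blockMat T ρ.1.1 ρ.2.1 a)
      (x := fun ρ => ρ.2.2 a)
      (measurable_blockMat (T := fun _ => T) (Q := fun ρ : Coins n => ρ.1.1)
        (σ := fun ρ => ρ.2.1) hT hR hσ a) (fun i => by fun_prop) k i
  have hcub : ∀ a, Measurable fun ρ : Coins n => cubicForm (rotMat T ρ.1.1) (iterate T ρ k a) :=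
    fun a => by
    simp only [cubicForm_rotMat]
    have h := measurable_transpose_mulVec (Q := fun ρ : Coins n => ρ.1.1)
      (x := fun ρ => iterate T ρ k a) hR (hit a)
    exact measurable_tri (T := fun _ => T) hT h h h
  have hfix : ∀ a i, Measurable fun ρ : Coins n =>
      fixSign (rotMat T ρ.1.1) (iterate T ρ k a) i := fun a i => by
    have e : (fun ρ : Coins n => fixSign (rotMat T ρ.1.1) (iterate T ρ k a) i) =
        fun ρ => if 0 ≤ cubicForm (rotMat T ρ.1.1) (iterate T ρ k a) then iterate T ρ k a i
          else -iterate T ρ k a i := by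
      ext ρ
      rw [fixSign]
      split_ifs <;> rfl
    rw [e]
    exact Measurable.ite (measurableSet_le measurable_const (hcub a)) (hit a i) (hit a i).neg
  have hsum : ∀ i, Measurable fun ρ : Coins n =>
      (∑ a : Fin 3, fixSign (rotMat T ρ.1.1) (iterate T ρ k a)) i := fun i => by
    have e : (fun ρ : Coins n => (∑ a : Fin 3, fixSign (rotMat T ρ.1.1) (iterate T ρ k a)) i) =
        fun ρ => ∑ a : Fin 3, fixSign (rotMat T ρ.1.1) (iterate T ρ k a) i := by
      ext ρ
      rw [WithLp.ofLp_sum, Finset.sum_apply]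
    rw [e]
    exact Finset.measurable_sum _ fun a _ => hfix a i
  have hout : ∀ i, Measurable fun ρ : Coins n => recover T k ρ i :=
    measurable_normalized (x := fun ρ : Coins n => Matrix.toEuclideanLin ρ.1.1ᵀ
      (∑ a : Fin 3, fixSign (rotMat T ρ.1.1) (iterate T ρ k a)))
      (fun i => measurable_transpose_mulVec (Q := fun ρ : Coins n => ρ.1.1)
        (x := fun ρ => (∑ a : Fin 3, fixSign (rotMat T ρ.1.1) (iterate T ρ k a)).ofLp) hR hsum i)
  exact (WithLp.measurable_toLp 2 (Fin n → ℝ)).comp (measurable_pi_lambda _ hout)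

end SpikedTensor

/-! ### Null sets of product measures -/

lemma MeasureTheory.Measure.pi_null_of_section {ι : Type*} [Fintype ι] [DecidableEq ι]
    {X : ι → Type*} [∀ i, MeasurableSpace (X i)] {μ : ∀ i, Measure (X i)}
    [∀ i, IsProbabilityMeasure (μ i)] {S : Set (∀ i, X i)} (hS : MeasurableSet S) (i : ι)
    (h : ∀ x, μ i {y | Function.update x i y ∈ S} = 0) : Measure.pi μ S = 0 := by
  rw [← lintegral_indicator_one hS]
  have hf : Measurable (S.indicator (1 : (∀ i, X i) → ENNReal)) := measurable_one.indicator hS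
  -- Fubini: integrating out coordinate `i` alone already gives zero for every choice of the other
  -- coordinates.
  rw [lintegral_eq_of_lmarginal_eq {i} hf (measurable_zero) ?_]
  · simp
  · ext x
    rw [lmarginal_singleton, lmarginal_singleton]
    have hm : MeasurableSet {y | Function.update x i y ∈ S} := measurable_update x hS
    have e : (fun y => S.indicator (1 : (∀ i, X i) → ENNReal) (Function.update x i y)) =
        {y | Function.update x i y ∈ S}.indicator 1 := by
      ext y
      simp only [Set.indicator]
      rfl
    simp only [e, lintegral_indicator_one hm, h x]
    simp

/-- The hyperplane lies in every slab `|⟨c, a⟩| < δ`; let `δ` tend to zero. -/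
lemma gaussianPi_hyperplane {ι : Type*} [Fintype ι] {c : ι → ℝ} (hc : ∑ i, c i ^ 2 = 1) :
    gaussianPi ι {a | ∑ i, c i * a i = 0} = 0 := by
  refine le_antisymm (ENNReal.le_of_forall_pos_le_add fun δ hδ _ => ?_) zero_le
  rw [zero_add, ← ENNReal.ofReal_coe_nnreal]
  refine (measure_mono fun a ha => ?_).trans (gaussianPi_small_ball c hc δ)
  have h0 : ∑ i, c i * a i = 0 := ha
  change |∑ i, c i * a i| < δ
  rw [h0, abs_zero]
  exact_mod_cast hδ

namespace SpikedTensor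

variable {n : ℕ}

/-! ### The Gram–Schmidt matrix of a Gaussian matrix -/

/-- The law of a square matrix with independent standard Gaussian entries. -/
abbrev matLaw (n : ℕ) : Measure (Fin n → Fin n → ℝ) := Measure.pi fun _ => gaussianPi (Fin n)

lemma gsMat_congr {G H : Matrix (Fin n) (Fin n) ℝ} {i : Fin n} (h : ∀ l ≤ i, G l = H l) :
    gsMat G i = gsMat H i := by
  induction i using WellFoundedLT.induction with
  | ind i ih =>
    have hraw : gsRaw G i = gsRaw H i := by
      ext j
      rw [gsRaw, gsRaw, h i le_rfl]
      congr 1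
      refine Finset.sum_congr rfl fun l hl => ?_
      have hl' := Finset.mem_Iio.1 hl
      rw [ih l hl' fun l' hl'' => h l' (hl''.trans hl'.le)]
    ext j
    rw [gsMat_eq, gsMat_eq, hraw]

/-- Fewer than `n` linear conditions on `n` coordinates have a nonzero solution. -/
lemma exists_unit_orthogonal (Q : Fin n → Fin n → ℝ) (i : Fin n) :
    ∃ c : Fin n → ℝ, ∑ m, c m ^ 2 = 1 ∧ ∀ l < i, ∑ m, c m * Q l m = 0 := by
  let f : EuclideanSpace ℝ (Fin n) →ₗ[ℝ] (Fin i → ℝ) :=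
    ⟨⟨fun u l => inner ℝ u (WithLp.toLp 2 (Q ⟨l, l.2.trans i.2⟩)), fun a b => by
      ext l; simp [inner_add_left]⟩, fun c a => by ext l; simp [real_inner_smul_left]⟩
  have hk : f.ker ≠ ⊥ := LinearMap.ker_ne_bot_of_finrank_lt (by simp)
  obtain ⟨u, hu, hu0⟩ := Submodule.exists_mem_ne_zero_of_ne_bot hk
  have hn : 0 < ‖u‖ := norm_pos_iff.2 hu0
  refine ⟨‖u‖⁻¹ • u, ?_, fun l hl => ?_⟩
  · have h1 : ‖(‖u‖⁻¹ • u)‖ = 1 := by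
      rw [norm_smul, norm_inv, norm_norm, inv_mul_cancel₀ hn.ne']
    have h2 := EuclideanSpace.real_norm_sq_eq (‖u‖⁻¹ • u)
    rw [h1, one_pow] at h2
    exact h2.symm
  · have h1 := congrFun (LinearMap.mem_ker.1 hu) ⟨l, hl⟩
    change inner ℝ u (WithLp.toLp 2 (Q l)) = 0 at h1
    rw [inner_eq_dotProduct] at h1
    change (‖u‖⁻¹ • u.ofLp) ⬝ᵥ Q l = 0
    rw [smul_dotProduct, h1, smul_zero]

/-- If the Gram–Schmidt vector of row `i` vanishes, that row lies in the span of the earlier ones,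
hence in a hyperplane whose unit normal depends only on the earlier rows. With all other rows fixed,
this is a null event. -/
lemma matLaw_gsRaw_eq_zero (i : Fin n) :
    matLaw n {G | ∀ j, gsRaw (Matrix.of G) i j = 0} = 0 := by
  have hG : ∀ i j, Measurable fun G : Fin n → Fin n → ℝ => Matrix.of G i j := fun i j => by
    change Measurable fun G : Fin n → Fin n → ℝ => G i j
    fun_prop
  have hraw : ∀ j, Measurable fun G : Fin n → Fin n → ℝ => gsRaw (Matrix.of G) i j := fun j => by
    simp only [gsRaw]
    exact (hG i j).sub (Finset.measurable_sum _ fun l _ =>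
      (Finset.measurable_sum _ fun m _ => (measurable_gsMat hG l m).mul (hG i m)).mul
        (measurable_gsMat hG l j))
  have hS : MeasurableSet {G : Fin n → Fin n → ℝ | ∀ j, gsRaw (Matrix.of G) i j = 0} := by
    simp only [Set.ofPred_forall]
    exact MeasurableSet.iInter fun j => hraw j (measurableSet_singleton 0)
  refine Measure.pi_null_of_section hS i fun G => ?_
  obtain ⟨c, hc1, hc⟩ := exists_unit_orthogonal (gsMat (Matrix.of G)) i
  refine measure_mono_null (fun x hx => ?_) (gaussianPi_hyperplane hc1)
  have hx' : ∀ j, gsRaw (Matrix.of (Function.update G i x)) i j = 0 := hx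
  change ∑ j, c j * x j = 0
  have h1 : ∀ l < i, gsMat (Matrix.of (Function.update G i x)) l = gsMat (Matrix.of G) l :=
    fun l hl => gsMat_congr fun l' hl' => by
      change Function.update G i x l' = G l'
      exact Function.update_of_ne (hl'.trans_lt hl).ne x G
  have h2 : ∀ j, x j = ∑ l ∈ Finset.Iio i,
      (∑ m, gsMat (Matrix.of G) l m * x m) * gsMat (Matrix.of G) l j := fun j => by
    have h3 := hx' j
    rw [gsRaw, sub_eq_zero] at h3
    have h4 : Matrix.of (Function.update G i x) i = x := Function.update_self ..
    rw [h4] at h3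
    rw [h3]
    exact Finset.sum_congr rfl fun l hl => by rw [h1 l (Finset.mem_Iio.1 hl)]
  have h5 : ∀ j, c j * x j = ∑ l ∈ Finset.Iio i,
      (∑ m, gsMat (Matrix.of G) l m * x m) * (c j * gsMat (Matrix.of G) l j) := fun j => by
    conv_lhs => rw [h2 j]
    rw [Finset.mul_sum]
    exact Finset.sum_congr rfl fun l _ => by ring
  simp only [h5]
  rw [Finset.sum_comm]
  refine Finset.sum_eq_zero fun l hl => ?_
  rw [← Finset.mul_sum, hc l (Finset.mem_Iio.1 hl), mul_zero]

lemma gsMat_mul_transpose {G : Matrix (Fin n) (Fin n) ℝ} (hG : ∀ i, ¬ ∀ j, gsRaw G i j = 0) :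
    gsMat G * (gsMat G)ᵀ = 1 := by
  set f : Fin n → EuclideanSpace ℝ (Fin n) := fun i => WithLp.toLp 2 (G i)
  have hne : ∀ i, InnerProductSpace.gramSchmidt ℝ f i ≠ 0 := fun i h0 => hG i fun j => by
    rw [gsRaw_eq]
    exact congrArg (fun v : EuclideanSpace ℝ (Fin n) => v j) h0
  ext i j
  have e : (gsMat G * (gsMat G)ᵀ) i j = inner ℝ (InnerProductSpace.gramSchmidtNormed ℝ f i)
      (InnerProductSpace.gramSchmidtNormed ℝ f j) := by
    rw [inner_eq_dotProduct]
    rfl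
  rw [e, Matrix.one_apply]
  simp only [InnerProductSpace.gramSchmidtNormed, inner_smul_left, inner_smul_right]
  split_ifs with h
  · rw [h, real_inner_self_eq_norm_sq]
    have := norm_ne_zero_iff.2 (hne j)
    simp
    field_simp
  · rw [InnerProductSpace.gramSchmidt_orthogonal ℝ f h]
    simp

lemma ae_gsMat_mul_transpose :
    ∀ᵐ G ∂matLaw n, gsMat (Matrix.of G) * (gsMat (Matrix.of G))ᵀ = 1 := by
  have h : ∀ᵐ G ∂matLaw n, ∀ i, ¬ ∀ j, gsRaw (Matrix.of G) i j = 0 := by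
    rw [ae_all_iff]
    intro i
    rw [ae_iff]
    simp only [not_not]
    exact matLaw_gsRaw_eq_zero i
  filter_upwards [h] with G hG using gsMat_mul_transpose hG

/-- The signs that turn the Gram–Schmidt matrix into a rotation. -/
def gsSigns (G : Fin n → Fin n → ℝ) (i : Fin n) : ℝ :=
  if (i : ℕ) = 0 then (gsMat (Matrix.of G)).det else 1

lemma gsSigns_mul_self {G : Fin n → Fin n → ℝ}
    (hG : gsMat (Matrix.of G) * (gsMat (Matrix.of G))ᵀ = 1) (i : Fin n) :
    gsSigns G i * gsSigns G i = 1 := by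
  rw [gsSigns]
  split_ifs
  · have := congrArg Matrix.det hG
    rwa [Matrix.det_mul, Matrix.det_transpose, Matrix.det_one] at this
  · norm_num

lemma gsSigns_mul_gsMat_mem (hn : 0 < n) {G : Fin n → Fin n → ℝ}
    (hG : gsMat (Matrix.of G) * (gsMat (Matrix.of G))ᵀ = 1) :
    Matrix.diagonal (gsSigns G) * gsMat (Matrix.of G) ∈
      Matrix.specialOrthogonalGroup (Fin n) ℝ := by
  have hd := gsSigns_mul_self hG
  refine ⟨Matrix.mem_unitaryGroup_iff.2 ?_, ?_⟩
  · change Matrix.diagonal (gsSigns G) * gsMat (Matrix.of G) *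
      (Matrix.diagonal (gsSigns G) * gsMat (Matrix.of G))ᴴ = 1
    rw [Matrix.conjTranspose_eq_transpose_of_trivial, Matrix.transpose_mul,
      Matrix.diagonal_transpose, Matrix.mul_assoc, ← Matrix.mul_assoc (gsMat _), hG,
      Matrix.one_mul, Matrix.diagonal_mul_diagonal]
    simp [hd]
  · change (Matrix.diagonal (gsSigns G) * gsMat (Matrix.of G)).det = 1
    rw [Matrix.det_mul, Matrix.det_diagonal, Finset.prod_eq_single (⟨0, hn⟩ : Fin n)]
    · rw [gsSigns, if_pos rfl]
      have := hd ⟨0, hn⟩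
      rwa [gsSigns, if_pos rfl] at this
    · intro i _ hi
      rw [gsSigns, if_neg fun h => hi (Fin.ext h)]
    · simp

/-- The rotation obtained from a Gaussian matrix. -/
def gsRot (hn : 0 < n) (G : Fin n → Fin n → ℝ) : SO n :=
  if h : gsMat (Matrix.of G) * (gsMat (Matrix.of G))ᵀ = 1 then
    ⟨_, gsSigns_mul_gsMat_mem hn h⟩
  else 1

lemma gsRot_val (hn : 0 < n) {G : Fin n → Fin n → ℝ}
    (hG : gsMat (Matrix.of G) * (gsMat (Matrix.of G))ᵀ = 1) :
    (gsRot hn G).1 = Matrix.diagonal (gsSigns G) * gsMat (Matrix.of G) := by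
  rw [gsRot, dif_pos hG]

lemma measurable_of_apply (i j : Fin n) :
    Measurable fun G : Fin n → Fin n → ℝ => Matrix.of G i j := by
  change Measurable fun G : Fin n → Fin n → ℝ => G i j
  fun_prop

lemma measurable_gsSigns (i : Fin n) : Measurable fun G : Fin n → Fin n → ℝ => gsSigns G i := by
  unfold gsSigns
  split_ifs
  · simp only [Matrix.det_apply']
    exact Finset.measurable_sum _ fun σ _ => (Finset.measurable_prod _ fun i _ =>
      measurable_gsMat measurable_of_apply _ _).const_mul _
  · exact measurable_const

/-- The group is compact, so the matrix entries embed it as a closed set and measurability may be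
checked entrywise. -/
lemma measurable_toSO {Ω : Type*} [MeasurableSpace Ω] {f : Ω → SO n}
    (hf : ∀ i j, Measurable fun ω => (f ω).1 i j) : Measurable f := by
  let e : SO n → (Fin n → Fin n → ℝ) := fun R i j => R.1 i j
  have hc : Continuous e := continuous_pi fun i => continuous_pi fun j =>
    (Continuous.matrix_elem continuous_subtype_val i j : Continuous fun R : SO n => R.1 i j)
  have hi : Function.Injective e := fun R S h => Subtype.ext (Matrix.ext fun i j =>
    congrFun (congrFun h i) j)
  have he := (hc.isClosedEmbedding hi).measurableEmbedding
  exact he.measurable_comp_iff.1 (measurable_pi_lambda _ fun i => measurable_pi_lambda _ (hf i))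

lemma measurable_gsRot (hn : 0 < n) : Measurable (gsRot hn) := by
  refine measurable_toSO fun i j => ?_
  have hgs : ∀ i j, Measurable fun G : Fin n → Fin n → ℝ => gsMat (Matrix.of G) i j :=
    fun i j => measurable_gsMat measurable_of_apply i j
  have hset : MeasurableSet {G : Fin n → Fin n → ℝ |
      gsMat (Matrix.of G) * (gsMat (Matrix.of G))ᵀ = 1} := by
    have e : {G : Fin n → Fin n → ℝ | gsMat (Matrix.of G) * (gsMat (Matrix.of G))ᵀ = 1} =
        ⋂ a, ⋂ b, {G : Fin n → Fin n → ℝ |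
          ∑ m, gsMat (Matrix.of G) a m * gsMat (Matrix.of G) b m =
            (1 : Matrix (Fin n) (Fin n) ℝ) a b} := by
      ext G
      simp only [Set.mem_ofPred_eq, Set.mem_iInter, ← Matrix.ext_iff]
      rfl
    rw [e]
    exact MeasurableSet.iInter fun a => MeasurableSet.iInter fun b =>
      (Finset.measurable_sum _ fun m _ => (hgs a m).mul (hgs b m)) (measurableSet_singleton _)
  have e : (fun G => (gsRot hn G).1 i j) = fun G : Fin n → Fin n → ℝ =>
      if gsMat (Matrix.of G) * (gsMat (Matrix.of G))ᵀ = 1 then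
        gsSigns G i * gsMat (Matrix.of G) i j else (1 : Matrix (Fin n) (Fin n) ℝ) i j := by
    ext G
    split_ifs with h
    · rw [gsRot_val hn h, Matrix.diagonal_mul]
    · rw [gsRot, dif_neg h]
      rfl
  rw [e]
  exact Measurable.ite hset ((measurable_gsSigns i).mul (hgs i j)) measurable_const

lemma matLaw_map_mul {S : Matrix (Fin n) (Fin n) ℝ} (hS : S * Sᵀ = 1) :
    MeasurePreserving (fun (G : Fin n → Fin n → ℝ) i => Sᵀ *ᵥ G i) (matLaw n) (matLaw n) := by
  have hSt : Sᵀ * Sᵀᵀ = 1 := by rw [Matrix.transpose_transpose]; exact mul_eq_one_comm.1 hS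
  have hm : Measurable fun x : Fin n → ℝ => Sᵀ *ᵥ x :=
    (Continuous.matrix_mulVec continuous_const continuous_id).measurable
  exact measurePreserving_pi _ _ fun _ => ⟨hm, gaussianPi_map_mulVec hSt⟩

/-- Replacing `G` by `G S` with a rotation `S` preserves the Gaussian law, multiplies the
Gram–Schmidt matrix by `S` and leaves the correcting signs unchanged, because `det S = 1`. The law
is thus right invariant, hence Haar. -/
lemma map_gsRot (hn : 0 < n) : (matLaw n).map (gsRot hn) = rotationLaw n := by
  have hm := measurable_gsRot hn
  have : IsProbabilityMeasure ((matLaw n).map (gsRot hn)) :=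
    Measure.isProbabilityMeasure_map hm.aemeasurable
  have : ((matLaw n).map (gsRot hn)).IsMulRightInvariant := ⟨fun S => by
    have hS := SO_mul_transpose S
    have hmul : Measurable fun R : SO n => R * S := by fun_prop
    have hp := matLaw_map_mul hS
    rw [Measure.map_map hmul hm]
    have h1 : (fun R : SO n => R * S) ∘ gsRot hn =ᵐ[matLaw n]
        gsRot hn ∘ fun (G : Fin n → Fin n → ℝ) i => S.1ᵀ *ᵥ G i := by
      filter_upwards [ae_gsMat_mul_transpose] with G hG
      have h2 : Matrix.of (fun i => S.1ᵀ *ᵥ G i) = Matrix.of G * S.1 := by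
        ext i j
        rw [Matrix.mul_apply_eq_vecMul, ← Matrix.mulVec_transpose]
        rfl
      have h3 : gsMat (Matrix.of (fun i => S.1ᵀ *ᵥ G i)) = gsMat (Matrix.of G) * S.1 := by
        rw [h2, gsMat_mul hS]
      have h4 : gsMat (Matrix.of (fun i => S.1ᵀ *ᵥ G i)) *
          (gsMat (Matrix.of (fun i => S.1ᵀ *ᵥ G i)))ᵀ = 1 := by
        rw [h3, Matrix.transpose_mul, Matrix.mul_assoc, ← Matrix.mul_assoc S.1, hS, Matrix.one_mul,
          hG]
      have h5 : gsSigns (fun i => S.1ᵀ *ᵥ G i) = gsSigns G := by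
        ext i
        rw [gsSigns, gsSigns, h3, Matrix.det_mul]
        have : S.1.det = 1 := S.2.2
        rw [this, mul_one]
      apply Subtype.ext
      change (gsRot hn G).1 * S.1 = (gsRot hn fun i => S.1ᵀ *ᵥ G i).1
      rw [gsRot_val hn hG, gsRot_val hn h4, h3, h5, Matrix.mul_assoc]
    rw [Measure.map_congr h1, ← Measure.map_map hm hp.measurable, hp.map_eq]⟩
  exact eq_rotationLaw_of_mul_right _

end SpikedTensor

/-! ### Reindexing independent standard Gaussians -/

lemma gaussianPi_map_comp_perm {ι : Type*} [Fintype ι] (π : Equiv.Perm ι) :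
    MeasurePreserving (fun (s : ι → ℝ) i => s (π i)) (gaussianPi ι) (gaussianPi ι) := by
  have h := Measure.map_infinitePi_infinitePi_of_inj (P := fun _ : ι => gaussianReal 0 1)
    π.injective
  rw [Measure.infinitePi_eq_pi] at h
  exact ⟨by fun_prop, h⟩

lemma gaussianPi_sum (ι κ : Type*) [Fintype ι] [Fintype κ] :
    MeasurePreserving (fun x : ι ⊕ κ → ℝ => ((fun i => x (.inl i)), fun j => x (.inr j)))
      (gaussianPi (ι ⊕ κ)) ((gaussianPi ι).prod (gaussianPi κ)) :=
  measurePreserving_sumPiEquivProdPi (X := fun _ : ι ⊕ κ => ℝ) fun _ => gaussianReal 0 1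

lemma gaussianPi_curry (ι κ : Type*) [Fintype ι] [Fintype κ] :
    MeasurePreserving (fun (x : ι × κ → ℝ) i j => x (i, j)) (gaussianPi (ι × κ))
      (Measure.pi fun _ => gaussianPi κ) := by
  have h := Measure.infinitePi_map_curry (X := ℝ) fun (_ : ι) (_ : κ) => gaussianReal 0 1
  simp only [Measure.infinitePi_eq_pi] at h
  exact ⟨by fun_prop, h⟩

/-- A coincidence of two keys places the vector in the hyperplane with unit normal `(e_i - e_j) /
√2`. -/
lemma gaussianPi_ae_injective {ι : Type*} [Fintype ι] :
    ∀ᵐ s ∂gaussianPi ι, Function.Injective s := by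
  classical
  have h : ∀ᵐ s ∂gaussianPi ι, ∀ i j, i ≠ j → s i ≠ s j := by
    simp only [ae_all_iff]
    intro i j hij
    rw [ae_iff]
    have hc : ∑ l, ((Real.sqrt 2)⁻¹ * ((if l = i then 1 else 0) - if l = j then 1 else 0)) ^ 2 =
        (1 : ℝ) := by
      have e : ∀ l, ((Real.sqrt 2)⁻¹ *
          ((if l = i then (1 : ℝ) else 0) - if l = j then 1 else 0)) ^ 2 =
          2⁻¹ * ((if l = i then 1 else 0) + if l = j then 1 else 0) := fun l => by
        rw [mul_pow, inv_pow, Real.sq_sqrt zero_le_two]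
        split_ifs with h1 h2 h2
        · exact absurd (h1.symm.trans h2) hij
        all_goals norm_num
      simp only [e]
      rw [← Finset.mul_sum, Finset.sum_add_distrib]
      simp
      norm_num
    refine measure_mono_null (fun s hs => ?_) (gaussianPi_hyperplane hc)
    simp only [ne_eq, not_not, Set.mem_ofPred_eq] at hs
    change ∑ l, _ = (0 : ℝ)
    simp only [mul_assoc]
    rw [← Finset.mul_sum]
    simp [sub_mul, hs]
  filter_upwards [h] with s hs i j hij
  by_contra hne
  exact hs i j hne hij

namespace SpikedTensor

open RealMachine

variable {n : ℕ}

/-! ### Sorting independent keys -/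

lemma rank_comp (s : Fin n → ℝ) (π : Equiv.Perm (Fin n)) (i : Fin n) :
    rank (fun i => s (π i)) i = rank s (π i) := by
  rw [rank, rank]
  refine Finset.card_bij (fun j _ => π j) (fun j hj => by simpa using hj)
    (fun _ _ _ _ h => π.injective h) fun j hj => ⟨π.symm j, by simpa using hj, by simp⟩

lemma sortPerm_comp {s : Fin n → ℝ} (hs : Function.Injective s) (π : Equiv.Perm (Fin n)) :
    sortPerm (fun i => s (π i)) = sortPerm s * π := by
  ext i
  have hsπ : Function.Injective fun i => s (π i) := hs.comp π.injective
  rw [sortPerm_apply hsπ, rank_comp, Equiv.Perm.mul_apply, sortPerm_apply hs]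

lemma measurable_rank (i : Fin n) : Measurable fun s : Fin n → ℝ => rank s i := by
  simp only [rank, Finset.card_filter]
  exact Finset.measurable_sum _ fun j _ => Measurable.ite
    (measurableSet_lt (measurable_pi_apply j) (measurable_pi_apply i)) measurable_const
    measurable_const

lemma measurableSet_injective {ι : Type*} [Fintype ι] :
    MeasurableSet {s : ι → ℝ | Function.Injective s} := by
  have e : {s : ι → ℝ | Function.Injective s} = ⋂ i, ⋂ j, {s | s i = s j → i = j} := by
    ext s
    simp [Function.Injective]
  rw [e]
  refine MeasurableSet.iInter fun i => MeasurableSet.iInter fun j => ?_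
  by_cases h : i = j
  · simp [h]
  · simp only [h, imp_false]
    exact (measurableSet_eq_fun (measurable_pi_apply i) (measurable_pi_apply j)).compl

lemma measurable_sortPerm : Measurable (sortPerm (n := n)) := by
  refine measurable_to_countable' fun σ => ?_
  have e : sortPerm (n := n) ⁻¹' {σ} =
      ({s | Function.Injective s} ∩ ⋂ i, {s | rank s i = σ i}) ∪
        ({s | Function.Injective s}ᶜ ∩ {_s | σ = 1}) := by
    ext s
    by_cases h : Function.Injective s
    · simp only [Set.mem_preimage, Set.mem_singleton_iff, Set.mem_union, Set.mem_inter_iff,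
        Set.mem_ofPred_eq, h, true_and, Set.mem_iInter, Set.mem_compl_iff, not_true_eq_false,
        false_and, or_false]
      rw [Equiv.ext_iff]
      simp only [Fin.ext_iff, sortPerm_apply h]
    · simp only [Set.mem_preimage, Set.mem_singleton_iff, Set.mem_union, Set.mem_inter_iff,
        Set.mem_ofPred_eq, h, false_and, Set.mem_compl_iff, not_false_eq_true, true_and, false_or]
      rw [sortPerm, dif_neg h, eq_comm]
  rw [e]
  refine (measurableSet_injective.inter (MeasurableSet.iInter fun i => ?_)).union
    (measurableSet_injective.compl.inter (MeasurableSet.const _))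
  exact measurable_rank i (measurableSet_singleton _)

/-- Permuting independent keys preserves their law and multiplies the sorting permutation from the
right (`sortPerm_comp`). A right invariant probability on a finite group is uniform. -/
lemma map_sortPerm : (gaussianPi (Fin n)).map sortPerm = permLaw n := by
  set μ := (gaussianPi (Fin n)).map sortPerm
  have hμ : IsProbabilityMeasure μ :=
    Measure.isProbabilityMeasure_map measurable_sortPerm.aemeasurable
  have h1 : ∀ σ, μ {σ} = μ {1} := fun σ => by
    have hp := gaussianPi_map_comp_perm σ
    have e : sortPerm ∘ (fun (s : Fin n → ℝ) i => s (σ i)) =ᵐ[gaussianPi (Fin n)]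
        (fun τ : Equiv.Perm (Fin n) => τ * σ) ∘ sortPerm := by
      filter_upwards [gaussianPi_ae_injective] with s hs using sortPerm_comp hs σ
    have hm : Measurable fun τ : Equiv.Perm (Fin n) => τ * σ := measurable_from_top
    have e2 : μ = μ.map fun τ : Equiv.Perm (Fin n) => τ * σ := by
      rw [Measure.map_map hm measurable_sortPerm, ← Measure.map_congr e,
        ← Measure.map_map measurable_sortPerm hp.measurable, hp.map_eq]
    rw [e2, Measure.map_apply hm (measurableSet_singleton _)]
    rw [← e2]
    congr 1
    ext τ
    simp
  have h2 : μ {1} = (Fintype.card (Equiv.Perm (Fin n)) : ENNReal)⁻¹ := by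
    have h3 : ∑ σ, μ {σ} = 1 := by
      rw [sum_measure_singleton, Finset.coe_univ, measure_univ]
    simp only [h1, Finset.sum_const, Finset.card_univ, nsmul_eq_mul] at h3
    exact ENNReal.eq_inv_of_mul_eq_one_left (by rwa [mul_comm])
  refine Measure.ext_of_singleton fun σ => ?_
  rw [h1, h2, permLaw, PMF.toMeasure_apply_singleton _ _ (measurableSet_singleton _),
    PMF.uniformOfFintype_apply]

/-! ### The random choices of the algorithm from independent Gaussians -/

/-- The random choices obtained from a Gaussian matrix, Gaussian keys and Gaussian vectors. -/
def coins (hn : 0 < n) (x : (Fin n → Fin n → ℝ) × (Fin n → ℝ) × (Fin 3 → Fin n → ℝ)) : Coins n :=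
  (gsRot hn x.1, sortPerm x.2.1, fun a i => gsSigns x.1 i * x.2.2 a i)

lemma startLaw_map_signs {d : Fin n → ℝ} (hd : ∀ i, d i * d i = 1) :
    MeasurePreserving (fun (g : Fin 3 → Fin n → ℝ) a i => d i * g a i) (startLaw n)
      (startLaw n) := by
  have hD : Matrix.diagonal d * (Matrix.diagonal d)ᵀ = 1 := by
    rw [Matrix.diagonal_transpose, Matrix.diagonal_mul_diagonal]
    simp [hd]
  have e : (fun x : Fin n → ℝ => Matrix.diagonal d *ᵥ x) = fun x i => d i * x i := by
    ext x i
    rw [Matrix.mulVec_diagonal]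
  have h := gaussianPi_map_mulVec hD
  rw [e] at h
  exact measurePreserving_pi _ _ fun _ => ⟨by fun_prop, h⟩

/-- The signs applied to the starting vectors depend on the Gaussian matrix. For almost every fixed
matrix, however, they preserve the Gaussian law, so the coins remain independent; hence the skew
product. -/
lemma measurePreserving_coins (hn : 0 < n) :
    MeasurePreserving (coins hn) ((matLaw n).prod ((gaussianPi (Fin n)).prod (startLaw n)))
      (coinLaw n) := by
  refine MeasurePreserving.skew_product (f := gsRot hn)
    (g := fun (G : Fin n → Fin n → ℝ) (x : (Fin n → ℝ) × (Fin 3 → Fin n → ℝ)) =>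
      (sortPerm x.1, fun a i => gsSigns G i * x.2 a i))
    ⟨measurable_gsRot hn, map_gsRot hn⟩ ?_ ?_
  · refine Measurable.prodMk (measurable_sortPerm.comp (measurable_fst.comp measurable_snd)) ?_
    refine measurable_pi_lambda _ fun a => measurable_pi_lambda _ fun i => ?_
    have h1 : Measurable fun p : (Fin n → Fin n → ℝ) × (Fin n → ℝ) × (Fin 3 → Fin n → ℝ) =>
        p.2.2 a i := by fun_prop
    exact ((measurable_gsSigns i).comp measurable_fst).mul h1
  · filter_upwards [ae_gsMat_mul_transpose] with G hG
    have h : MeasurePreserving (sortPerm (n := n)) (gaussianPi (Fin n)) (permLaw n) :=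
      ⟨measurable_sortPerm, map_sortPerm⟩
    exact (h.prod (startLaw_map_signs (gsSigns_mul_self hG))).map_eq

/-- The cells of the tape that hold the matrix, the keys and the starting vectors. -/
def tapeIndex (n : ℕ) : (Fin n × Fin n) ⊕ (Fin n ⊕ (Fin 3 × Fin n)) → ℕ × ℕ × ℕ
  | .inl (i, j) => (i, j, 0)
  | .inr (.inl i) => (i, n, 0)
  | .inr (.inr (a, i)) => if a = 0 then (n, i, 0) else if a = 1 then (i, n, n) else (n, i, n)

/-- The coordinate `n` never equals an index below `n`; its positions, with the last coordinate `0`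
or `n`, separate the blocks. -/
lemma tapeIndex_injective (hn : 0 < n) : Function.Injective (tapeIndex n) := by
  rintro (⟨i, j⟩ | i | ⟨a, i⟩) (⟨i', j'⟩ | i' | ⟨a', i'⟩) h
  all_goals
    have := i.2
    have := i'.2
    try have := j.2
    try have := j'.2
    try fin_cases a
    all_goals try fin_cases a'
    all_goals
      simp [tapeIndex, Fin.ext_iff] at h ⊢
      try omega

/-- The Gaussian matrix, the keys and the starting vectors on the tape. -/
def tapeSeeds (n : ℕ) (ω : Tape) :
    (Fin n → Fin n → ℝ) × (Fin n → ℝ) × (Fin 3 → Fin n → ℝ) :=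
  (tapeMat n ω, tapeKeys n ω, tapeStart n ω)

lemma measurePreserving_tapeSeeds (hn : 0 < n) :
    MeasurePreserving (tapeSeeds n) tapeLaw
      ((matLaw n).prod ((gaussianPi (Fin n)).prod (startLaw n))) := by
  have h0 : MeasurePreserving (fun ω i => ω (tapeIndex n i)) tapeLaw (gaussianPi _) :=
    ⟨by fun_prop, by
      have h := Measure.map_infinitePi_infinitePi_of_inj
        (P := fun _ : ℕ × ℕ × ℕ => gaussianReal 0 1) (tapeIndex_injective hn)
      rwa [Measure.infinitePi_eq_pi (ι := _ ⊕ _)] at h⟩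
  have h1 := ((gaussianPi_curry (Fin n) (Fin n)).prod ((MeasurePreserving.id _).prod
    (gaussianPi_curry (Fin 3) (Fin n)))).comp (((MeasurePreserving.id _).prod
      (gaussianPi_sum (Fin n) (Fin 3 × Fin n))).comp ((gaussianPi_sum _ _).comp h0))
  convert h1 using 1
  ext ω
  · rfl
  · rfl
  · change tapeStart n ω _ _ = ω (tapeIndex n (.inr (.inr (_, _))))
    simp only [tapeStart, tapeIndex]
    split_ifs <;> rfl

/-- Coupling: the coins are read off the same tape. Almost surely the Gram–Schmidt matrix is
orthogonal and the keys are distinct; then the program uses `Q` where the algorithm uses `D Q` with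
starts multiplied by `D`, and `recoverMat_flip` says that the outputs coincide. -/
lemma recoverP_law (hn : 0 < n) (T : Tensor n) (k : ℕ) {S : Set (EuclideanSpace ℝ (Fin n))}
    (hS : MeasurableSet S) :
    tapeLaw {ω | recoverP.output T k ω ∈ S} = coinLaw n {ρ | recover T k ρ ∈ S} := by
  have hp := (measurePreserving_coins hn).comp (measurePreserving_tapeSeeds hn)
  have hS' : MeasurableSet {ρ | recover T k ρ ∈ S} := measurable_recover T k hS
  rw [← hp.measure_preimage hS'.nullMeasurableSet]
  have hq := (measurePreserving_tapeSeeds hn).quasiMeasurePreserving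
  have h1 := (Measure.quasiMeasurePreserving_fst.comp hq).ae ae_gsMat_mul_transpose
  have h2 := ((Measure.quasiMeasurePreserving_fst.comp
    Measure.quasiMeasurePreserving_snd).comp hq).ae gaussianPi_ae_injective
  refine measure_congr ?_
  filter_upwards [h1, h2] with ω hG hs
  have hG' : gsMat (tapeMat n ω) * (gsMat (tapeMat n ω))ᵀ = 1 := hG
  have h : recoverP.output T k ω = recover T k
      (coins hn (tapeSeeds n ω)) := by
    rw [recoverP_output T k hs, recover_eq]
    have h3 : (coins hn (tapeSeeds n ω)).1.1 =
        Matrix.diagonal (gsSigns (tapeMat n ω)) * gsMat (tapeMat n ω) := gsRot_val hn hG'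
    rw [h3]
    exact (recoverMat_flip (gsSigns_mul_self hG') T _ _ _ k).symm
  refine propext ?_
  change recoverP.output T k ω ∈ S ↔ recover T k (coins hn (tapeSeeds n ω)) ∈ S
  rw [h]

end SpikedTensor
-- The recovery guarantee and the running time combined
theorem mainTheorem5 :
    ∃ (C κ : ℝ) (p : ℕ) (prog : RealMachine.Program), 0 < C ∧ 0 < κ ∧
      ∀ n : ℕ, 2 ≤ n → ∀ ε : ℝ, Real.log n / Real.sqrt n ≤ ε →
        -- recovery, and convergence of the power method, with high probability
        (∀ τ : ℝ, (n : ℝ) ^ (3 / 4 : ℝ) / ε ≤ τ →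
          ∀ v₀ : EuclideanSpace ℝ (Fin n), ‖v₀‖ = 1 →
            ((SpikedTensor.noiseLaw n).prod (SpikedTensor.coinLaw n))
              {ω | ¬ ∀ k : ℕ, κ * Real.log n ^ p * max 1 (Real.log (1 / ε)) ≤ k →
                (∀ (a : Fin 3) (w : EuclideanSpace ℝ (Fin n)),
                  SpikedTensor.IsTopSingularVector
                    (SpikedTensor.blockMatrix (SpikedTensor.spikedTensor τ v₀ ω.1)
                      ω.2.1 ω.2.2.1 a) w →
                  ∃ s : ℝ, (s = 1 ∨ s = -1) ∧
                    ‖SpikedTensor.iterate (SpikedTensor.spikedTensor τ v₀ ω.1) ω.2 k a - s • w‖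
                      ≤ C * ε) ∧
                1 - C * ε ≤
                  inner ℝ (SpikedTensor.recover (SpikedTensor.spikedTensor τ v₀ ω.1) k ω.2) v₀}
              ≤ ENNReal.ofReal (C / (n : ℝ) ^ 10)) ∧
        -- implementation in almost linear time
        (∀ T : SpikedTensor.Tensor n,
          (∀ (k : ℕ) (S : Set (EuclideanSpace ℝ (Fin n))), MeasurableSet S →
            RealMachine.tapeLaw {ω | prog.output T k ω ∈ S} =
              SpikedTensor.coinLaw n {ρ | SpikedTensor.recover T k ρ ∈ S}) ∧
          ∀ ω : RealMachine.Tape,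
            (prog.time T ⌈κ * Real.log n ^ p * max 1 (Real.log (1 / ε))⌉₊ ω : ℝ) ≤
              C * (n : ℝ) ^ 3 * Real.log n ^ p * max 1 (Real.log (1 / ε))) := by
  obtain ⟨C₀, hC₀, hrec⟩ := SpikedTensor.exists_recovery_const
  -- One logarithm suffices, so `p = 1`, and `18` is the iteration constant of the recovery bound.
  -- The summand `220000 = 10000 * 22` covers the running time.
  refine ⟨C₀ + 220000, 18, 1, RealMachine.recoverP, by positivity, by norm_num,
    fun n hn ε hε => ⟨fun τ hτ v₀ hv => ?_, fun T => ⟨fun k S hS =>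
      SpikedTensor.recoverP_law (by omega) T k hS, fun ω => ?_⟩⟩⟩
  · refine (measure_mono fun ω hω => ?_).trans (hrec _ (by linarith) n hn ε hε τ hτ v₀ hv)
    refine fun h => hω fun k hk => h k (le_trans ?_ hk)
    have h0 : 0 ≤ Real.log n := Real.log_natCast_nonneg n
    rw [pow_one]
    -- The factor `L ≥ 1` only increases the number of iterations, and recovery holds for all larger
    -- `k`.
    exact le_mul_of_one_le_right (by positivity) (le_max_left _ _)
  · set L := max 1 (Real.log (1 / ε))
    have hL : 1 ≤ L := le_max_left _ _
    rw [pow_one]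
    have hlog : 1 / 2 ≤ Real.log n := by
      have h1 := Real.log_two_gt_d9
      have h2 : Real.log 2 ≤ Real.log n := Real.log_le_log two_pos (by exact_mod_cast hn)
      linarith
    have hlL : Real.log n ≤ Real.log n * L := le_mul_of_one_le_right (by linarith) hL
    set k := ⌈18 * Real.log n * L⌉₊
    have hk : (k : ℝ) < 18 * Real.log n * L + 1 := Nat.ceil_lt_add_one (by nlinarith)
    have htime : RealMachine.recoverP.time T k ω ≤ 10000 * (n ^ 3 * (k + 1)) :=
      (RealMachine.Program.exec_time_le _ (fun _ => le_rfl) _).trans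
        (RealMachine.recoverP_cost_le (by omega) k)
    have htime' : (RealMachine.recoverP.time T k ω : ℝ) ≤ 10000 * ((n : ℝ) ^ 3 * (k + 1)) := by
      exact_mod_cast htime
    have hn3 : (0 : ℝ) ≤ (n : ℝ) ^ 3 := by positivity
    -- Rounding up and the extra unit cost `2 ≤ 4 * (log n * L)`, since `log n ≥ log 2 ≥ 1 / 2`.
    have hk1 : (k : ℝ) + 1 ≤ 22 * (Real.log n * L) := by linarith
    calc (RealMachine.recoverP.time T k ω : ℝ)
        ≤ 10000 * ((n : ℝ) ^ 3 * (k + 1)) := htime'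
      _ ≤ 10000 * ((n : ℝ) ^ 3 * (22 * (Real.log n * L))) := by gcongr
      _ = 220000 * ((n : ℝ) ^ 3 * (Real.log n * L)) := by ring
      _ ≤ (C₀ + 220000) * ((n : ℝ) ^ 3 * (Real.log n * L)) := by
        refine mul_le_mul_of_nonneg_right (by linarith) (mul_nonneg hn3 (by linarith))
      _ = (C₀ + 220000) * (n : ℝ) ^ 3 * Real.log n * L := by ring

end
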